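/- Lemma 2.2. Let $q_1,q_2,q_3\in L^1[0,\pi]$ be real-valued, let $h_1,h_2,h_3\in\mathbb R\setminus\{0\}$, $a>0$, $b\in\mathbb R$ with $|a-1|+|b|>0$, and let $0<d<\pi$. For $\lambda\in\mathbb C$ and $j=1,2,3$ let $\varphi_j(\cdot,\lambda)$ be the solution of $$-y''+q_j(x)y=\lambda y\ \text{ on }(0,\pi),\qquad y(0)=1,\quad y'(0)=h_j,$$ where $\varphi_1$ in addition satisfies the jump conditions $$y(d+0)=a\,y(d-0),\qquad y'(d+0)=\tfrac1a\,y'(d-0)+b\,y(d-0)$$ (so $\varphi_1$ solves the equation on $(0,d)$ and on $(d,\pi)$). Solutions are understood with $y,y'$ absolutely continuous (on $[0,\pi]$ for $j=2,3$, and on each side of $d$ for $j=1$) and the equation holding almost everywhere. Let $$\omega(\lambda)=\begin{vmatrix}\varphi_1(\pi,\lambda)&-\varphi_2(\pi,\lambda)&0\\ \varphi_1(\pi,\lambda)&0&-\varphi_3(\pi,\lambda)\\ \varphi_1'(\pi,\lambda)&\varphi_2'(\pi,\lambda)&\varphi_3'(\pi,\lambda)\end{vmatrix}.$$ Then $\omega$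 is an entire function of growth order $\tfrac12$, that is, $\limsup_{r\to\infty}\frac{\log\log\max_{|\lambda|=r}|\omega(\lambda)|}{\log r}=\tfrac12$, and all its zeros are real. If moreover $\frac{a^2-1}{a^2+1}<\frac34$, then the zeros of $\omega$, each repeated according to its multiplicity, can be arranged into three real sequences $\{\lambda_{n,1}\}_{n\ge1},\{\lambda_{n,2}\}_{n\ge1},\{\lambda_{n,3}\}_{n\ge1}$ such that, as $n\to\infty$, $$\sqrt{\lambda_{n,1}}=n-1+O(1),\qquad \sqrt{\lambda_{n,i}}=n-\tfrac12+O(1)\quad(i=2,3),$$ where $\sqrt{\cdot}$ is the principal square root. -/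

import Mathlib

open MeasureTheory Filter Asymptotics

namespace StarSL

/-- `y` (with derivative `y'`) solves `-y'' + q y = lam y` on `[s, t]` in the usual sense for an
integrable potential: `y` and `y'` are absolutely continuous on `[s, t]` and the equation, written
as `(y')' = (q - lam) y`, holds almost everywhere. -/
structure SolvesOn (q : ℝ → ℝ) (lam : ℂ) (s t : ℝ) (y y' : ℝ → ℂ) : Prop where
  ac : AbsolutelyContinuousOnInterval y s t
  ac_deriv : AbsolutelyContinuousOnInterval y' s t
  hasDerivAt : ∀ x ∈ Set.Ioo s t, HasDerivAt y (y' x) x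
  equation : ∀ᵐ x : ℝ, x ∈ Set.Ioo s t → HasDerivAt y' (((q x : ℂ) - lam) * y x) x

/-- The solution `(y, y')` on `[s, t]` of the initial value problem
`-y'' + q y = lam y`, `y s = c`, `y' s = c'`. For `q` integrable on `[s, t]` and `s < t` it exists
and its values on `[s, t]` are unique; the values outside `[s, t]` are never used below. -/
noncomputable def ivpSol (q : ℝ → ℝ) (lam : ℂ) (s t : ℝ) (c c' : ℂ) : (ℝ → ℂ) × (ℝ → ℂ) :=
  Classical.epsilon fun p : (ℝ → ℂ) × (ℝ → ℂ) =>
    SolvesOn q lam s t p.1 p.2 ∧ p.1 s = c ∧ p.2 s = c'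

/-- `(φ, φ')` on an edge without jump: `-φ'' + q φ = lam φ` on `[0, π]`,
`φ 0 = 1`, `φ' 0 = h`. -/
noncomputable def phi (q : ℝ → ℝ) (h : ℝ) (lam : ℂ) : (ℝ → ℂ) × (ℝ → ℂ) :=
  ivpSol q lam 0 Real.pi 1 h

/-- The part of `(φ₁, φ₁')` on `[0, d]`, before the jump; its value at `d` is the left limit
`(φ₁ (d - 0), φ₁' (d - 0))`. -/
noncomputable def phiLeft (q : ℝ → ℝ) (h d : ℝ) (lam : ℂ) : (ℝ → ℂ) × (ℝ → ℂ) :=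
  ivpSol q lam 0 d 1 h

/-- The part of `(φ₁, φ₁')` on `[d, π]`, after the jump; its value at `d` is the right limit, given
by the jump conditions `φ₁ (d + 0) = a φ₁ (d - 0)` and
`φ₁' (d + 0) = a⁻¹ φ₁' (d - 0) + b φ₁ (d - 0)`. -/
noncomputable def phiRight (q : ℝ → ℝ) (h a d b : ℝ) (lam : ℂ) : (ℝ → ℂ) × (ℝ → ℂ) :=
  ivpSol q lam d Real.pi
    ((a : ℂ) * (phiLeft q h d lam).1 d)
    ((a : ℂ)⁻¹ * (phiLeft q h d lam).2 d + (b : ℂ) * (phiLeft q h d lam).1 d)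

/-- The characteristic function `ω` of the problem `L(q₁,q₂,q₃;h₁,h₂,h₃;a,d,b)` on the three-star
graph, with the jump at `d` on the first edge. -/
noncomputable def charFun (q₁ q₂ q₃ : ℝ → ℝ) (h₁ h₂ h₃ a d b : ℝ) (lam : ℂ) : ℂ :=
  let φ₁ := phiRight q₁ h₁ a d b lam
  let φ₂ := phi q₂ h₂ lam
  let φ₃ := phi q₃ h₃ lam
  Matrix.det
    !![φ₁.1 Real.pi, -φ₂.1 Real.pi, 0;
       φ₁.1 Real.pi, 0, -φ₃.1 Real.pi;
       φ₁.2 Real.pi, φ₂.2 Real.pi, φ₃.2 Real.pi]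

/-- The maximum modulus of `f` on the circle `|z| = r`. -/
noncomputable def maxModulus (f : ℂ → ℂ) (r : ℝ) : ℝ :=
  sSup ((fun z => ‖f z‖) '' Metric.sphere (0 : ℂ) r)

/-- The growth order of an entire function,
the upper limit of `log (log M(r)) / log r` as `r → ∞`. -/
noncomputable def growthOrder (f : ℂ → ℂ) : EReal :=
  limsup (fun r : ℝ =>
    ((Real.log (Real.log (maxModulus f r)) / Real.log r : ℝ) : EReal)) atTop

end StarSL

/-!
Write `gⱼ = φⱼ (π, ·)` and `fⱼ = φⱼ' (π, ·)`. Expanding the determinant gives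
`ω = f₁ g₂ g₃ + g₁ f₂ g₃ + g₁ g₂ f₃`, the numerator of the sum `m` of the three quotients `fⱼ / gⱼ`
(`charFun_eq_pairSum`).

Lagrange's identity `f(λ) g(μ) - g(λ) f(μ) = (μ - λ) ∫ y(·, λ) y(·, μ)`, which the unimodular jump
condition leaves intact, makes each `fⱼ / gⱼ` the negative of a Herglotz function
(`HerglotzPair`): its imaginary part has the sign opposite to that of `Im λ`, and on the real axis
it decreases strictly. Hence so does `m`. Off the real axis `m` therefore does not vanish, so the
zeros of `ω` are real (`pairSum_ne_zero`). On the axis `m` runs from `+∞` to `-∞` between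
consecutive poles, and at a point where `k ≥ 1` of the `gⱼ` vanish the residues add up without
cancellation, so that `ω` has a zero of order exactly `k - 1` there. It follows that on every
interval the number of zeros of `ω` differs by at most one from the number of zeros of
`g₁`, `g₂`, `g₃` together, multiplicities included (`mass_pairSum`).

It remains to count the zeros of each `gⱼ`. For `j = 2, 3` the comparison with `cos (π √λ)` gives
`R + O(1)` zeros below `R ^ 2`. For the edge with the jump, `g₁` is itself the numerator of a sum
of two such quotients, one for each side of `d`: with the fundamental system `u`, `v` on `[d, π]`
it is `y (d + 0) u (π) + y' (d + 0) v (π)`. The zeros of the two denominators are counted by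
`R d / π + O(1)` and `R (π - d) / π + O(1)`, whence again `R + O(1)`, for every `a > 0` and `b`
(`countsLike_phiRight`). Thus `ω` has `3 R + O(1)` zeros below `R ^ 2`. Listed in increasing order
they satisfy `√λ_k = k / 3 + O(1)`, and dealing them out by residues modulo `3` gives the three
sequences.

The order `1 / 2` comes from the bound `|ω(λ)| ≤ exp (C (1 + √|λ|))` together with exponential
growth in `√|λ|` along the negative axis, where all the terms of `ω` are non-negative
(`growthOrder_eq_half`).
-/

namespace StarSL

open Set Topology ComplexConjugate

/-! ### Absolutely continuous functions -/

lemma ac_const (c : ℂ) (s t : ℝ) : AbsolutelyContinuousOnInterval (fun _ : ℝ => c) s t := by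
  simp [AbsolutelyContinuousOnInterval, tendsto_const_nhds]

/-- The primitive of an integrable complex-valued function is absolutely continuous. -/
lemma ac_integral {g : ℝ → ℂ} {s t : ℝ} (hg : IntervalIntegrable g volume s t) :
    AbsolutelyContinuousOnInterval (fun x => ∫ r in s..x, g r) s t := by
  have hre : IntervalIntegrable (fun x => (g x).re) volume s t :=
    ⟨hg.1.re, hg.2.re⟩
  have him : IntervalIntegrable (fun x => (g x).im) volume s t :=
    ⟨hg.1.im, hg.2.im⟩
  have h1 := (hre.absolutelyContinuousOnInterval_intervalIntegral (c := s) (by simp)).fun_smul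
    (ac_const 1 s t)
  have h2 := (him.absolutelyContinuousOnInterval_intervalIntegral (c := s) (by simp)).fun_smul
    (ac_const Complex.I s t)
  have h3 := h1.fun_add h2
  have key : ∀ x ∈ uIcc s t, (∫ r in s..x, (g r).re) • (1 : ℂ) +
      (∫ r in s..x, (g r).im) • Complex.I = ∫ r in s..x, g r := by
    intro x hx
    have hsub : uIcc s x ⊆ uIcc s t := uIcc_subset_uIcc_left hx
    have hgx := hg.mono_set hsub
    have e1 := hre.mono_set hsub
    have e2 := him.mono_set hsub
    rw [← intervalIntegral.integral_smul_const, ← intervalIntegral.integral_smul_const,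
      ← intervalIntegral.integral_add]
    · refine intervalIntegral.integral_congr fun r _ => ?_
      simp [Complex.re_add_im]
    · exact ⟨e1.1.smul_const _, e1.2.smul_const _⟩
    · exact ⟨e2.1.smul_const _, e2.2.smul_const _⟩
  rw [absolutelyContinuousOnInterval_iff] at h3 ⊢
  intro ε hε
  obtain ⟨δ, hδ, H⟩ := h3 ε hε
  refine ⟨δ, hδ, fun E hE hl => lt_of_eq_of_lt (Finset.sum_congr rfl fun i hi => ?_) (H E hE hl)⟩
  have := hE.1 i hi
  rw [key _ this.1, key _ this.2]

/-- The fundamental theorem of calculus for complex-valued absolutely continuous functions. -/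
lemma eq_integral_of_ac {y g : ℝ → ℂ} {s t : ℝ} (hst : s ≤ t)
    (hy : AbsolutelyContinuousOnInterval y s t) (hg : IntervalIntegrable g volume s t)
    (hd : ∀ᵐ x : ℝ, x ∈ Ioo s t → HasDerivAt y (g x) x) {x : ℝ} (hx : x ∈ Icc s t) :
    y x = y s + ∫ r in s..x, g r := by
  have hac := hy.fun_sub (ac_integral hg)
  have hne : ∀ c : ℝ, ∀ᵐ x : ℝ, x ≠ c := fun c => by
    simp [ae_iff]
  obtain ⟨C, hC⟩ := hac.const_of_ae_hasDerivAt_zero (by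
    filter_upwards [hd, hg.ae_hasDerivAt_integral, hne s, hne t] with z h1 h2 h3 h4 hz
    have hz' : z ∈ Ioo s t := by
      rw [uIcc_of_le hst] at hz
      exact ⟨lt_of_le_of_ne hz.1 (Ne.symm h3), lt_of_le_of_ne hz.2 h4⟩
    simpa using (h1 hz').fun_sub (h2 hz s (by simp)))
  have h1 := hC s (by simp)
  have h2 := hC x (by rwa [uIcc_of_le hst])
  simp only [intervalIntegral.integral_same, sub_zero] at h1
  rw [← h1] at h2
  linear_combination h2

lemma integral_eq_sub_of_ac {y g : ℝ → ℂ} {s t : ℝ} (hst : s ≤ t)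
    (hy : AbsolutelyContinuousOnInterval y s t) (hg : IntervalIntegrable g volume s t)
    (hd : ∀ᵐ x : ℝ, x ∈ Ioo s t → HasDerivAt y (g x) x) :
    ∫ r in s..t, g r = y t - y s := by
  rw [eq_integral_of_ac hst hy hg hd (right_mem_Icc.2 hst)]; ring

/-- `∫ w Wⁿ = Wⁿ⁺¹ / (n + 1)` for the primitive `W` of an integrable function `w`. -/
lemma integral_mul_primitive_pow {w : ℝ → ℝ} {s t : ℝ}
    (hw : IntervalIntegrable w volume s t) (n : ℕ) :
    ∫ x in s..t, w x * (∫ r in s..x, w r) ^ n = (∫ r in s..t, w r) ^ (n + 1) / (n + 1) := by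
  set W : ℝ → ℝ := fun x => ∫ r in s..x, w r with hW
  have hac : AbsolutelyContinuousOnInterval W s t :=
    hw.absolutelyContinuousOnInterval_intervalIntegral (by simp)
  have hpow : ∀ k : ℕ, AbsolutelyContinuousOnInterval (fun x => W x ^ k) s t := by
    intro k
    induction k with
    | zero => simp [AbsolutelyContinuousOnInterval, tendsto_const_nhds]
    | succ k ih =>
      simp_rw [pow_succ]
      exact ih.fun_mul hac
  have h1 := (hpow (n + 1)).integral_deriv_eq_sub
  have h2 : ∫ x in s..t, deriv (fun x => W x ^ (n + 1)) x
      = ∫ x in s..t, (n + 1 : ℝ) * (w x * W x ^ n) := by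
    refine intervalIntegral.integral_congr_ae ?_
    filter_upwards [hw.ae_hasDerivAt_integral] with x hx hxm
    have := ((hx (uIoc_subset_uIcc hxm) s (by simp)).fun_pow (n + 1)).deriv
    rw [this]
    push_cast
    simp only [W]
    ring
  rw [h2, intervalIntegral.integral_const_mul] at h1
  have h0 : W s = 0 := by simp [hW]
  rw [h0] at h1
  have : (n + 1 : ℝ) ≠ 0 := by positivity
  rw [eq_div_iff this, mul_comm, h1]
  simp [hW]

/-! ### The Volterra operator of the first order system -/

lemma isUnit_one_sub_of_norm_pow_le {R : Type*} [NormedRing R] [CompleteSpace R] (V : R) (w : ℝ)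
    (h : ∀ n : ℕ, ‖V ^ n‖ ≤ w ^ n / n.factorial) : IsUnit (1 - V) := by
  obtain ⟨n, hn⟩ := ((FloorSemiring.tendsto_pow_div_factorial_atTop w).eventually
    (gt_mem_nhds one_pos)).exists
  have h1 : IsUnit (1 - V ^ n) := isUnit_one_sub_of_norm_lt_one ((h n).trans_lt hn)
  rw [← mul_neg_geom_sum] at h1
  have hcomm : Commute (1 - V) (∑ i ∈ Finset.range n, V ^ i) := by
    rw [Commute, SemiconjBy, mul_neg_geom_sum, geom_sum_mul_neg]
  exact (hcomm.isUnit_mul_iff.1 h1).1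

lemma differentiable_inverse_one_sub_affine {R : Type*} [NormedRing R] [NormedAlgebra ℂ R]
    [CompleteSpace R] (A B : R) (h : ∀ lam : ℂ, IsUnit (1 - (A + lam • B))) :
    Differentiable ℂ fun lam : ℂ => Ring.inverse (1 - (A + lam • B)) := by
  intro lam
  have h1 : DifferentiableAt ℂ (fun lam : ℂ => 1 - (A + lam • B)) lam := by fun_prop
  exact DifferentiableAt.comp (𝕜 := ℂ) (g := Ring.inverse)
    (f := fun lam : ℂ => 1 - (A + lam • B)) lam (differentiableAt_inverse (h lam)) h1

section Volterra

variable {s t : ℝ}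

/-- The Volterra operator `u ↦ ∫ₛ w u` on the continuous functions on `[s, t]`. -/
noncomputable def volterra (hst : s ≤ t) (w : ℝ → ℂ) (hw : IntervalIntegrable w volume s t) :
    C(Icc s t, ℂ) →L[ℂ] C(Icc s t, ℂ) :=
  have hint : ∀ u : C(Icc s t, ℂ),
      IntervalIntegrable (fun r => w r * IccExtend hst u r) volume s t := fun u =>
    hw.mul_continuousOn (u.continuous.Icc_extend' (h := hst)).continuousOn
  LinearMap.mkContinuous
    { toFun := fun u => ⟨fun x => ∫ r in s..x, w r * IccExtend hst u r, by
        have h := (ac_integral (hint u)).continuousOn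
        rw [uIcc_of_le hst] at h
        exact continuousOn_iff_continuous_domRestrict.1 h⟩
      map_add' := fun u v => by
        ext x
        have hsub : uIcc s (x : ℝ) ⊆ uIcc s t :=
          uIcc_subset_uIcc_left (by rw [uIcc_of_le hst]; exact x.2)
        change ∫ r in s..(x : ℝ), w r * IccExtend hst (u + v) r
          = (∫ r in s..(x : ℝ), w r * IccExtend hst u r)
            + ∫ r in s..(x : ℝ), w r * IccExtend hst v r
        rw [← intervalIntegral.integral_add ((hint u).mono_set hsub) ((hint v).mono_set hsub)]
        refine intervalIntegral.integral_congr fun r _ => ?_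
        simp [IccExtend, mul_add]
      map_smul' := fun c u => by
        ext x
        change ∫ r in s..(x : ℝ), w r * IccExtend hst (c • u) r
          = c * ∫ r in s..(x : ℝ), w r * IccExtend hst u r
        rw [← intervalIntegral.integral_const_mul]
        refine intervalIntegral.integral_congr fun r _ => ?_
        simp [IccExtend, mul_left_comm] }
    (∫ r in s..t, ‖w r‖)
    (fun u => by
      have h0 : 0 ≤ ∫ r in s..t, ‖w r‖ :=
        intervalIntegral.integral_nonneg hst fun _ _ => norm_nonneg _
      rw [ContinuousMap.norm_le _ (by positivity)]
      intro x
      have hsub : uIcc s (x : ℝ) ⊆ uIcc s t :=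
        uIcc_subset_uIcc_left (by rw [uIcc_of_le hst]; exact x.2)
      have hnw : IntervalIntegrable (fun r => ‖w r‖) volume s t := hw.norm
      calc ‖∫ r in s..(x : ℝ), w r * IccExtend hst u r‖
          ≤ ∫ r in s..(x : ℝ), ‖w r‖ * ‖u‖ := by
            refine intervalIntegral.norm_integral_le_of_norm_le x.2.1
              (Eventually.of_forall fun r _ => ?_) ((hnw.mono_set hsub).mul_const _)
            rw [norm_mul]
            gcongr
            exact u.norm_coe_le_norm _
        _ = (∫ r in s..(x : ℝ), ‖w r‖) * ‖u‖ := intervalIntegral.integral_mul_const _ _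
        _ ≤ (∫ r in s..t, ‖w r‖) * ‖u‖ := by
            gcongr
            exact intervalIntegral.integral_mono_interval le_rfl x.2.1 x.2.2
              (Eventually.of_forall fun _ => norm_nonneg _) hnw)

lemma volterra_apply (hst : s ≤ t) (w : ℝ → ℂ) (hw : IntervalIntegrable w volume s t)
    (u : C(Icc s t, ℂ)) (x : Icc s t) :
    volterra hst w hw u x = ∫ r in s..(x : ℝ), w r * IccExtend hst u r := rfl

/-- The integral operator of the system `y' = p`, `p' = (q - lam) y`:
the solutions of the system are the fixed points of `(c, c') + systemOp`. -/
noncomputable def systemOp (hst : s ≤ t) (q : ℝ → ℂ) (hq : IntervalIntegrable q volume s t)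
    (lam : ℂ) : (C(Icc s t, ℂ) × C(Icc s t, ℂ)) →L[ℂ] (C(Icc s t, ℂ) × C(Icc s t, ℂ)) :=
  ((volterra hst (fun _ => 1) intervalIntegrable_const).comp
      (ContinuousLinearMap.snd ℂ C(Icc s t, ℂ) C(Icc s t, ℂ))).prod
    ((volterra hst q hq - lam • volterra hst (fun _ => 1) intervalIntegrable_const).comp
      (ContinuousLinearMap.fst ℂ C(Icc s t, ℂ) C(Icc s t, ℂ)))

lemma systemOp_fst (hst : s ≤ t) (q : ℝ → ℂ) (hq : IntervalIntegrable q volume s t) (lam : ℂ)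
    (z : C(Icc s t, ℂ) × C(Icc s t, ℂ)) (x : Icc s t) :
    (systemOp hst q hq lam z).1 x = ∫ r in s..(x : ℝ), IccExtend hst z.2 r := by
  simp [systemOp, volterra_apply]

lemma systemOp_snd (hst : s ≤ t) (q : ℝ → ℂ) (hq : IntervalIntegrable q volume s t) (lam : ℂ)
    (z : C(Icc s t, ℂ) × C(Icc s t, ℂ)) (x : Icc s t) :
    (systemOp hst q hq lam z).2 x = ∫ r in s..(x : ℝ), (q r - lam) * IccExtend hst z.1 r := by
  have hsub : uIcc s (x : ℝ) ⊆ uIcc s t :=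
    uIcc_subset_uIcc_left (by rw [uIcc_of_le hst]; exact x.2)
  have hc : ContinuousOn (IccExtend hst z.1) (uIcc s (x : ℝ)) :=
    (z.1.continuous.Icc_extend' (h := hst)).continuousOn
  simp only [systemOp, ContinuousLinearMap.prod_apply, ContinuousLinearMap.comp_apply,
    ContinuousLinearMap.coe_fst', sub_apply, smul_apply,
    ContinuousMap.sub_apply, ContinuousMap.smul_apply, volterra_apply, smul_eq_mul, one_mul]
  rw [← intervalIntegral.integral_const_mul, ← intervalIntegral.integral_sub]
  · exact intervalIntegral.integral_congr fun r _ => by simp [sub_mul]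
  · exact (hq.mono_set hsub).mul_continuousOn hc
  · exact (continuousOn_const.mul hc).intervalIntegrable

/-- The iterates of the Volterra operator decay factorially. -/
lemma norm_systemOp_pow_le (hst : s ≤ t) (q : ℝ → ℂ) (hq : IntervalIntegrable q volume s t)
    (lam : ℂ) (n : ℕ) (z : C(Icc s t, ℂ) × C(Icc s t, ℂ)) (x : Icc s t) :
    ‖((systemOp hst q hq lam ^ n) z).1 x‖
        ≤ (∫ r in s..(x : ℝ), (1 + ‖q r - lam‖)) ^ n / n.factorial * ‖z‖ ∧
      ‖((systemOp hst q hq lam ^ n) z).2 x‖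
        ≤ (∫ r in s..(x : ℝ), (1 + ‖q r - lam‖)) ^ n / n.factorial * ‖z‖ := by
  induction n generalizing x with
  | zero =>
    simp only [pow_zero, one_apply_eq_self, Nat.factorial_zero, Nat.cast_one, div_one,
      one_mul]
    exact ⟨(z.1.norm_coe_le_norm x).trans (norm_fst_le z),
      (z.2.norm_coe_le_norm x).trans (norm_snd_le z)⟩
  | succ n ih =>
    have hwt : IntervalIntegrable (fun r => 1 + ‖q r - lam‖) volume s t :=
      intervalIntegrable_const.add (hq.sub intervalIntegrable_const).norm
    have hsub : uIcc s (x : ℝ) ⊆ uIcc s t :=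
      uIcc_subset_uIcc_left (by rw [uIcc_of_le hst]; exact x.2)
    have hw := hwt.mono_set hsub
    set W : ℝ → ℝ := fun x => ∫ r in s..x, (1 + ‖q r - lam‖) with hW
    have hWc : ContinuousOn W (uIcc s (x : ℝ)) :=
      (hw.absolutelyContinuousOnInterval_intervalIntegral (c := s) (by simp)).continuousOn
    have hint : IntervalIntegrable
        (fun r => (1 + ‖q r - lam‖) * W r ^ n * (‖z‖ / n.factorial)) volume s x :=
      (hw.mul_continuousOn (hWc.pow n)).mul_const _
    have hval : ∫ r in s..(x : ℝ), (1 + ‖q r - lam‖) * W r ^ n * (‖z‖ / n.factorial)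
        = W x ^ (n + 1) / (n + 1).factorial * ‖z‖ := by
      rw [intervalIntegral.integral_mul_const, integral_mul_primitive_pow hw n,
        Nat.factorial_succ]
      push_cast
      have : (n.factorial : ℝ) ≠ 0 := by positivity
      field_simp
      rw [hW, mul_comm]
    have hW0 : ∀ r ∈ Ioc s (x : ℝ), 0 ≤ W r := fun r hr =>
      intervalIntegral.integral_nonneg hr.1.le fun _ _ => by positivity
    have hext : ∀ (u : C(Icc s t, ℂ)) (r : ℝ) (hr : r ∈ Ioc s (x : ℝ)),
        IccExtend hst u r = u ⟨r, hr.1.le, hr.2.trans x.2.2⟩ := fun u r hr =>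
      IccExtend_of_mem hst u _
    rw [pow_succ']
    constructor
    · rw [mul_apply_eq_comp, systemOp_fst, ← hval]
      refine intervalIntegral.norm_integral_le_of_norm_le x.2.1
        (Eventually.of_forall fun r hr => ?_) hint
      rw [hext _ r hr]
      refine (ih ⟨r, hr.1.le, hr.2.trans x.2.2⟩).2.trans ?_
      have h1 : W r ^ n / n.factorial * ‖z‖ = 1 * W r ^ n * (‖z‖ / n.factorial) := by ring
      have h2 := hW0 r hr
      change W r ^ n / n.factorial * ‖z‖ ≤ _
      rw [h1]
      gcongr
      linarith [norm_nonneg (q r - lam)]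
    · rw [mul_apply_eq_comp, systemOp_snd, ← hval]
      refine intervalIntegral.norm_integral_le_of_norm_le x.2.1
        (Eventually.of_forall fun r hr => ?_) hint
      rw [hext _ r hr, norm_mul]
      have h3 := (ih ⟨r, hr.1.le, hr.2.trans x.2.2⟩).1
      have h1 : (1 + ‖q r - lam‖) * W r ^ n * (‖z‖ / n.factorial)
        = (1 + ‖q r - lam‖) * (W r ^ n / n.factorial * ‖z‖) := by ring
      have h2 := hW0 r hr
      rw [h1]
      change _ ≤ W r ^ n / n.factorial * ‖z‖ at h3
      gcongr
      linarith [norm_nonneg (q r - lam)]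

/-- The system operator is quasi-nilpotent, so that `1 - systemOp` is invertible. -/
lemma isUnit_one_sub_systemOp (hst : s ≤ t) (q : ℝ → ℂ) (hq : IntervalIntegrable q volume s t)
    (lam : ℂ) : IsUnit (1 - systemOp hst q hq lam) := by
  set V := systemOp hst q hq lam
  have hwt : IntervalIntegrable (fun r => 1 + ‖q r - lam‖) volume s t :=
    intervalIntegrable_const.add (hq.sub intervalIntegrable_const).norm
  set w := ∫ r in s..t, (1 + ‖q r - lam‖) with hw
  have hbound : ∀ n : ℕ, ‖V ^ n‖ ≤ w ^ n / n.factorial := by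
    intro n
    have hw0 : 0 ≤ w := intervalIntegral.integral_nonneg hst fun _ _ => by positivity
    refine ContinuousLinearMap.opNorm_le_bound _ (by positivity) fun z => ?_
    have hmono : ∀ x : Icc s t, (∫ r in s..(x : ℝ), (1 + ‖q r - lam‖)) ^ n / n.factorial * ‖z‖
        ≤ w ^ n / n.factorial * ‖z‖ := fun x => by
      have h1 : 0 ≤ ∫ r in s..(x : ℝ), (1 + ‖q r - lam‖) :=
        intervalIntegral.integral_nonneg x.2.1 fun _ _ => by positivity
      have h2 : ∫ r in s..(x : ℝ), (1 + ‖q r - lam‖) ≤ w :=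
        intervalIntegral.integral_mono_interval le_rfl x.2.1 x.2.2
          (Eventually.of_forall fun _ => by positivity) hwt
      gcongr
    rw [Prod.norm_def]
    refine max_le ?_ ?_ <;> rw [ContinuousMap.norm_le _ (by positivity)] <;> intro x
    · exact (norm_systemOp_pow_le hst q hq lam n z x).1.trans (hmono x)
    · exact (norm_systemOp_pow_le hst q hq lam n z x).2.trans (hmono x)
  exact isUnit_one_sub_of_norm_pow_le V w hbound

lemma differentiable_inverse_one_sub_systemOp (hst : s ≤ t) (q : ℝ → ℂ)
    (hq : IntervalIntegrable q volume s t) :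
    Differentiable ℂ fun lam => Ring.inverse (1 - systemOp hst q hq lam) := by
  obtain ⟨B, haff⟩ : ∃ B : (C(Icc s t, ℂ) × C(Icc s t, ℂ)) →L[ℂ] (C(Icc s t, ℂ) × C(Icc s t, ℂ)),
      ∀ lam, systemOp hst q hq lam = systemOp hst q hq 0 + lam • B := by
    refine ⟨-((0 : (C(Icc s t, ℂ) × C(Icc s t, ℂ)) →L[ℂ] C(Icc s t, ℂ)).prod
        ((volterra hst (fun _ => 1) intervalIntegrable_const).comp
          (ContinuousLinearMap.fst ℂ C(Icc s t, ℂ) C(Icc s t, ℂ)))), ?_⟩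
    intro lam
    refine ContinuousLinearMap.ext fun z => Prod.ext (ContinuousMap.ext fun x => ?_)
      (ContinuousMap.ext fun x => ?_)
    · simp only [systemOp, add_apply, smul_apply, neg_apply,
        ContinuousLinearMap.prod_apply, ContinuousLinearMap.comp_apply, zero_apply, sub_apply,
        Prod.smul_mk, Prod.neg_mk, Prod.mk_add_mk, ContinuousMap.add_apply,
        ContinuousMap.smul_apply, ContinuousMap.neg_apply, ContinuousMap.zero_apply, smul_eq_mul]
      ring
    · simp only [systemOp, add_apply, smul_apply, neg_apply,
        ContinuousLinearMap.prod_apply, ContinuousLinearMap.comp_apply, zero_apply, sub_apply,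
        Prod.smul_mk, Prod.neg_mk, Prod.mk_add_mk, ContinuousMap.add_apply, ContinuousMap.sub_apply,
        ContinuousMap.smul_apply, ContinuousMap.neg_apply, smul_eq_mul]
      ring
  have hfun : (fun lam => Ring.inverse (1 - systemOp hst q hq lam))
      = fun lam => Ring.inverse (1 - (systemOp hst q hq 0 + lam • B)) :=
    funext fun lam => congrArg (fun V => Ring.inverse (1 - V)) (haff lam)
  have hunit : ∀ lam : ℂ, IsUnit (1 - (systemOp hst q hq 0 + lam • B)) := fun lam => by
    have h := isUnit_one_sub_systemOp hst q hq lam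
    rwa [haff lam] at h
  rw [hfun]
  exact differentiable_inverse_one_sub_affine (systemOp hst q hq 0) B hunit

/-- The solution of the system with initial data `(c, c')` at `s`, as a pair of continuous
functions. -/
noncomputable def solFamily (hst : s ≤ t) (q : ℝ → ℂ) (hq : IntervalIntegrable q volume s t)
    (c c' : ℂ) (lam : ℂ) : C(Icc s t, ℂ) × C(Icc s t, ℂ) :=
  Ring.inverse (1 - systemOp hst q hq lam) (ContinuousMap.const _ c, ContinuousMap.const _ c')

lemma differentiable_solFamily (hst : s ≤ t) (q : ℝ → ℂ) (hq : IntervalIntegrable q volume s t)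
    (c c' : ℂ) : Differentiable ℂ (solFamily hst q hq c c') :=
  (differentiable_inverse_one_sub_systemOp hst q hq).clm_apply (differentiable_const _)

lemma eq_solFamily_iff (hst : s ≤ t) (q : ℝ → ℂ) (hq : IntervalIntegrable q volume s t)
    (c c' : ℂ) (lam : ℂ) (z : C(Icc s t, ℂ) × C(Icc s t, ℂ)) :
    z = solFamily hst q hq c c' lam ↔
      (∀ x : Icc s t, z.1 x = c + ∫ r in s..(x : ℝ), IccExtend hst z.2 r) ∧
      ∀ x : Icc s t, z.2 x = c' + ∫ r in s..(x : ℝ), (q r - lam) * IccExtend hst z.1 r := by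
  have hunit := isUnit_one_sub_systemOp hst q hq lam
  set V := systemOp hst q hq lam with hV
  have h1 : z = solFamily hst q hq c c' lam ↔
      z - V z = (ContinuousMap.const _ c, ContinuousMap.const _ c') := by
    constructor
    · rintro rfl
      have := congrArg
        (fun T => T (ContinuousMap.const (Icc s t) c, ContinuousMap.const (Icc s t) c'))
        (Ring.mul_inverse_cancel _ hunit)
      simpa [solFamily, mul_apply_eq_comp, ← hV] using this
    · intro h
      have := congrArg (fun T => T z) (Ring.inverse_mul_cancel _ hunit)
      simp only [mul_apply_eq_comp, sub_apply, one_apply_eq_self] at this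
      rw [h] at this
      exact this.symm
  rw [h1, sub_eq_iff_eq_add, Prod.ext_iff, ContinuousMap.ext_iff, ContinuousMap.ext_iff]
  refine and_congr (forall_congr' fun x => ?_) (forall_congr' fun x => ?_)
  · rw [Prod.fst_add, ContinuousMap.add_apply, hV, systemOp_fst]; rfl
  · rw [Prod.snd_add, ContinuousMap.add_apply, hV, systemOp_snd]; rfl

end Volterra

/-! ### The initial value problem -/

section InitialValueProblem

variable {q : ℝ → ℝ} {lam : ℂ} {s t : ℝ} {c c' : ℂ}

lemma intervalIntegrable_ofReal (hq : IntervalIntegrable q volume s t) :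
    IntervalIntegrable (fun r => (q r : ℂ)) volume s t :=
  ⟨hq.1.ofReal, hq.2.ofReal⟩

lemma SolvesOn.continuousOn {y y' : ℝ → ℂ} (h : SolvesOn q lam s t y y') (hst : s ≤ t) :
    ContinuousOn y (Icc s t) ∧ ContinuousOn y' (Icc s t) := by
  have h1 := h.ac.continuousOn
  have h2 := h.ac_deriv.continuousOn
  rw [uIcc_of_le hst] at h1 h2
  exact ⟨h1, h2⟩

lemma SolvesOn.intervalIntegrable {y y' : ℝ → ℂ} (h : SolvesOn q lam s t y y')
    (hq : IntervalIntegrable q volume s t) :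
    IntervalIntegrable y' volume s t ∧
      IntervalIntegrable (fun r => ((q r : ℂ) - lam) * y r) volume s t :=
  ⟨h.ac_deriv.continuousOn.intervalIntegrable,
    ((intervalIntegrable_ofReal hq).sub intervalIntegrable_const).mul_continuousOn
      h.ac.continuousOn⟩

/-- Uniqueness for the initial value problem. -/
lemma SolvesOn.eq_solFamily {y y' : ℝ → ℂ} (hst : s ≤ t) (hq : IntervalIntegrable q volume s t)
    (h : SolvesOn q lam s t y y') (hc : y s = c) (hc' : y' s = c') {x : ℝ} (hx : x ∈ Icc s t) :
    y x = (solFamily hst _ (intervalIntegrable_ofReal hq) c c' lam).1 ⟨x, hx⟩ ∧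
      y' x = (solFamily hst _ (intervalIntegrable_ofReal hq) c c' lam).2 ⟨x, hx⟩ := by
  have hcont := h.continuousOn hst
  have hint := h.intervalIntegrable hq
  set z : C(Icc s t, ℂ) × C(Icc s t, ℂ) :=
    (⟨_, continuousOn_iff_continuous_domRestrict.1 hcont.1⟩,
      ⟨_, continuousOn_iff_continuous_domRestrict.1 hcont.2⟩) with hz
  have key : z = solFamily hst _ (intervalIntegrable_ofReal hq) c c' lam := by
    rw [eq_solFamily_iff]
    constructor <;> intro w
    · have h1 := eq_integral_of_ac hst h.ac hint.1 (Eventually.of_forall h.hasDerivAt) w.2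
      rw [hc] at h1
      refine h1.trans ?_
      congr 1
      refine intervalIntegral.integral_congr fun r hr => ?_
      rw [uIcc_of_le w.2.1] at hr
      rw [IccExtend_of_mem hst _ ⟨hr.1, hr.2.trans w.2.2⟩]
      rfl
    · have h1 := eq_integral_of_ac hst h.ac_deriv hint.2 h.equation w.2
      rw [hc'] at h1
      refine h1.trans ?_
      congr 1
      refine intervalIntegral.integral_congr fun r hr => ?_
      rw [uIcc_of_le w.2.1] at hr
      rw [IccExtend_of_mem hst _ ⟨hr.1, hr.2.trans w.2.2⟩]
      rfl
  rw [← key]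
  exact ⟨rfl, rfl⟩

/-- Existence for the initial value problem. -/
lemma exists_solvesOn (hst : s ≤ t) (hq : IntervalIntegrable q volume s t) (lam c c' : ℂ) :
    ∃ p : (ℝ → ℂ) × (ℝ → ℂ), SolvesOn q lam s t p.1 p.2 ∧ p.1 s = c ∧ p.2 s = c' := by
  set z := solFamily hst _ (intervalIntegrable_ofReal hq) c c' lam with hz
  obtain ⟨h1, h2⟩ := (eq_solFamily_iff hst _ (intervalIntegrable_ofReal hq) c c' lam z).1 hz
  have hc1 : Continuous (IccExtend hst z.1) := z.1.continuous.Icc_extend'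
  have hc2 : Continuous (IccExtend hst z.2) := z.2.continuous.Icc_extend'
  have hi : IntervalIntegrable (fun r => ((q r : ℂ) - lam) * IccExtend hst z.1 r) volume s t :=
    ((intervalIntegrable_ofReal hq).sub intervalIntegrable_const).mul_continuousOn hc1.continuousOn
  refine ⟨(fun x => c + ∫ r in s..x, IccExtend hst z.2 r,
    fun x => c' + ∫ r in s..x, ((q r : ℂ) - lam) * IccExtend hst z.1 r), ⟨?_, ?_, ?_, ?_⟩, ?_, ?_⟩
  · exact (ac_const c s t).fun_add (ac_integral (hc2.intervalIntegrable _ _))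
  · exact (ac_const c' s t).fun_add (ac_integral hi)
  · intro x hx
    have hx' : x ∈ Icc s t := Ioo_subset_Icc_self hx
    have h3 := (intervalIntegral.integral_hasDerivAt_right (hc2.intervalIntegrable s x)
      hc2.stronglyMeasurable.stronglyMeasurableAtFilter hc2.continuousAt).const_add c
    rw [IccExtend_of_mem hst _ hx', h2] at h3
    exact h3
  · filter_upwards [hi.ae_hasDerivAt_integral] with x h3 hx
    have hx' : x ∈ Icc s t := Ioo_subset_Icc_self hx
    have h4 := (h3 (by rwa [uIcc_of_le hst]) s (by simp)).const_add c'
    rw [IccExtend_of_mem hst _ hx', h1] at h4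
    exact h4
  · simp
  · simp

lemma ivpSol_spec (hst : s ≤ t) (hq : IntervalIntegrable q volume s t) (lam c c' : ℂ) :
    SolvesOn q lam s t (ivpSol q lam s t c c').1 (ivpSol q lam s t c c').2 ∧
      (ivpSol q lam s t c c').1 s = c ∧ (ivpSol q lam s t c c').2 s = c' :=
  Classical.epsilon_spec (exists_solvesOn hst hq lam c c')

lemma SolvesOn.eq_ivpSol {y y' : ℝ → ℂ} (hst : s ≤ t) (hq : IntervalIntegrable q volume s t)
    (h : SolvesOn q lam s t y y') {x : ℝ} (hx : x ∈ Icc s t) :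
    y x = (ivpSol q lam s t (y s) (y' s)).1 x ∧ y' x = (ivpSol q lam s t (y s) (y' s)).2 x := by
  obtain ⟨h1, h2, h3⟩ := ivpSol_spec hst hq lam (y s) (y' s)
  have e1 := h.eq_solFamily hst hq rfl rfl hx
  have e2 := h1.eq_solFamily hst hq h2 h3 hx
  exact ⟨e1.1.trans e2.1.symm, e1.2.trans e2.2.symm⟩

/-- The solution and its derivative at a fixed point are entire functions of the spectral
parameter. -/
lemma differentiable_ivpSol (hst : s ≤ t) (hq : IntervalIntegrable q volume s t) (c c' : ℂ)
    {x : ℝ} (hx : x ∈ Icc s t) :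
    Differentiable ℂ (fun lam => (ivpSol q lam s t c c').1 x) ∧
      Differentiable ℂ (fun lam => (ivpSol q lam s t c c').2 x) := by
  have hev : Differentiable ℂ fun u : C(Icc s t, ℂ) => u ⟨x, hx⟩ :=
    (ContinuousMap.evalCLM ℂ (⟨x, hx⟩ : Icc s t) : C(Icc s t, ℂ) →L[ℂ] ℂ).differentiable
  have hd := differentiable_solFamily hst _ (intervalIntegrable_ofReal hq) c c'
  have heq : ∀ lam, _ := fun lam => by
    obtain ⟨h1, h2, h3⟩ := ivpSol_spec hst hq lam c c'
    exact h1.eq_solFamily hst hq h2 h3 hx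
  refine ⟨?_, ?_⟩
  · rw [funext fun lam => (heq lam).1]
    exact hev.comp hd.fst
  · rw [funext fun lam => (heq lam).2]
    exact hev.comp hd.snd

lemma continuous_integral_ivpSol_mul (hst : s ≤ t) (hq : IntervalIntegrable q volume s t)
    (c c' : ℂ) {v : ℝ → ℂ} (hv : ContinuousOn v (Icc s t)) :
    Continuous fun lam => ∫ r in s..t, (ivpSol q lam s t c c').1 r * v r := by
  have hvi : IntervalIntegrable v volume s t := by
    rw [← uIcc_of_le hst] at hv
    exact hv.intervalIntegrable
  have heq : ∀ lam, ∫ r in s..t, (ivpSol q lam s t c c').1 r * v r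
      = volterra hst v hvi (solFamily hst _ (intervalIntegrable_ofReal hq) c c' lam).1
        ⟨t, right_mem_Icc.2 hst⟩ := fun lam => by
    obtain ⟨h1, h2, h3⟩ := ivpSol_spec hst hq lam c c'
    rw [volterra_apply]
    refine intervalIntegral.integral_congr fun r hr => ?_
    rw [uIcc_of_le hst] at hr
    rw [IccExtend_of_mem hst _ hr, mul_comm, (h1.eq_solFamily hst hq h2 h3 hr).1]
  rw [funext heq]
  have hd := (differentiable_solFamily hst _ (intervalIntegrable_ofReal hq) c c').continuous
  exact (ContinuousMap.evalCLM ℂ (⟨t, right_mem_Icc.2 hst⟩ : Icc s t)).continuous.comp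
    ((volterra hst v hvi).continuous.comp hd.fst)

end InitialValueProblem

/-! ### Lagrange's identity -/

section Lagrange

variable {q : ℝ → ℝ} {lam mu : ℂ} {s t : ℝ} {y y' z z' : ℝ → ℂ}

/-- **Lagrange's identity** for solutions belonging to two spectral parameters. -/
lemma SolvesOn.lagrange (hst : s ≤ t)
    (h : SolvesOn q lam s t y y') (k : SolvesOn q mu s t z z') :
    (y' t * z t - y t * z' t) - (y' s * z s - y s * z' s)
      = (mu - lam) * ∫ r in s..t, y r * z r := by
  have hac : AbsolutelyContinuousOnInterval (fun r => y' r * z r - y r * z' r) s t :=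
    (h.ac_deriv.fun_smul k.ac).fun_sub (h.ac.fun_smul k.ac_deriv)
  have hint : IntervalIntegrable (fun r => (mu - lam) * (y r * z r)) volume s t :=
    (continuousOn_const.mul (h.ac.continuousOn.mul k.ac.continuousOn)).intervalIntegrable
  rw [← intervalIntegral.integral_const_mul, integral_eq_sub_of_ac hst hac hint]
  filter_upwards [h.equation, k.equation] with x h1 h2 hx
  have h3 := ((h1 hx).mul (k.hasDerivAt x hx)).sub ((h.hasDerivAt x hx).mul (h2 hx))
  refine h3.congr_deriv ?_
  ring

lemma SolvesOn.linear (h : SolvesOn q lam s t y y') (k : SolvesOn q lam s t z z') (a b : ℂ) :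
    SolvesOn q lam s t (fun r => a * y r + b * z r) (fun r => a * y' r + b * z' r) where
  ac := (h.ac.const_smul a).fun_add (k.ac.const_smul b)
  ac_deriv := (h.ac_deriv.const_smul a).fun_add (k.ac_deriv.const_smul b)
  hasDerivAt x hx := ((h.hasDerivAt x hx).const_mul a).add ((k.hasDerivAt x hx).const_mul b)
  equation := by
    filter_upwards [h.equation, k.equation] with x h1 h2 hx
    refine (((h1 hx).const_mul a).add ((h2 hx).const_mul b)).congr_deriv ?_
    ring

lemma ac_conj (h : AbsolutelyContinuousOnInterval y s t) :
    AbsolutelyContinuousOnInterval (fun r => conj (y r)) s t := by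
  unfold AbsolutelyContinuousOnInterval at h ⊢
  simpa [Complex.dist_conj_conj] using h

lemma SolvesOn.conj (h : SolvesOn q lam s t y y') :
    SolvesOn q (conj lam) s t (fun r => conj (y r)) (fun r => conj (y' r)) where
  ac := ac_conj h.ac
  ac_deriv := ac_conj h.ac_deriv
  hasDerivAt x hx := (h.hasDerivAt x hx).star
  equation := by
    filter_upwards [h.equation] with x h1 hx
    refine (h1 hx).star.congr_deriv ?_
    simp

/-- A solution with non-zero initial data does not vanish identically. -/
lemma SolvesOn.integral_normSq_pos (hst : s < t) (h : SolvesOn q lam s t y y')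
    (h0 : y s ≠ 0 ∨ y' s ≠ 0) : 0 < ∫ r in s..t, ‖y r‖ ^ 2 := by
  obtain ⟨hc, hc'⟩ := h.continuousOn hst.le
  refine intervalIntegral.integral_pos hst (hc.norm.pow 2) (fun _ _ => by positivity) ?_
  by_contra hcon
  push Not at hcon
  have hy : ∀ r ∈ Icc s t, y r = 0 := fun r hr => by
    have := hcon r hr
    have h2 : ‖y r‖ ^ 2 = 0 := le_antisymm this (by positivity)
    simpa using h2
  have hy' : EqOn y' (fun _ => 0) (Ioo s t) := fun r hr => by
    have h1 := h.hasDerivAt r hr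
    have h2 : HasDerivAt y 0 r := (hasDerivAt_const r (0 : ℂ)).congr_of_eventuallyEq
      (by filter_upwards [Ioo_mem_nhds hr.1 hr.2] with w hw using hy w (Ioo_subset_Icc_self hw))
    exact h1.unique h2
  have hy'' : EqOn y' (fun _ => 0) (Icc s t) :=
    hy'.of_subset_closure hc' continuousOn_const Ioo_subset_Icc_self
      (by rw [closure_Ioo hst.ne])
  rcases h0 with h0 | h0
  · exact h0 (hy s (left_mem_Icc.2 hst.le))
  · exact h0 (hy'' (left_mem_Icc.2 hst.le))

lemma SolvesOn.integral_mul_conj (y : ℝ → ℂ) :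
    ∫ r in s..t, y r * conj (y r) = ((∫ r in s..t, ‖y r‖ ^ 2 : ℝ) : ℂ) := by
  rw [← intervalIntegral.integral_ofReal]
  refine intervalIntegral.integral_congr fun r _ => ?_
  simp [Complex.mul_conj, Complex.normSq_eq_norm_sq]

lemma ivpSol_linear (hst : s ≤ t) (hq : IntervalIntegrable q volume s t) (lam c c' : ℂ)
    {x : ℝ} (hx : x ∈ Icc s t) :
    (ivpSol q lam s t c c').1 x
        = c * (ivpSol q lam s t 1 0).1 x + c' * (ivpSol q lam s t 0 1).1 x ∧
      (ivpSol q lam s t c c').2 x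
        = c * (ivpSol q lam s t 1 0).2 x + c' * (ivpSol q lam s t 0 1).2 x := by
  obtain ⟨h1, h2, h3⟩ := ivpSol_spec hst hq lam 1 0
  obtain ⟨k1, k2, k3⟩ := ivpSol_spec hst hq lam 0 1
  have := (h1.linear k1 c c').eq_ivpSol hst hq hx
  simp only [h2, h3, k2, k3, mul_one, mul_zero, add_zero, zero_add] at this
  exact ⟨this.1.symm, this.2.symm⟩

lemma ivpSol_conj (hst : s ≤ t) (hq : IntervalIntegrable q volume s t) (lam c c' : ℂ)
    {x : ℝ} (hx : x ∈ Icc s t) :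
    (ivpSol q (conj lam) s t (conj c) (conj c')).1 x = conj ((ivpSol q lam s t c c').1 x) ∧
      (ivpSol q (conj lam) s t (conj c) (conj c')).2 x
        = conj ((ivpSol q lam s t c c').2 x) := by
  obtain ⟨h1, h2, h3⟩ := ivpSol_spec hst hq lam c c'
  have := h1.conj.eq_ivpSol hst hq hx
  simp only [h2, h3] at this
  exact ⟨this.1.symm, this.2.symm⟩

/-- The Wronskian of the fundamental system is `1`. -/
lemma ivpSol_wronskian (hst : s ≤ t) (hq : IntervalIntegrable q volume s t) (lam : ℂ) :
    (ivpSol q lam s t 0 1).2 t * (ivpSol q lam s t 1 0).1 t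
      - (ivpSol q lam s t 0 1).1 t * (ivpSol q lam s t 1 0).2 t = 1 := by
  obtain ⟨h1, h2, h3⟩ := ivpSol_spec hst hq lam 1 0
  obtain ⟨k1, k2, k3⟩ := ivpSol_spec hst hq lam 0 1
  have := k1.lagrange hst h1
  rw [h2, h3, k2, k3] at this
  linear_combination this

end Lagrange

/-! ### Herglotz pairs -/

/-- The functions `f`, `g` are entire and real on the real axis, and `I` is a positive semidefinite
kernel with `f λ g μ - g λ f μ = (μ - λ) I λ μ`, as given by Lagrange's identity for
`f = y' (t)`, `g = y (t)`. -/
structure LagrangeKernel (f g : ℂ → ℂ) (I : ℂ → ℂ → ℂ) : Prop where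
  diff_f : Differentiable ℂ f
  diff_g : Differentiable ℂ g
  conj_f : ∀ z, f (conj z) = conj (f z)
  conj_g : ∀ z, g (conj z) = conj (g z)
  kernel : ∀ z w, f z * g w - g z * f w = (w - z) * I z w
  continuous_kernel : ∀ w, Continuous fun z => I z w
  nonneg : ∀ z, 0 ≤ (I z (conj z)).re

/-- A pair of entire functions, real on the real axis, such that `-f / g` is a non-constant
Herglotz function, stated by means of a strictly positive kernel. -/
def HerglotzPair (f g : ℂ → ℂ) : Prop :=
  ∃ I, LagrangeKernel f g I ∧ ∀ z, 0 < (I z (conj z)).re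

section Pairs

variable {f g : ℂ → ℂ} {I : ℂ → ℂ → ℂ}

lemma LagrangeKernel.const (c c' : ℝ) :
    LagrangeKernel (fun _ => (c' : ℂ)) (fun _ => (c : ℂ)) (fun _ _ => 0) where
  diff_f := differentiable_const _
  diff_g := differentiable_const _
  conj_f _ := (Complex.conj_ofReal _).symm
  conj_g _ := (Complex.conj_ofReal _).symm
  kernel _ _ := by ring
  continuous_kernel _ := continuous_const
  nonneg _ := by simp

/-- The kernel is invariant under real unimodular transformations of the pair. -/
lemma LagrangeKernel.jump (h : LagrangeKernel f g I) {a : ℝ} (ha : a ≠ 0) (b : ℝ) :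
    LagrangeKernel (fun z => (a : ℂ)⁻¹ * f z + b * g z) (fun z => a * g z) I where
  diff_f := (h.diff_f.const_mul _).add (h.diff_g.const_mul _)
  diff_g := h.diff_g.const_mul _
  conj_f z := by simp [h.conj_f, h.conj_g]
  conj_g z := by simp [h.conj_g]
  kernel z w := by
    rw [← h.kernel]
    have : (a : ℂ) ≠ 0 := by exact_mod_cast ha
    field_simp
    ring
  continuous_kernel := h.continuous_kernel
  nonneg := h.nonneg

lemma HerglotzPair.jump (h : HerglotzPair f g) {a : ℝ} (ha : a ≠ 0) (b : ℝ) :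
    HerglotzPair (fun z => (a : ℂ)⁻¹ * f z + b * g z) (fun z => a * g z) :=
  let ⟨I, h1, h2⟩ := h
  ⟨I, h1.jump ha b, h2⟩

/-- Propagation of a Lagrange kernel along an interval: the initial data at `s` are
`(g λ, f λ)`, and the new pair consists of the values at `t`. -/
lemma LagrangeKernel.propagate {q : ℝ → ℝ} {s t : ℝ} (hst : s ≤ t)
    (hq : IntervalIntegrable q volume s t) (h : LagrangeKernel f g I) :
    LagrangeKernel (fun z => (ivpSol q z s t (g z) (f z)).2 t)
      (fun z => (ivpSol q z s t (g z) (f z)).1 t)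
      (fun z w => I z w + ∫ r in s..t,
        (ivpSol q z s t (g z) (f z)).1 r * (ivpSol q w s t (g w) (f w)).1 r) := by
  have ht : t ∈ Icc s t := right_mem_Icc.2 hst
  have hconj : ∀ z, ∀ x ∈ Icc s t,
      (ivpSol q (conj z) s t (g (conj z)) (f (conj z))).1 x
        = conj ((ivpSol q z s t (g z) (f z)).1 x) ∧
      (ivpSol q (conj z) s t (g (conj z)) (f (conj z))).2 x
        = conj ((ivpSol q z s t (g z) (f z)).2 x) := fun z x hx => by
    rw [h.conj_f, h.conj_g]
    exact ivpSol_conj hst hq z _ _ hx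
  refine ⟨?_, ?_, fun z => (hconj z t ht).2, fun z => (hconj z t ht).1, ?_, ?_, ?_⟩
  · rw [funext fun z => (ivpSol_linear hst hq z (g z) (f z) ht).2]
    exact (h.diff_g.mul (differentiable_ivpSol hst hq 1 0 ht).2).add
      (h.diff_f.mul (differentiable_ivpSol hst hq 0 1 ht).2)
  · rw [funext fun z => (ivpSol_linear hst hq z (g z) (f z) ht).1]
    exact (h.diff_g.mul (differentiable_ivpSol hst hq 1 0 ht).1).add
      (h.diff_f.mul (differentiable_ivpSol hst hq 0 1 ht).1)
  · intro z w
    obtain ⟨h1, h2, h3⟩ := ivpSol_spec hst hq z (g z) (f z)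
    obtain ⟨k1, k2, k3⟩ := ivpSol_spec hst hq w (g w) (f w)
    have := h1.lagrange hst k1
    rw [h2, h3, k2, k3] at this
    linear_combination this + h.kernel z w
  · intro w
    have hv := ((ivpSol_spec hst hq w (g w) (f w)).1.continuousOn hst).1
    have heq : ∀ z, ∫ r in s..t,
        (ivpSol q z s t (g z) (f z)).1 r * (ivpSol q w s t (g w) (f w)).1 r
        = g z * (∫ r in s..t, (ivpSol q z s t 1 0).1 r * (ivpSol q w s t (g w) (f w)).1 r)
          + f z * ∫ r in s..t, (ivpSol q z s t 0 1).1 r * (ivpSol q w s t (g w) (f w)).1 r := by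
      intro z
      have hi : ∀ c c', IntervalIntegrable (fun r => (ivpSol q z s t c c').1 r *
          (ivpSol q w s t (g w) (f w)).1 r) volume s t := fun c c' => by
        have := ((ivpSol_spec hst hq z c c').1.continuousOn hst).1.mul hv
        rw [← uIcc_of_le hst] at this
        exact this.intervalIntegrable
      rw [← intervalIntegral.integral_const_mul, ← intervalIntegral.integral_const_mul,
        ← intervalIntegral.integral_add ((hi _ _).const_mul _) ((hi _ _).const_mul _)]
      refine intervalIntegral.integral_congr fun r hr => ?_
      rw [uIcc_of_le hst] at hr
      simp only [(ivpSol_linear hst hq z (g z) (f z) hr).1]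
      ring
    simp_rw [heq]
    exact (h.continuous_kernel w).add
      ((h.diff_g.continuous.mul (continuous_integral_ivpSol_mul hst hq 1 0 hv)).add
        (h.diff_f.continuous.mul (continuous_integral_ivpSol_mul hst hq 0 1 hv)))
  · intro z
    have : ∫ r in s..t, (ivpSol q z s t (g z) (f z)).1 r *
        (ivpSol q (conj z) s t (g (conj z)) (f (conj z))).1 r
        = ∫ r in s..t, (ivpSol q z s t (g z) (f z)).1 r *
          conj ((ivpSol q z s t (g z) (f z)).1 r) := by
      refine intervalIntegral.integral_congr fun r hr => ?_
      rw [uIcc_of_le hst] at hr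
      simp only [(hconj z r hr).1]
    rw [this, SolvesOn.integral_mul_conj, Complex.add_re, Complex.ofReal_re]
    exact add_nonneg (h.nonneg z)
      (intervalIntegral.integral_nonneg hst fun _ _ => by positivity)

lemma HerglotzPair.propagate {q : ℝ → ℝ} {s t : ℝ} (hst : s ≤ t)
    (hq : IntervalIntegrable q volume s t) (h : HerglotzPair f g) :
    HerglotzPair (fun z => (ivpSol q z s t (g z) (f z)).2 t)
      (fun z => (ivpSol q z s t (g z) (f z)).1 t) := by
  obtain ⟨I, h1, h2⟩ := h
  refine ⟨_, h1.propagate hst hq, fun z => ?_⟩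
  -- at conjugate parameters the integrand is `|y| ^ 2`, hence the integral is non-negative
  have hconj : ∫ r in s..t, (ivpSol q z s t (g z) (f z)).1 r *
        (ivpSol q (conj z) s t (g (conj z)) (f (conj z))).1 r
        = ∫ r in s..t, (ivpSol q z s t (g z) (f z)).1 r *
          conj ((ivpSol q z s t (g z) (f z)).1 r) := by
    refine intervalIntegral.integral_congr fun r hr => ?_
    rw [uIcc_of_le hst] at hr
    simp only [h1.conj_f, h1.conj_g, (ivpSol_conj hst hq z _ _ hr).1]
  rw [hconj, SolvesOn.integral_mul_conj, Complex.add_re, Complex.ofReal_re]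
  exact add_pos_of_pos_of_nonneg (h2 z)
    (intervalIntegral.integral_nonneg hst fun _ _ => by positivity)

/-- The values at `t` of the solution with fixed real initial data form a Herglotz pair. -/
lemma herglotzPair_ivpSol {q : ℝ → ℝ} {s t : ℝ} (hst : s < t)
    (hq : IntervalIntegrable q volume s t) {c c' : ℝ} (h0 : c ≠ 0 ∨ c' ≠ 0) :
    HerglotzPair (fun z => (ivpSol q z s t c c').2 t) (fun z => (ivpSol q z s t c c').1 t) := by
  refine ⟨_, (LagrangeKernel.const c c').propagate hst.le hq, fun z => ?_⟩
  have hconj : ∫ r in s..t, (ivpSol q z s t c c').1 r * (ivpSol q (conj z) s t c c').1 r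
        = ∫ r in s..t, (ivpSol q z s t c c').1 r * conj ((ivpSol q z s t c c').1 r) := by
    refine intervalIntegral.integral_congr fun r hr => ?_
    rw [uIcc_of_le hst.le] at hr
    have := (ivpSol_conj hst.le hq z c c' hr).1
    rw [Complex.conj_ofReal, Complex.conj_ofReal] at this
    simp only [this]
  obtain ⟨h1, h2, h3⟩ := ivpSol_spec hst.le hq z c c'
  rw [hconj, SolvesOn.integral_mul_conj, zero_add, Complex.ofReal_re]
  refine h1.integral_normSq_pos hst ?_
  rw [h2, h3]
  exact_mod_cast h0

/-- The Herglotz pair of the backward problem: with `ψ` the solution normalized by `ψ(t) = 0`,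
`ψ'(t) = 1`, the fundamental system satisfies `u(t) = ψ'(s)` and `v(t) = -ψ(s)`. -/
lemma herglotzPair_fundamental {q : ℝ → ℝ} {s t : ℝ} (hst : s < t)
    (hq : IntervalIntegrable q volume s t) :
    HerglotzPair (fun z => (ivpSol q z s t 1 0).1 t) (fun z => (ivpSol q z s t 0 1).1 t) := by
  have ht : t ∈ Icc s t := right_mem_Icc.2 hst.le
  set U : ℂ → ℂ := fun z => (ivpSol q z s t 1 0).1 t with hU
  set V : ℂ → ℂ := fun z => (ivpSol q z s t 0 1).1 t with hV
  have hdU : Differentiable ℂ U := (differentiable_ivpSol hst.le hq 1 0 ht).1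
  have hdV : Differentiable ℂ V := (differentiable_ivpSol hst.le hq 0 1 ht).1
  have hcu : ∀ z, ∀ x ∈ Icc s t, (ivpSol q (conj z) s t 1 0).1 x
      = conj ((ivpSol q z s t 1 0).1 x) := fun z x hx => by
    simpa using (ivpSol_conj hst.le hq z 1 0 hx).1
  have hcv : ∀ z, ∀ x ∈ Icc s t, (ivpSol q (conj z) s t 0 1).1 x
      = conj ((ivpSol q z s t 0 1).1 x) := fun z x hx => by
    simpa using (ivpSol_conj hst.le hq z 0 1 hx).1
  set ψ : ℂ → ℝ → ℂ := fun z r =>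
    -V z * (ivpSol q z s t 1 0).1 r + U z * (ivpSol q z s t 0 1).1 r with hψ
  set ψ' : ℂ → ℝ → ℂ := fun z r =>
    -V z * (ivpSol q z s t 1 0).2 r + U z * (ivpSol q z s t 0 1).2 r with hψ'
  have hsol : ∀ z, SolvesOn q z s t (ψ z) (ψ' z) := fun z =>
    (ivpSol_spec hst.le hq z 1 0).1.linear (ivpSol_spec hst.le hq z 0 1).1 _ _
  have hs : ∀ z, ψ z s = -V z := fun z => by
    simp only [hψ, (ivpSol_spec hst.le hq z 1 0).2.1, (ivpSol_spec hst.le hq z 0 1).2.1]; ring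
  have hs' : ∀ z, ψ' z s = U z := fun z => by
    simp only [hψ', (ivpSol_spec hst.le hq z 1 0).2.2, (ivpSol_spec hst.le hq z 0 1).2.2]; ring
  have htz : ∀ z, ψ z t = 0 := fun z => by simp only [hψ, hU, hV]; ring
  have hψc : ∀ z, ∀ r ∈ Icc s t, ψ (conj z) r = conj (ψ z r) := fun z r hr => by
    simp only [hψ, hU, hV, map_add, map_mul, map_neg, hcu z r hr, hcv z r hr, hcu z t ht,
      hcv z t ht]
  have hpos : ∀ z, 0 < (∫ r in s..t, ψ z r * ψ (conj z) r).re := fun z => by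
    have : ∫ r in s..t, ψ z r * ψ (conj z) r = ∫ r in s..t, ψ z r * conj (ψ z r) := by
      refine intervalIntegral.integral_congr fun r hr => ?_
      rw [uIcc_of_le hst.le] at hr
      simp only [hψc z r hr]
    rw [this, SolvesOn.integral_mul_conj, Complex.ofReal_re]
    refine (hsol z).integral_normSq_pos hst ?_
    rw [hs, hs']
    by_contra hcon
    push Not at hcon
    have hw := ivpSol_wronskian hst.le hq z
    have h1 : V z = 0 := by simpa using hcon.1
    have h2 : U z = 0 := hcon.2
    simp only [hU, hV] at h1 h2
    rw [h1, h2] at hw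
    simp at hw
  refine ⟨fun z w => ∫ r in s..t, ψ z r * ψ w r,
    ⟨hdU, hdV, fun z => hcu z t ht, fun z => hcv z t ht, ?_, ?_, fun z => (hpos z).le⟩, hpos⟩
  · intro z w
    have := (hsol z).lagrange hst.le (hsol w)
    rw [htz, htz, hs, hs, hs', hs'] at this
    linear_combination this
  · intro w
    have hv := ((hsol w).continuousOn hst.le).1
    have heq : ∀ z, ∫ r in s..t, ψ z r * ψ w r
        = -V z * (∫ r in s..t, (ivpSol q z s t 1 0).1 r * ψ w r)
          + U z * ∫ r in s..t, (ivpSol q z s t 0 1).1 r * ψ w r := by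
      intro z
      have hi : ∀ c c', IntervalIntegrable (fun r => (ivpSol q z s t c c').1 r * ψ w r)
          volume s t := fun c c' => by
        have := ((ivpSol_spec hst.le hq z c c').1.continuousOn hst.le).1.mul hv
        rw [← uIcc_of_le hst.le] at this
        exact this.intervalIntegrable
      rw [← intervalIntegral.integral_const_mul, ← intervalIntegral.integral_const_mul,
        ← intervalIntegral.integral_add ((hi _ _).const_mul _) ((hi _ _).const_mul _)]
      refine intervalIntegral.integral_congr fun r hr => ?_
      simp only [hψ]
      ring
    simp_rw [heq]
    exact (hdV.continuous.neg.mul (continuous_integral_ivpSol_mul hst.le hq 1 0 hv)).add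
      (hdU.continuous.mul (continuous_integral_ivpSol_mul hst.le hq 0 1 hv))

/-- `f / g` maps the upper half-plane into the lower one. -/
lemma HerglotzPair.im_mul_conj (h : HerglotzPair f g) (z : ℂ) :
    ∃ k : ℝ, 0 < k ∧ (f z * conj (g z)).im = -z.im * k := by
  obtain ⟨I, h1, h2⟩ := h
  refine ⟨_, h2 z, ?_⟩
  have := congrArg Complex.im (h1.kernel z (conj z))
  rw [h1.conj_f, h1.conj_g] at this
  simp only [Complex.sub_im, Complex.mul_im, Complex.conj_re, Complex.conj_im,
    Complex.sub_re] at this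
  simp only [Complex.mul_im, Complex.conj_re, Complex.conj_im]
  linarith

lemma HerglotzPair.im_eq_zero (h : HerglotzPair f g) (x : ℝ) :
    (f x).im = 0 ∧ (g x).im = 0 := by
  obtain ⟨I, h1, -⟩ := h
  have e1 := h1.conj_f x
  have e2 := h1.conj_g x
  rw [Complex.conj_ofReal] at e1 e2
  exact ⟨Complex.conj_eq_iff_im.1 e1.symm, Complex.conj_eq_iff_im.1 e2.symm⟩

lemma HerglotzPair.ofReal_re (h : HerglotzPair f g) (x : ℝ) :
    ((f x).re : ℂ) = f x ∧ ((g x).re : ℂ) = g x := by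
  obtain ⟨h1, h2⟩ := h.im_eq_zero x
  exact ⟨Complex.ext rfl (by simp [h1]), Complex.ext rfl (by simp [h2])⟩

/-- The derivative of `f / g` is negative on the real axis. -/
lemma HerglotzPair.wronskian_neg (h : HerglotzPair f g) (x : ℝ) :
    (deriv f x).re * (g x).re - (f x).re * (deriv g x).re < 0 := by
  obtain ⟨I, h1, h2⟩ := id h
  have hd : HasDerivAt (fun z => f z * g x - g z * f x)
      (deriv f x * g x - deriv g x * f x) (x : ℂ) :=
    ((h1.diff_f x).hasDerivAt.mul_const _).sub ((h1.diff_g x).hasDerivAt.mul_const _)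
  have hd2 : HasDerivAt (fun z => f z * g x - g z * f x) (-I x x) (x : ℂ) := by
    rw [hasDerivAt_iff_tendsto_slope]
    have hc := ((h1.continuous_kernel x).neg.tendsto (x : ℂ)).mono_left
      (nhdsWithin_le_nhds (s := {(x : ℂ)}ᶜ))
    refine hc.congr' ?_
    filter_upwards [self_mem_nhdsWithin] with z hz
    have hz' : z - x ≠ 0 := sub_ne_zero.2 hz
    change -I z x = _
    rw [slope_def_field, h1.kernel]
    field_simp
    ring
  have he := congrArg Complex.re (hd.unique hd2)
  have hI := h2 x
  rw [Complex.conj_ofReal] at hI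
  obtain ⟨i1, i2⟩ := h.im_eq_zero x
  simp only [Complex.sub_re, Complex.mul_re, i1, i2, mul_zero, sub_zero, Complex.neg_re] at he
  linarith

lemma HerglotzPair.differentiable (h : HerglotzPair f g) :
    Differentiable ℂ f ∧ Differentiable ℂ g :=
  let ⟨_, h1, _⟩ := h
  ⟨h1.diff_f, h1.diff_g⟩

end Pairs

/-! ### Sums of Herglotz functions: reality and multiplicity of the zeros -/

section PairSum

variable {ι : Type*} [Fintype ι] {f g : ι → ℂ → ℂ}

/-- The numerator `∑ⱼ fⱼ ∏_{i ≠ j} gᵢ` of the sum of the quotients `fⱼ / gⱼ`. -/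
noncomputable def pairSum [DecidableEq ι] (f g : ι → ℂ → ℂ) (z : ℂ) : ℂ :=
  ∑ j, f j z * ∏ i ∈ Finset.univ.erase j, g i z

lemma pairSum_eq_prod_mul [DecidableEq ι] {z : ℂ} (h : ∀ j, g j z ≠ 0) :
    pairSum f g z = (∏ j, g j z) * ∑ j, f j z / g j z := by
  rw [pairSum, Finset.mul_sum]
  refine Finset.sum_congr rfl fun j _ => ?_
  rw [← Finset.mul_prod_erase _ _ (Finset.mem_univ j)]
  field_simp [h j]

lemma differentiable_pairSum [DecidableEq ι] (h : ∀ j, HerglotzPair (f j) (g j)) :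
    Differentiable ℂ (pairSum f g) := by
  unfold pairSum
  refine Differentiable.fun_sum fun j _ => (h j).differentiable.1.mul ?_
  exact Differentiable.fun_finsetProd fun i _ => (h i).differentiable.2

/-- The sum of the quotients has non-zero imaginary part off the real axis. -/
lemma pairSum_ne_zero [DecidableEq ι] [Nonempty ι] (h : ∀ j, HerglotzPair (f j) (g j)) {z : ℂ}
    (hz : z.im ≠ 0) : pairSum f g z ≠ 0 := by
  choose k hk hkz using fun j => (h j).im_mul_conj z
  have hg : ∀ j, g j z ≠ 0 := fun j h0 => by
    have := hkz j
    rw [h0] at this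
    simp only [map_zero, mul_zero, Complex.zero_im, neg_mul, zero_eq_neg, mul_eq_zero] at this
    exact this.elim hz (hk j).ne'
  rw [pairSum_eq_prod_mul hg]
  refine mul_ne_zero (Finset.prod_ne_zero_iff.2 fun j _ => hg j) fun h0 => ?_
  have him : ∀ j, (f j z / g j z).im = -z.im * (k j / Complex.normSq (g j z)) := fun j => by
    rw [mul_div_assoc', ← hkz j, div_eq_mul_inv, Complex.inv_def, ← mul_assoc,
      Complex.im_mul_ofReal, div_eq_mul_inv]
  have h1 := congrArg Complex.im h0
  rw [Complex.im_sum, Complex.zero_im] at h1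
  simp_rw [him] at h1
  rw [← Finset.mul_sum] at h1
  have h2 : 0 < ∑ j, k j / Complex.normSq (g j z) :=
    Finset.sum_pos (fun j _ => div_pos (hk j) (Complex.normSq_pos.2 (hg j)))
      Finset.univ_nonempty
  rcases mul_eq_zero.1 h1 with h3 | h3
  · exact hz (neg_eq_zero.1 h3)
  · exact h2.ne' h3

lemma HerglotzPair.deriv_im {f g : ℂ → ℂ} (h : HerglotzPair f g) (x : ℝ) :
    (deriv f x).im = 0 ∧ (deriv g x).im = 0 := by
  have key : ∀ F : ℂ → ℂ, Differentiable ℂ F → (∀ r : ℝ, (F r).im = 0) → (deriv F x).im = 0 := by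
    intro F hF h0
    have h1 := (hF x).hasDerivAt.comp_ofReal
    have h2 : HasDerivAt (fun r : ℝ => (F r).im) (deriv F x).im x :=
      Complex.imCLM.hasFDerivAt.comp_hasDerivAt x h1
    rw [funext h0] at h2
    exact h2.unique (hasDerivAt_const x 0)
  exact ⟨key f h.differentiable.1 fun r => (h.im_eq_zero r).1,
    key g h.differentiable.2 fun r => (h.im_eq_zero r).2⟩

/-- The number of the functions `gⱼ` that vanish at the real point `x`. -/
noncomputable def poleCount (g : ι → ℂ → ℂ) (x : ℝ) : ℕ :=
  letI := Classical.decPred fun j => g j x = 0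
  (Finset.univ.filter fun j => g j x = 0).card

/-- The restriction to the real axis of the sum of the quotients `fⱼ / gⱼ`. -/
noncomputable def quotSum (f g : ι → ℂ → ℂ) (x : ℝ) : ℝ :=
  ∑ j, (f j x).re / (g j x).re

lemma poleCount_eq_zero_iff {x : ℝ} : poleCount g x = 0 ↔ ∀ j, g j x ≠ 0 := by
  classical
  simp [poleCount, Finset.filter_eq_empty_iff]

/-- A common zero of `k ≥ 1` of the functions `gⱼ` is a zero of order `k - 1` of the numerator:
the residues `fⱼ / gⱼ'` have the same sign and cannot cancel. -/
lemma analyticOrderAt_pairSum_of_pole [DecidableEq ι] (h : ∀ j, HerglotzPair (f j) (g j)) {x : ℝ}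
    (hx : poleCount g x ≠ 0) :
    analyticOrderAt (pairSum f g) (x : ℂ) = (poleCount g x - 1 : ℕ) := by
  classical
  set S : Finset ι := Finset.univ.filter fun j => g j x = 0 with hS
  have hSk : poleCount g x = S.card := by
    unfold poleCount
    congr
  rw [hSk] at hx ⊢
  have hmem : ∀ j, j ∈ S ↔ g j x = 0 := fun j => by simp [hS]
  set d : ι → ℂ → ℂ := fun i => if i ∈ S then dslope (g i) (x : ℂ) else g i with hd
  set F : ι → ℂ → ℂ := fun j => if j ∈ S then f j else fun z => (z - x) * f j z with hF
  have hdd : ∀ i, Differentiable ℂ (d i) := fun i => by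
    simp only [hd]
    split_ifs with hi
    · rw [← differentiableOn_univ, Complex.differentiableOn_dslope univ_mem]
      exact (h i).differentiable.2.differentiableOn
    · exact (h i).differentiable.2
  have hFd : ∀ j, Differentiable ℂ (F j) := fun j => by
    simp only [hF]
    split_ifs with hi
    · exact (h j).differentiable.1
    · exact (differentiable_id.sub_const _).mul (h j).differentiable.1
  have hgd : ∀ i z, g i z = (if i ∈ S then z - (x : ℂ) else 1) * d i z := fun i z => by
    simp only [hd]
    split_ifs with hi
    · have := sub_smul_dslope (g i) (x : ℂ) z
      rw [(hmem i).1 hi, sub_zero, smul_eq_mul] at this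
      exact this.symm
    · simp
  have hprod : ∀ j z, ∏ i ∈ Finset.univ.erase j, g i z
      = (z - x) ^ (S.erase j).card * ∏ i ∈ Finset.univ.erase j, d i z := fun j z => by
    simp_rw [hgd]
    rw [Finset.prod_mul_distrib]
    congr 1
    · rw [Finset.prod_ite, Finset.prod_const_one, mul_one, Finset.prod_const]
      congr 2
      ext i
      simp [and_comm]
  rw [(((differentiable_pairSum h).analyticAt (x : ℂ))).analyticOrderAt_eq_natCast]
  refine ⟨fun z => ∑ j, F j z * ∏ i ∈ Finset.univ.erase j, d i z, ?_, ?_, ?_⟩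
  · refine Differentiable.analyticAt ?_ _
    exact Differentiable.fun_sum fun j _ => (hFd j).mul
      (Differentiable.fun_finsetProd fun i _ => hdd i)
  · have hd0 : ∀ i, d i x ≠ 0 := fun i => by
      simp only [hd]
      split_ifs with hi
      · rw [dslope_same]
        intro h0
        have := (h i).wronskian_neg x
        rw [h0, (hmem i).1 hi] at this
        simp at this
      · exact fun h0 => hi ((hmem i).2 h0)
    have hval : ∑ j, F j x * ∏ i ∈ Finset.univ.erase j, d i x
        = (∏ i, d i x) * ∑ j ∈ S, f j x / d j x := by
      rw [Finset.mul_sum, ← Finset.sum_subset (Finset.subset_univ S)]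
      · refine Finset.sum_congr rfl fun j hj => ?_
        rw [← Finset.mul_prod_erase _ _ (Finset.mem_univ j)]
        have := hd0 j
        simp only [hF, if_pos hj]
        field_simp
      · intro j _ hj
        simp [hF, if_neg hj]
    change ∑ j, F j x * ∏ i ∈ Finset.univ.erase j, d i x ≠ 0
    rw [hval]
    refine mul_ne_zero (Finset.prod_ne_zero_iff.2 fun i _ => hd0 i) ?_
    have hre : ∀ j ∈ S, f j x / d j x = (((f j x).re / (deriv (g j) x).re : ℝ) : ℂ) :=
      fun j hj => by
        have h1 : (((deriv (g j) x).re : ℝ) : ℂ) = deriv (g j) x :=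
          Complex.ext rfl (by simp [((h j).deriv_im x).2])
        simp only [hd, if_pos hj]
        rw [dslope_same, Complex.ofReal_div, ((h j).ofReal_re x).1, h1]
    rw [Finset.sum_congr rfl hre, ← Complex.ofReal_sum, Complex.ofReal_ne_zero]
    refine (Finset.sum_pos (fun j hj => ?_) (Finset.card_ne_zero.1 hx)).ne'
    have h1 := (h j).wronskian_neg x
    rw [(hmem j).1 hj, Complex.zero_re, mul_zero, zero_sub, neg_neg_iff_pos] at h1
    rw [div_eq_mul_inv]
    rcases mul_pos_iff.1 h1 with h2 | h2
    · exact mul_pos h2.1 (inv_pos.2 h2.2)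
    · exact mul_pos_of_neg_of_neg h2.1 (inv_lt_zero.2 h2.2)
  · refine Eventually.of_forall fun z => ?_
    rw [pairSum, smul_eq_mul, Finset.mul_sum]
    refine Finset.sum_congr rfl fun j _ => ?_
    rw [hprod]
    by_cases hj : j ∈ S
    · simp only [hF, if_pos hj, Finset.card_erase_of_mem hj]
      ring
    · simp only [hF, if_neg hj, Finset.erase_eq_of_notMem hj]
      obtain ⟨n, hn⟩ := Nat.exists_eq_succ_of_ne_zero hx
      rw [hn, Nat.succ_sub_one, pow_succ]
      ring

lemma hasDerivAt_quotSum (h : ∀ j, HerglotzPair (f j) (g j)) {x : ℝ} (hx : ∀ j, g j x ≠ 0) :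
    HasDerivAt (quotSum f g)
      (∑ j, ((deriv (f j) x).re * (g j x).re - (f j x).re * (deriv (g j) x).re)
        / (g j x).re ^ 2) x := by
  unfold quotSum
  refine HasDerivAt.fun_sum fun j _ => ?_
  have h1 := ((h j).differentiable.1 x).hasDerivAt.real_of_complex
  have h2 := ((h j).differentiable.2 x).hasDerivAt.real_of_complex
  refine h1.div h2 fun h0 => hx j ?_
  rw [← ((h j).ofReal_re x).2, h0, Complex.ofReal_zero]

lemma sum_wronskian_neg [Nonempty ι] (h : ∀ j, HerglotzPair (f j) (g j)) {x : ℝ}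
    (hx : ∀ j, g j x ≠ 0) :
    ∑ j, ((deriv (f j) x).re * (g j x).re - (f j x).re * (deriv (g j) x).re)
        / (g j x).re ^ 2 < 0 := by
  refine Finset.sum_neg (fun j _ => ?_) Finset.univ_nonempty
  have h0 : (g j x).re ≠ 0 := fun h0 => hx j (by
    rw [← ((h j).ofReal_re x).2, h0, Complex.ofReal_zero])
  exact div_neg_of_neg_of_pos ((h j).wronskian_neg x) (by positivity)

lemma sum_div_eq_quotSum (h : ∀ j, HerglotzPair (f j) (g j)) (x : ℝ) :
    ∑ j, f j x / g j x = (quotSum f g x : ℂ) := by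
  rw [quotSum, Complex.ofReal_sum]
  refine Finset.sum_congr rfl fun j _ => ?_
  rw [Complex.ofReal_div, ((h j).ofReal_re x).1, ((h j).ofReal_re x).2]

/-- Away from the poles the zeros of the numerator are simple. -/
lemma analyticOrderAt_pairSum_of_not_pole [DecidableEq ι] [Nonempty ι]
    (h : ∀ j, HerglotzPair (f j) (g j)) {x : ℝ} (hx : poleCount g x = 0) :
    analyticOrderAt (pairSum f g) (x : ℂ) = if quotSum f g x = 0 then 1 else 0 := by
  rw [poleCount_eq_zero_iff] at hx
  have han := (differentiable_pairSum h).analyticAt (x : ℂ)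
  have hG : ∏ j, g j x ≠ 0 := Finset.prod_ne_zero_iff.2 fun j _ => hx j
  have hval : pairSum f g x = (∏ j, g j x) * (quotSum f g x : ℂ) := by
    rw [pairSum_eq_prod_mul hx, sum_div_eq_quotSum h]
  split_ifs with h0
  · refine han.analyticOrderAt_eq_one_of_zero_deriv_ne_zero (by rw [hval, h0]; simp) fun hd => ?_
    -- the real function `pairSum = ∏ gⱼ · quotSum` has non-zero derivative at `x`
    have h1 := (hasDerivAt_quotSum h hx).ofReal_comp
    have h2 : HasDerivAt (fun r : ℝ => ∏ j, g j r) (deriv (fun z : ℂ => ∏ j, g j z) x) x :=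
      ((Differentiable.fun_finsetProd fun i _ => (h i).differentiable.2) (x : ℂ)
        ).hasDerivAt.comp_ofReal
    have h3 := h2.mul h1
    have h4 : HasDerivAt (fun r : ℝ => pairSum f g r) (deriv (pairSum f g) x) x :=
      ((differentiable_pairSum h) (x : ℂ)).hasDerivAt.comp_ofReal
    have hev : ∀ᶠ r : ℝ in 𝓝 x, ∀ j, g j r ≠ 0 := by
      rw [eventually_all]
      intro j
      exact ((h j).differentiable.2.continuous.comp
        Complex.continuous_ofReal).continuousAt.eventually_ne
        (hx j)
    have h5 := h4.congr_of_eventuallyEq (f₁ := fun r : ℝ => (∏ j, g j r) * (quotSum f g r : ℂ)) (by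
      filter_upwards [hev] with r hr
      rw [pairSum_eq_prod_mul hr, sum_div_eq_quotSum h])
    have h6 := h3.unique h5
    rw [h0, hd, Complex.ofReal_zero, mul_zero, zero_add] at h6
    exact mul_ne_zero hG (Complex.ofReal_ne_zero.2 (sum_wronskian_neg h hx).ne) h6
  · rw [han.analyticOrderAt_eq_zero, hval]
    exact mul_ne_zero hG (Complex.ofReal_ne_zero.2 h0)

end PairSum

/-! ### Counting with multiplicity -/

/-- The number of points of `S`, the point `x` being counted `o x` times. -/
noncomputable def mass (o : ℝ → ℕ) (S : Set ℝ) : ℕ∞ :=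
  {p : ℝ × ℕ | p.1 ∈ S ∧ p.2 < o p.1}.encard

section Mass

variable {o o' : ℝ → ℕ} {S T : Set ℝ}

lemma mass_union (h : Disjoint S T) : mass o (S ∪ T) = mass o S + mass o T := by
  unfold mass
  rw [← Set.encard_union_eq]
  · congr 1
    ext p
    simp only [mem_ofPred_eq, mem_union]
    tauto
  · rw [Set.disjoint_left]
    intro p hp hp'
    exact Set.disjoint_left.1 h hp.1 hp'.1

lemma mass_mono (h : S ⊆ T) : mass o S ≤ mass o T :=
  Set.encard_le_encard fun _ hp => ⟨h hp.1, hp.2⟩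

lemma mass_singleton (x : ℝ) : mass o {x} = o x := by
  have : {p : ℝ × ℕ | p.1 ∈ ({x} : Set ℝ) ∧ p.2 < o p.1} = Prod.mk x '' (Set.Iio (o x)) := by
    ext ⟨r, n⟩
    simp only [mem_singleton_iff, mem_ofPred_eq, mem_image, mem_Iio, Prod.mk.injEq]
    constructor
    · rintro ⟨rfl, h⟩
      exact ⟨n, h, rfl, rfl⟩
    · rintro ⟨_, h, rfl, rfl⟩
      exact ⟨rfl, h⟩
  rw [mass, this, (Prod.mk_right_injective x).encard_image, ← Finset.coe_Iio,
    Set.encard_coe_eq_coe_finsetCard, Nat.card_Iio]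

lemma mass_eq_zero (h : ∀ x ∈ S, o x = 0) : mass o S = 0 := by
  rw [mass, Set.encard_eq_zero, Set.eq_empty_iff_forall_notMem]
  intro p hp
  have := hp.2
  rw [h _ hp.1] at this
  exact Nat.not_lt_zero _ this

lemma mass_add : mass (fun x => o x + o' x) S = mass o S + mass o' S := by
  have hinj : Function.Injective fun p : ℝ × ℕ => (p.1, p.2 + o p.1) := by
    rintro ⟨x, n⟩ ⟨x', n'⟩ h
    simp only [Prod.mk.injEq] at h
    obtain ⟨rfl, h⟩ := h
    simpa using h
  unfold mass
  rw [← hinj.encard_image {p : ℝ × ℕ | p.1 ∈ S ∧ p.2 < o' p.1}, ← Set.encard_union_eq]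
  · congr 1
    ext ⟨x, n⟩
    simp only [mem_ofPred_eq, mem_union, mem_image, Prod.mk.injEq, Prod.exists]
    constructor
    · rintro ⟨hx, hn⟩
      by_cases h : n < o x
      · exact Or.inl ⟨hx, h⟩
      · exact Or.inr ⟨x, n - o x, ⟨hx, by omega⟩, rfl, by omega⟩
    · rintro (⟨hx, hn⟩ | ⟨x', n', ⟨hx, hn⟩, rfl, rfl⟩)
      · exact ⟨hx, by omega⟩
      · exact ⟨hx, by omega⟩
  · rw [Set.disjoint_left]
    rintro ⟨x, n⟩ hp ⟨⟨x', n'⟩, hp', he⟩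
    simp only [Prod.mk.injEq] at he
    obtain ⟨rfl, rfl⟩ := he
    have := hp.2
    simp only at this
    omega

lemma mass_sum {ι : Type*} (s : Finset ι) (k : ι → ℝ → ℕ) :
    mass (fun x => ∑ j ∈ s, k j x) S = ∑ j ∈ s, mass (k j) S := by
  classical
  induction s using Finset.induction_on with
  | empty => simpa using mass_eq_zero (fun _ _ => rfl)
  | insert a s ha ih =>
    simp_rw [Finset.sum_insert ha]
    rw [mass_add, ih]

lemma mass_ne_top (h : (S ∩ {x | o x ≠ 0}).Finite) : mass o S ≠ ⊤ := by
  rw [mass, Set.encard_ne_top_iff]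
  refine (h.biUnion fun x _ => (Set.finite_Iio (o x)).image (Prod.mk x)).subset ?_
  rintro ⟨x, n⟩ ⟨hx, hn⟩
  simp only [mem_iUnion]
  exact ⟨x, ⟨hx, by simp only [mem_ofPred_eq]; simp only at hn; omega⟩, n, hn, rfl⟩

lemma mass_le_one (h : ∀ x ∈ S, o x ≤ 1) (h' : ∀ x ∈ S, ∀ y ∈ S, o x ≠ 0 → o y ≠ 0 → x = y) :
    mass o S ≤ 1 := by
  rw [mass, Set.encard_le_one_iff]
  rintro ⟨x, n⟩ ⟨y, n'⟩ ⟨hx, hn⟩ ⟨hy, hn'⟩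
  simp only at hx hn hy hn'
  have h1 := h x hx
  have h2 := h y hy
  have h3 := h' x hx y hy (by omega) (by omega)
  subst h3
  simp only [Prod.mk.injEq, true_and]
  omega

lemma one_le_mass {x : ℝ} (hx : x ∈ S) (h : o x ≠ 0) : 1 ≤ mass o S := by
  rw [mass, Set.one_le_encard_iff_nonempty]
  exact ⟨(x, 0), hx, Nat.pos_of_ne_zero h⟩

end Mass

/-! ### Interlacing of zeros and poles -/

section Interlacing

variable {K O : ℝ → ℕ} {m m' : ℝ → ℝ}

/-- The function `m`, with derivative `m'`, is strictly decreasing between its poles, which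
are the points with `K ≠ 0`, is positive to the right and negative to the left of each of them, and
`O` is the order of the zeros of the numerator of `m`, the denominator having a zero of order
`K`. -/
structure Interlaced (K O : ℝ → ℕ) (m m' : ℝ → ℝ) : Prop where
  order_pole : ∀ x, K x ≠ 0 → O x + 1 = K x
  order_zero : ∀ x, K x = 0 → O x = if m x = 0 then 1 else 0
  finite : ∀ A B, (Icc A B ∩ {x | K x ≠ 0}).Finite
  hasDerivAt : ∀ x, K x = 0 → HasDerivAt m (m' x) x
  deriv_neg : ∀ x, K x = 0 → m' x < 0
  right : ∀ x, K x ≠ 0 → ∀ᶠ y in 𝓝[>] x, 0 < m y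
  left : ∀ x, K x ≠ 0 → ∀ᶠ y in 𝓝[<] x, m y < 0

lemma Interlaced.strictAntiOn (h : Interlaced K O m m') {S : Set ℝ} (hS : S.OrdConnected)
    (h0 : ∀ x ∈ S, K x = 0) : StrictAntiOn m S := by
  refine strictAntiOn_of_deriv_neg hS.convex
    (fun x hx => (h.hasDerivAt x (h0 x hx)).continuousAt.continuousWithinAt) fun x hx => ?_
  have := h0 x (interior_subset hx)
  rw [(h.hasDerivAt x this).deriv]
  exact h.deriv_neg x this

lemma Interlaced.mass_le_one (h : Interlaced K O m m') {S : Set ℝ} (hS : S.OrdConnected)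
    (h0 : ∀ x ∈ S, K x = 0) : mass O S ≤ 1 := by
  have hz : ∀ x ∈ S, O x ≠ 0 → m x = 0 := fun x hx ho => by
    by_contra hm
    exact ho (by rw [h.order_zero x (h0 x hx), if_neg hm])
  refine StarSL.mass_le_one (fun x hx => ?_) fun x hx y hy hx' hy' =>
    (h.strictAntiOn hS h0).injOn hx hy ((hz x hx hx').trans (hz y hy hy').symm)
  rw [h.order_zero x (h0 x hx)]
  split_ifs <;> simp

lemma Interlaced.mass_gap (h : Interlaced K O m m') {z w : ℝ} (hzw : z < w) (hz : K z ≠ 0)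
    (hw : K w ≠ 0) (h0 : ∀ x ∈ Ioo z w, K x = 0) : mass O (Ioo z w) = 1 := by
  refine le_antisymm (h.mass_le_one ordConnected_Ioo h0) ?_
  obtain ⟨x, hx, hxI⟩ := ((h.right z hz).and (Ioo_mem_nhdsGT hzw)).exists
  obtain ⟨y, hy, hyI⟩ := ((h.left w hw).and (Ioo_mem_nhdsLT hzw)).exists
  have hxy : x < y := ((h.strictAntiOn ordConnected_Ioo h0).lt_iff_gt hyI hxI).1 (hy.trans hx)
  have hc : ContinuousOn m (Icc x y) := fun r hr =>
    (h.hasDerivAt r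
      (h0 r ⟨hxI.1.trans_le hr.1, hr.2.trans_lt hyI.2⟩)).continuousAt.continuousWithinAt
  obtain ⟨r, hr, hr0⟩ := intermediate_value_Icc' hxy.le hc ⟨hy.le, hx.le⟩
  have hrI : r ∈ Ioo z w := ⟨hxI.1.trans_le hr.1, hr.2.trans_lt hyI.2⟩
  refine one_le_mass hrI ?_
  rw [h.order_zero r (h0 r hrI), if_pos hr0]
  exact one_ne_zero

/-- Between two poles there are as many zeros as poles. -/
lemma Interlaced.mass_between (h : Interlaced K O m m') {z w : ℝ} (hzw : z < w) (hz : K z ≠ 0)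
    (hw : K w ≠ 0) : mass O (Ico z w) = mass K (Ico z w) := by
  have hfin : ∀ z w, (Ioo z w ∩ {x | K x ≠ 0}).Finite := fun z w =>
    (h.finite z w).subset (inter_subset_inter_left _ Ioo_subset_Icc_self)
  induction hn : (Ioo z w ∩ {x | K x ≠ 0}).ncard using Nat.strong_induction_on generalizing z w with
  | _ n ih =>
  by_cases h0 : ∀ x ∈ Ioo z w, K x = 0
  · rw [← Ioo_insert_left hzw, insert_eq,
      mass_union (by simp), mass_union (by simp), h.mass_gap hzw hz hw h0, mass_eq_zero h0,
      mass_singleton, mass_singleton, ← h.order_pole z hz]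
    simp
  · push Not at h0
    obtain ⟨v, hv, hv0⟩ := h0
    have hlt : ∀ z' w', Ioo z' w' ⊆ Ioo z w → v ∉ Ioo z' w' →
        (Ioo z' w' ∩ {x | K x ≠ 0}).ncard < n := fun z' w' hs hv' => by
      rw [← hn]
      refine Set.ncard_lt_ncard ⟨inter_subset_inter_left _ hs, fun hcon => ?_⟩ (hfin z w)
      exact hv' (hcon ⟨hv, hv0⟩).1
    rw [← Ico_union_Ico_eq_Ico hv.1.le hv.2.le,
      mass_union (Ico_disjoint_Ico_same), mass_union (Ico_disjoint_Ico_same),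
      ih _ (hlt z v (Ioo_subset_Ioo_right hv.2.le) (by simp)) hv.1 hz hv0 rfl,
      ih _ (hlt v w (Ioo_subset_Ioo_left hv.1.le) (by simp)) hv.2 hv0 hw rfl]

/-- On every interval the numbers of zeros and of poles differ by at most one. -/
lemma Interlaced.mass_Ico (h : Interlaced K O m m') (A B : ℝ) :
    mass O (Ico A B) ≤ mass K (Ico A B) + 1 ∧ mass K (Ico A B) ≤ mass O (Ico A B) + 1 := by
  by_cases h0 : ∀ x ∈ Ico A B, K x = 0
  · rw [mass_eq_zero h0, zero_add]
    exact ⟨h.mass_le_one ordConnected_Ico h0, zero_le⟩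
  have hfin : (Ico A B ∩ {x | K x ≠ 0}).Finite :=
    (h.finite A B).subset (inter_subset_inter_left _ Ico_subset_Icc_self)
  have hne : (Ico A B ∩ {x | K x ≠ 0}).Nonempty := by
    push Not at h0
    obtain ⟨v, hv, hv0⟩ := h0
    exact ⟨v, hv, hv0⟩
  obtain ⟨z, ⟨hzI, hz⟩, hzmin⟩ := Set.exists_min_image _ id hfin hne
  obtain ⟨w, ⟨hwI, hw⟩, hwmax⟩ := Set.exists_max_image _ id hfin hne
  have hzw : z ≤ w := hzmin w ⟨hwI, hw⟩
  have h1 : ∀ x ∈ Ico A z, K x = 0 := fun x hx => by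
    by_contra hK
    exact absurd (hzmin x ⟨⟨hx.1, hx.2.trans hzI.2⟩, hK⟩) (not_le.2 hx.2)
  have h2 : ∀ x ∈ Ioo w B, K x = 0 := fun x hx => by
    by_contra hK
    exact absurd (hwmax x ⟨⟨hwI.1.trans hx.1.le, hx.2⟩, hK⟩) (not_le.2 hx.1)
  have h3 : mass O (Ico z w) = mass K (Ico z w) := by
    rcases hzw.eq_or_lt with rfl | hlt
    · simp [mass]
    · exact h.mass_between hlt hz hw
  have hsplit : ∀ o : ℝ → ℕ, mass o (Ico A B)
      = mass o (Ico A z) + mass o (Ico z w) + (o w + mass o (Ioo w B)) := fun o => by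
    rw [← Ico_union_Ico_eq_Ico (hzI.1.trans hzw) hwI.2.le,
      mass_union Ico_disjoint_Ico_same, ← Ico_union_Ico_eq_Ico hzI.1 hzw,
      mass_union Ico_disjoint_Ico_same, ← Ioo_insert_left hwI.2, insert_eq,
      mass_union (by simp), mass_singleton]
  have e1 := h.mass_le_one ordConnected_Ico h1
  have e2 := h.mass_le_one ordConnected_Ioo h2
  rw [hsplit O, hsplit K, mass_eq_zero h1, mass_eq_zero h2, h3, ← h.order_pole w hw]
  push_cast
  generalize mass K (Ico z w) = M at *
  generalize mass O (Ico A z) = P at *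
  generalize mass O (Ioo w B) = Q at *
  constructor
  · calc P + M + (O w + Q) ≤ 1 + M + (O w + 1) := by gcongr
      _ = 0 + M + (O w + 1 + 0) + 1 := by ring
  · calc 0 + M + ((O w : ℕ∞) + 1 + 0) = 0 + M + (O w + 0) + 1 := by ring
      _ ≤ P + M + (O w + Q) + 1 := by gcongr <;> exact zero_le

end Interlacing

section Application

variable {ι : Type*} [Fintype ι] {f g : ι → ℂ → ℂ}

/-- The indicator function of the real zeros of `g`. -/
noncomputable def zeroInd (g : ℂ → ℂ) (x : ℝ) : ℕ :=
  open scoped Classical in if g x = 0 then 1 else 0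

lemma zeroInd_ne_zero {g : ℂ → ℂ} {x : ℝ} : zeroInd g x ≠ 0 ↔ g x = 0 := by
  simp [zeroInd]

lemma poleCount_eq_sum (g : ι → ℂ → ℂ) (x : ℝ) : poleCount g x = ∑ j, zeroInd (g j) x := by
  classical
  unfold poleCount zeroInd
  rw [Finset.card_filter]

lemma HerglotzPair.deriv_ne_zero {f g : ℂ → ℂ} (h : HerglotzPair f g) {x : ℝ} (hx : g x = 0) :
    deriv g x ≠ 0 := fun h0 => by
  have := h.wronskian_neg x
  rw [hx, h0] at this
  simp at this

lemma HerglotzPair.finite_zeros {f g : ℂ → ℂ} (h : HerglotzPair f g) (A B : ℝ) :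
    (Icc A B ∩ {x : ℝ | g x = 0}).Finite := by
  by_contra hinf
  obtain ⟨x, -, hx⟩ := Set.Infinite.exists_accPt_of_subset_isCompact hinf isCompact_Icc
    inter_subset_left
  have hc : Continuous fun x : ℝ => g x :=
    h.differentiable.2.continuous.comp Complex.continuous_ofReal
  have hfr : ∃ᶠ y in 𝓝[≠] x, g (y : ℝ) = 0 :=
    (accPt_iff_frequently_nhdsNE.1 hx).mono fun y hy => hy.2
  have hx0 : g x = 0 := by
    have hcl : IsClosed {x : ℝ | g x = 0} := isClosed_eq hc continuous_const
    exact hcl.mem_of_frequently_of_tendsto hfr (tendsto_id.mono_left nhdsWithin_le_nhds)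
  have hd : HasDerivAt (fun x : ℝ => g x) (deriv g x) x :=
    (h.differentiable.2 x).hasDerivAt.comp_ofReal
  exact hfr (hd.eventually_ne (h.deriv_ne_zero hx0))

lemma tendsto_sub_mul_quotSum (h : ∀ j, HerglotzPair (f j) (g j)) {z : ℝ}
    (hz : poleCount g z ≠ 0) :
    ∃ c, 0 < c ∧ Tendsto (fun x => (x - z) * quotSum f g x) (𝓝[≠] z) (𝓝 c) := by
  classical
  refine ⟨∑ j, if g j z = 0 then (f j z).re / (deriv (g j) z).re else 0, ?_, ?_⟩
  · have hpos : ∀ j, g j z = 0 → 0 < (f j z).re / (deriv (g j) z).re := fun j hj => by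
      have h1 := (h j).wronskian_neg z
      rw [hj, Complex.zero_re, mul_zero, zero_sub, neg_neg_iff_pos] at h1
      rw [div_eq_mul_inv]
      rcases mul_pos_iff.1 h1 with h2 | h2
      · exact mul_pos h2.1 (inv_pos.2 h2.2)
      · exact mul_pos_of_neg_of_neg h2.1 (inv_lt_zero.2 h2.2)
    obtain ⟨j, hj⟩ : ∃ j, g j z = 0 := by
      by_contra hcon
      push Not at hcon
      exact hz (poleCount_eq_zero_iff.2 hcon)
    refine Finset.sum_pos' (fun i _ => ?_) ⟨j, Finset.mem_univ j, ?_⟩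
    · split_ifs with hi
      · exact (hpos i hi).le
      · exact le_rfl
    · rw [if_pos hj]
      exact hpos j hj
  · simp_rw [quotSum, Finset.mul_sum]
    refine tendsto_finsetSum _ fun j _ => ?_
    have hf : Tendsto (fun x : ℝ => (f j x).re) (𝓝[≠] z) (𝓝 (f j z).re) :=
      ((Complex.continuous_re.comp ((h j).differentiable.1.continuous.comp
        Complex.continuous_ofReal)).tendsto z).mono_left nhdsWithin_le_nhds
    have hg : HasDerivAt (fun x : ℝ => (g j x).re) (deriv (g j) z).re z :=
      ((h j).differentiable.2 z).hasDerivAt.real_of_complex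
    split_ifs with hj
    · have hd0 : (deriv (g j) z).re ≠ 0 := fun h0 => by
        have h1 := (h j).wronskian_neg z
        rw [hj, h0] at h1
        simp at h1
      have hs := (hasDerivAt_iff_tendsto_slope.1 hg).inv₀ hd0
      have := hf.mul hs
      rw [← div_eq_mul_inv] at this
      refine this.congr' ?_
      filter_upwards [self_mem_nhdsWithin] with x hx
      rw [slope_def_field, hj]
      simp only [Complex.zero_re, sub_zero, inv_div]
      ring
    · have hg0 : (g j z).re ≠ 0 := fun h0 => hj (by
        rw [← ((h j).ofReal_re z).2, h0, Complex.ofReal_zero])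
      have h1 : Tendsto (fun x : ℝ => x - z) (𝓝[≠] z) (𝓝 0) := by
        have : Tendsto (fun x : ℝ => x - z) (𝓝 z) (𝓝 (z - z)) :=
          (continuous_id.sub continuous_const).tendsto z
        rw [sub_self] at this
        exact this.mono_left nhdsWithin_le_nhds
      have h2 := h1.mul (hf.div (hg.continuousAt.tendsto.mono_left nhdsWithin_le_nhds) hg0)
      rwa [zero_mul] at h2

/-- The multiplicity of the real point `x` as a zero of the entire function `F`. -/
noncomputable def realOrder (F : ℂ → ℂ) (x : ℝ) : ℕ := analyticOrderNatAt F (x : ℂ)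

lemma interlaced_pairSum [DecidableEq ι] [Nonempty ι] (h : ∀ j, HerglotzPair (f j) (g j)) :
    Interlaced (poleCount g) (realOrder (pairSum f g)) (quotSum f g)
      (fun x => ∑ j, ((deriv (f j) x).re * (g j x).re - (f j x).re * (deriv (g j) x).re)
        / (g j x).re ^ 2) where
  order_pole x hx := by
    rw [realOrder, analyticOrderNatAt, analyticOrderAt_pairSum_of_pole h hx, ENat.toNat_natCast]
    omega
  order_zero x hx := by
    rw [realOrder, analyticOrderNatAt, analyticOrderAt_pairSum_of_not_pole h hx]
    split_ifs <;> rfl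
  finite A B := by
    refine (Set.finite_iUnion fun j => (h j).finite_zeros A B).subset ?_
    rintro x ⟨hx, hx0⟩
    by_contra hcon
    refine hx0 (poleCount_eq_zero_iff.2 fun j hj => hcon ?_)
    exact mem_iUnion.2 ⟨j, hx, hj⟩
  hasDerivAt x hx := hasDerivAt_quotSum h (poleCount_eq_zero_iff.1 hx)
  deriv_neg x hx := sum_wronskian_neg h (poleCount_eq_zero_iff.1 hx)
  right x hx := by
    obtain ⟨c, hc, ht⟩ := tendsto_sub_mul_quotSum h hx
    have h1 := (ht.mono_left (nhdsWithin_mono x fun y (hy : x < y) => hy.ne')).eventually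
      (lt_mem_nhds hc)
    filter_upwards [h1, self_mem_nhdsWithin] with y hy hxy
    exact pos_of_mul_pos_right hy (sub_nonneg.2 (le_of_lt hxy))
  left x hx := by
    obtain ⟨c, hc, ht⟩ := tendsto_sub_mul_quotSum h hx
    have h1 := (ht.mono_left (nhdsWithin_mono x fun y (hy : y < x) => hy.ne)).eventually
      (lt_mem_nhds hc)
    filter_upwards [h1, self_mem_nhdsWithin] with y hy hxy
    have hxy' : y - x < 0 := sub_neg.2 hxy
    by_contra hcon
    exact absurd hy (not_lt.2 (mul_nonpos_of_nonpos_of_nonneg hxy'.le (not_lt.1 hcon)))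

lemma analyticOrderAt_pairSum [DecidableEq ι] [Nonempty ι]
    (h : ∀ j, HerglotzPair (f j) (g j)) (x : ℝ) :
    analyticOrderAt (pairSum f g) (x : ℂ) = realOrder (pairSum f g) x := by
  rw [realOrder, Nat.cast_analyticOrderNatAt]
  by_cases hx : poleCount g x = 0
  · rw [analyticOrderAt_pairSum_of_not_pole h hx]
    split_ifs <;> simp
  · rw [analyticOrderAt_pairSum_of_pole h hx]
    simp

lemma HerglotzPair.realOrder_eq {f g : ℂ → ℂ} (h : HerglotzPair f g) (x : ℝ) :
    realOrder g x = zeroInd g x := by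
  have han := h.differentiable.2.analyticAt (x : ℂ)
  rw [realOrder, analyticOrderNatAt, zeroInd]
  split_ifs with h0
  · rw [han.analyticOrderAt_eq_one_of_zero_deriv_ne_zero h0 (h.deriv_ne_zero h0)]
    rfl
  · rw [han.analyticOrderAt_eq_zero.2 h0]
    rfl

/-- The zeros of the numerator of a sum of Herglotz quotients are, up to one, as many as the zeros
of all the denominators. -/
lemma mass_pairSum [DecidableEq ι] [Nonempty ι] (h : ∀ j, HerglotzPair (f j) (g j)) (A B : ℝ) :
    mass (realOrder (pairSum f g)) (Ico A B) ≤ ∑ j, mass (zeroInd (g j)) (Ico A B) + 1 ∧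
      ∑ j, mass (zeroInd (g j)) (Ico A B) ≤ mass (realOrder (pairSum f g)) (Ico A B) + 1 := by
  have := (interlaced_pairSum h).mass_Ico A B
  rw [funext (poleCount_eq_sum g), mass_sum] at this
  exact this

end Application

/-! ### Asymptotics of solutions for large spectral parameter -/

lemma norm_exp_I_mul_le (w : ℂ) : ‖Complex.exp (w * Complex.I)‖ ≤ Real.exp |w.im| ∧
    ‖Complex.exp (-w * Complex.I)‖ ≤ Real.exp |w.im| := by
  rw [Complex.norm_exp, Complex.norm_exp]
  constructor <;> refine Real.exp_le_exp.2 ?_ <;> simp [neg_le_abs, le_abs_self]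

lemma norm_cos_le_exp (w : ℂ) : ‖Complex.cos w‖ ≤ Real.exp |w.im| := by
  obtain ⟨h1, h2⟩ := norm_exp_I_mul_le w
  rw [Complex.cos, norm_div, Complex.norm_two]
  have := norm_add_le (Complex.exp (w * Complex.I)) (Complex.exp (-w * Complex.I))
  linarith

lemma norm_sin_le_exp (w : ℂ) : ‖Complex.sin w‖ ≤ Real.exp |w.im| := by
  obtain ⟨h1, h2⟩ := norm_exp_I_mul_le w
  rw [Complex.sin, norm_div, Complex.norm_two, norm_mul, Complex.norm_I, mul_one]
  have := norm_sub_le (Complex.exp (-w * Complex.I)) (Complex.exp (w * Complex.I))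
  linarith

lemma abs_im_mul_sub (ρ : ℂ) {r x : ℝ} (h : r ≤ x) :
    |(ρ * ((x - r : ℝ) : ℂ)).im| = |ρ.im| * (x - r) := by
  rw [Complex.im_mul_ofReal, abs_mul, abs_of_nonneg (sub_nonneg.2 h)]

section Asymptotics

variable {q : ℝ → ℝ} {ρ : ℂ} {s t : ℝ} {y y' : ℝ → ℂ}

lemma ac_of_contDiff {F : ℝ → ℂ} (h : ContDiff ℝ 1 F) (s t : ℝ) :
    AbsolutelyContinuousOnInterval F s t :=
  h.contDiffOn.absolutelyContinuousOnInterval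

lemma hasDerivAt_cos_mul_sub (ρ : ℂ) (x r : ℝ) :
    HasDerivAt (fun r : ℝ => Complex.cos (ρ * ((x - r : ℝ) : ℂ)))
      (ρ * Complex.sin (ρ * ((x - r : ℝ) : ℂ))) r := by
  have h1 : HasDerivAt (fun r : ℝ => ρ * ((x - r : ℝ) : ℂ)) (ρ * ((-1 : ℝ) : ℂ)) r :=
    (((hasDerivAt_id r).const_sub x).ofReal_comp).const_mul ρ
  refine ((Complex.hasDerivAt_cos _).comp r h1).congr_deriv ?_
  push_cast
  ring

lemma hasDerivAt_sin_mul_sub (ρ : ℂ) (x r : ℝ) :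
    HasDerivAt (fun r : ℝ => Complex.sin (ρ * ((x - r : ℝ) : ℂ)))
      (-ρ * Complex.cos (ρ * ((x - r : ℝ) : ℂ))) r := by
  have h1 : HasDerivAt (fun r : ℝ => ρ * ((x - r : ℝ) : ℂ)) (ρ * ((-1 : ℝ) : ℂ)) r :=
    (((hasDerivAt_id r).const_sub x).ofReal_comp).const_mul ρ
  refine ((Complex.hasDerivAt_sin _).comp r h1).congr_deriv ?_
  push_cast
  ring

lemma contDiff_cos_mul_sub (ρ : ℂ) (x : ℝ) :
    ContDiff ℝ 1 fun r : ℝ => Complex.cos (ρ * ((x - r : ℝ) : ℂ)) := by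
  refine (Complex.contDiff_cos.restrict_scalars ℝ).comp ?_
  exact contDiff_const.mul (Complex.ofRealCLM.contDiff.comp (contDiff_const.sub contDiff_id))

lemma contDiff_sin_mul_sub (ρ : ℂ) (x : ℝ) :
    ContDiff ℝ 1 fun r : ℝ => Complex.sin (ρ * ((x - r : ℝ) : ℂ)) := by
  refine (Complex.contDiff_sin.restrict_scalars ℝ).comp ?_
  exact contDiff_const.mul (Complex.ofRealCLM.contDiff.comp (contDiff_const.sub contDiff_id))

lemma SolvesOn.mono_right {lam : ℂ} (h : SolvesOn q lam s t y y') {x : ℝ} (hx : x ∈ Icc s t) :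
    SolvesOn q lam s x y y' where
  ac := h.ac.mono (uIcc_subset_uIcc_left (Icc_subset_uIcc hx))
  ac_deriv := h.ac_deriv.mono (uIcc_subset_uIcc_left (Icc_subset_uIcc hx))
  hasDerivAt r hr := h.hasDerivAt r ⟨hr.1, hr.2.trans_le hx.2⟩
  equation := by
    filter_upwards [h.equation] with r h1 hr using h1 ⟨hr.1, hr.2.trans_le hx.2⟩

/-- Variation of constants around the free equation `-y'' = ρ² y`. -/
lemma SolvesOn.variation (hst : s ≤ t) (hq : IntervalIntegrable q volume s t) (hρ : ρ ≠ 0)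
    (h : SolvesOn q (ρ ^ 2) s t y y') :
    y t = y s * Complex.cos (ρ * ((t - s : ℝ) : ℂ))
        + y' s * (Complex.sin (ρ * ((t - s : ℝ) : ℂ)) / ρ)
        + ∫ r in s..t, q r * y r * (Complex.sin (ρ * ((t - r : ℝ) : ℂ)) / ρ) ∧
      y' t = -y s * ρ * Complex.sin (ρ * ((t - s : ℝ) : ℂ))
        + y' s * Complex.cos (ρ * ((t - s : ℝ) : ℂ))
        + ∫ r in s..t, q r * y r * Complex.cos (ρ * ((t - r : ℝ) : ℂ)) := by
  have hsin := ac_of_contDiff (contDiff_sin_mul_sub ρ t) s t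
  have hcos := ac_of_contDiff (contDiff_cos_mul_sub ρ t) s t
  have hi : ∀ F : ℝ → ℂ, AbsolutelyContinuousOnInterval F s t →
      IntervalIntegrable (fun r => q r * y r * F r) volume s t := fun F hF =>
    ((intervalIntegrable_ofReal hq).mul_continuousOn h.ac.continuousOn).mul_continuousOn
      hF.continuousOn
  constructor
  · have hac : AbsolutelyContinuousOnInterval (fun r => y r * Complex.cos (ρ * ((t - r : ℝ) : ℂ))
        + y' r * (ρ⁻¹ * Complex.sin (ρ * ((t - r : ℝ) : ℂ)))) s t :=
      (h.ac.fun_smul hcos).fun_add (h.ac_deriv.fun_smul (hsin.const_smul ρ⁻¹))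
    have := integral_eq_sub_of_ac hst hac (hi _ (hsin.const_smul ρ⁻¹)) (by
      filter_upwards [h.equation] with x h1 hx
      refine (((h.hasDerivAt x hx).mul (hasDerivAt_cos_mul_sub ρ t x)).add
        ((h1 hx).mul ((hasDerivAt_sin_mul_sub ρ t x).const_mul ρ⁻¹))).congr_deriv ?_
      simp only [smul_eq_mul]
      field_simp
      ring)
    simp only [sub_self, Complex.ofReal_zero, mul_zero, Complex.cos_zero, Complex.sin_zero,
      mul_one, add_zero, smul_eq_mul] at this
    simp_rw [div_eq_inv_mul]
    linear_combination -this
  · have hac : AbsolutelyContinuousOnInterval (fun r =>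
        y r * (-ρ * Complex.sin (ρ * ((t - r : ℝ) : ℂ)))
        + y' r * Complex.cos (ρ * ((t - r : ℝ) : ℂ))) s t :=
      (h.ac.fun_smul (hsin.const_smul (-ρ))).fun_add (h.ac_deriv.fun_smul hcos)
    have := integral_eq_sub_of_ac hst hac (hi _ hcos) (by
      filter_upwards [h.equation] with x h1 hx
      refine (((h.hasDerivAt x hx).mul ((hasDerivAt_sin_mul_sub ρ t x).const_mul (-ρ))).add
        ((h1 hx).mul (hasDerivAt_cos_mul_sub ρ t x))).congr_deriv ?_
      ring)
    simp only [sub_self, Complex.ofReal_zero, mul_zero, Complex.cos_zero, Complex.sin_zero,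
      mul_one, zero_add] at this
    linear_combination -this

/-- For `|ρ| ≥ 2 ‖q‖₁` the solution is bounded by twice the bound for the free solution. -/
lemma SolvesOn.norm_le (hst : s ≤ t) (hq : IntervalIntegrable q volume s t) (hρ : ρ ≠ 0)
    (hρq : 2 * ∫ r in s..t, |q r| ≤ ‖ρ‖) (h : SolvesOn q (ρ ^ 2) s t y y') {x : ℝ}
    (hx : x ∈ Icc s t) :
    ‖y x‖ ≤ 2 * (‖y s‖ + ‖y' s‖ / ‖ρ‖) * Real.exp (|ρ.im| * (x - s)) := by
  have hρ' : 0 < ‖ρ‖ := norm_pos_iff.2 hρ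
  set K := ‖y s‖ + ‖y' s‖ / ‖ρ‖ with hK
  set Q := ∫ r in s..t, |q r| with hQ
  have hcont : ContinuousOn (fun r => ‖y r‖ * Real.exp (-(|ρ.im| * (r - s)))) (Icc s t) :=
    (h.continuousOn hst).1.norm.mul (by fun_prop)
  obtain ⟨x₀, hx₀, hmax⟩ := isCompact_Icc.exists_isMaxOn (nonempty_Icc.2 hst) hcont
  set M := ‖y x₀‖ * Real.exp (-(|ρ.im| * (x₀ - s))) with hM
  have hM0 : 0 ≤ M := by positivity
  have hyM : ∀ r ∈ Icc s t, ‖y r‖ ≤ M * Real.exp (|ρ.im| * (r - s)) := fun r hr => by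
    have h1 : ‖y r‖ * Real.exp (-(|ρ.im| * (r - s))) ≤ M := hmax hr
    rw [Real.exp_neg, ← div_eq_mul_inv, div_le_iff₀ (Real.exp_pos _)] at h1
    exact h1
  have hqx : IntervalIntegrable q volume s x₀ :=
    hq.mono_set (uIcc_subset_uIcc_left (Icc_subset_uIcc hx₀))
  have hvar := (h.mono_right hx₀).variation hx₀.1 hqx hρ
  have hint : ‖∫ r in s..x₀, q r * y r * (Complex.sin (ρ * ((x₀ - r : ℝ) : ℂ)) / ρ)‖
      ≤ ∫ r in s..x₀, |q r| * (M * Real.exp (|ρ.im| * (x₀ - s)) / ‖ρ‖) := by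
    refine intervalIntegral.norm_integral_le_of_norm_le hx₀.1
      (Eventually.of_forall fun r hr => ?_) (hqx.abs.mul_const _)
    rw [norm_mul, norm_mul, norm_div, Complex.norm_real, Real.norm_eq_abs, mul_assoc,
      mul_div_assoc']
    have h1 := norm_sin_le_exp (ρ * ((x₀ - r : ℝ) : ℂ))
    rw [abs_im_mul_sub ρ hr.2] at h1
    have h2 := hyM r ⟨hr.1.le, hr.2.trans hx₀.2⟩
    refine mul_le_mul_of_nonneg_left (div_le_div_of_nonneg_right ?_ hρ'.le) (abs_nonneg _)
    calc ‖y r‖ * ‖Complex.sin (ρ * ((x₀ - r : ℝ) : ℂ))‖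
        ≤ (M * Real.exp (|ρ.im| * (r - s))) * Real.exp (|ρ.im| * (x₀ - r)) := by gcongr
      _ = M * Real.exp (|ρ.im| * (x₀ - s)) := by
        rw [mul_assoc, ← Real.exp_add]
        congr 2
        ring
  have hQx : ∫ r in s..x₀, |q r| ≤ Q :=
    intervalIntegral.integral_mono_interval le_rfl hx₀.1 hx₀.2
      (Eventually.of_forall fun _ => abs_nonneg _) hq.abs
  rw [intervalIntegral.integral_mul_const] at hint
  have hfree : ‖y s * Complex.cos (ρ * ((x₀ - s : ℝ) : ℂ))
      + y' s * (Complex.sin (ρ * ((x₀ - s : ℝ) : ℂ)) / ρ)‖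
      ≤ K * Real.exp (|ρ.im| * (x₀ - s)) := by
    have h1 := norm_sin_le_exp (ρ * ((x₀ - s : ℝ) : ℂ))
    have h2 := norm_cos_le_exp (ρ * ((x₀ - s : ℝ) : ℂ))
    rw [abs_im_mul_sub ρ hx₀.1] at h1 h2
    refine (norm_add_le _ _).trans ?_
    rw [norm_mul, norm_mul, norm_div, hK, add_mul, div_mul_eq_mul_div, mul_div_assoc]
    gcongr
  have hMK : M ≤ K + M * (Q / ‖ρ‖) := by
    have h1 : ‖y x₀‖ ≤ K * Real.exp (|ρ.im| * (x₀ - s))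
        + Q * (M * Real.exp (|ρ.im| * (x₀ - s)) / ‖ρ‖) := by
      rw [hvar.1]
      refine (norm_add_le _ _).trans (add_le_add hfree (hint.trans ?_))
      gcongr
    calc M ≤ (K * Real.exp (|ρ.im| * (x₀ - s))
        + Q * (M * Real.exp (|ρ.im| * (x₀ - s)) / ‖ρ‖)) * Real.exp (-(|ρ.im| * (x₀ - s))) := by
          rw [hM]; gcongr
      _ = (K + M * (Q / ‖ρ‖)) * (Real.exp (|ρ.im| * (x₀ - s)) *
          Real.exp (-(|ρ.im| * (x₀ - s)))) := by ring
      _ = K + M * (Q / ‖ρ‖) := by rw [← Real.exp_add]; simp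
  have hQρ : Q / ‖ρ‖ ≤ 1 / 2 := by
    rw [div_le_iff₀ hρ']
    linarith
  have hM2 : M ≤ 2 * K := by nlinarith
  refine (hyM x hx).trans ?_
  gcongr

/-- Comparison with the solution of the free equation. -/
lemma SolvesOn.norm_sub_free_le (hst : s ≤ t) (hq : IntervalIntegrable q volume s t) (hρ : ρ ≠ 0)
    (hρq : 2 * ∫ r in s..t, |q r| ≤ ‖ρ‖) (h : SolvesOn q (ρ ^ 2) s t y y') :
    ‖y t - (y s * Complex.cos (ρ * ((t - s : ℝ) : ℂ))
        + y' s * (Complex.sin (ρ * ((t - s : ℝ) : ℂ)) / ρ))‖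
      ≤ 2 * (‖y s‖ + ‖y' s‖ / ‖ρ‖) * (∫ r in s..t, |q r|) / ‖ρ‖ * Real.exp (|ρ.im| * (t - s)) ∧
    ‖y' t - (-y s * ρ * Complex.sin (ρ * ((t - s : ℝ) : ℂ))
        + y' s * Complex.cos (ρ * ((t - s : ℝ) : ℂ)))‖
      ≤ 2 * (‖y s‖ + ‖y' s‖ / ‖ρ‖) * (∫ r in s..t, |q r|) * Real.exp (|ρ.im| * (t - s)) := by
  obtain ⟨h1, h2⟩ := h.variation hst hq hρ
  set K := ‖y s‖ + ‖y' s‖ / ‖ρ‖ with hK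
  have hy := fun r hr => h.norm_le hst hq hρ hρq (x := r) hr
  have key : ∀ (F : ℝ → ℂ) , (∀ r ∈ Ioc s t, ‖F r‖ ≤ Real.exp (|ρ.im| * (t - r))) →
      ‖∫ r in s..t, q r * y r * F r‖
        ≤ 2 * K * (∫ r in s..t, |q r|) * Real.exp (|ρ.im| * (t - s)) := by
    intro F hF
    have : 2 * K * (∫ r in s..t, |q r|) * Real.exp (|ρ.im| * (t - s))
        = ∫ r in s..t, |q r| * (2 * K * Real.exp (|ρ.im| * (t - s))) := by
      rw [intervalIntegral.integral_mul_const]; ring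
    rw [this]
    refine intervalIntegral.norm_integral_le_of_norm_le hst
      (Eventually.of_forall fun r hr => ?_) (hq.abs.mul_const _)
    rw [norm_mul, norm_mul, Complex.norm_real, Real.norm_eq_abs, mul_assoc]
    refine mul_le_mul_of_nonneg_left ?_ (abs_nonneg _)
    calc ‖y r‖ * ‖F r‖
        ≤ (2 * K * Real.exp (|ρ.im| * (r - s))) * Real.exp (|ρ.im| * (t - r)) :=
          mul_le_mul (hy r ⟨hr.1.le, hr.2⟩) (hF r hr) (norm_nonneg _) (by positivity)
      _ = 2 * K * Real.exp (|ρ.im| * (t - s)) := by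
        rw [mul_assoc, ← Real.exp_add]
        congr 2
        ring
  constructor
  · have e : y t - (y s * Complex.cos (ρ * ((t - s : ℝ) : ℂ))
        + y' s * (Complex.sin (ρ * ((t - s : ℝ) : ℂ)) / ρ))
        = (∫ r in s..t, q r * y r * Complex.sin (ρ * ((t - r : ℝ) : ℂ))) / ρ := by
      rw [h1, ← intervalIntegral.integral_div]
      simp_rw [mul_div_assoc]
      ring
    rw [e, norm_div, div_mul_eq_mul_div]
    gcongr
    refine key _ fun r hr => ?_
    have := norm_sin_le_exp (ρ * ((t - r : ℝ) : ℂ))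
    rwa [abs_im_mul_sub ρ hr.2] at this
  · have e : y' t - (-y s * ρ * Complex.sin (ρ * ((t - s : ℝ) : ℂ))
        + y' s * Complex.cos (ρ * ((t - s : ℝ) : ℂ)))
        = ∫ r in s..t, q r * y r * Complex.cos (ρ * ((t - r : ℝ) : ℂ)) := by
      rw [h2]; ring
    rw [e]
    refine key _ fun r hr => ?_
    have := norm_cos_le_exp (ρ * ((t - r : ℝ) : ℂ))
    rwa [abs_im_mul_sub ρ hr.2] at this

/-- Asymptotics of the solution with initial data `(1, h)`. -/
lemma ivpSol_asymptotics_one (hst : s ≤ t) (hq : IntervalIntegrable q volume s t) (h : ℂ) :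
    ∃ C R : ℝ, 0 < C ∧ 1 ≤ R ∧ ∀ ρ : ℂ, R ≤ ‖ρ‖ →
      ‖(ivpSol q (ρ ^ 2) s t 1 h).1 t - Complex.cos (ρ * ((t - s : ℝ) : ℂ))‖
        ≤ C / ‖ρ‖ * Real.exp (|ρ.im| * (t - s)) ∧
      ‖(ivpSol q (ρ ^ 2) s t 1 h).2 t + ρ * Complex.sin (ρ * ((t - s : ℝ) : ℂ))‖
        ≤ C * Real.exp (|ρ.im| * (t - s)) := by
  set Q := ∫ r in s..t, |q r| with hQ
  have hQ0 : 0 ≤ Q := intervalIntegral.integral_nonneg hst fun _ _ => abs_nonneg _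
  refine ⟨‖h‖ + 2 * (1 + ‖h‖) * Q + 1, 1 + 2 * Q, by positivity, by linarith, fun ρ hρ => ?_⟩
  have hρ1 : 1 ≤ ‖ρ‖ := by linarith
  have hρ0 : ρ ≠ 0 := norm_pos_iff.1 (by linarith)
  obtain ⟨h1, h2, h3⟩ := ivpSol_spec hst hq (ρ ^ 2) 1 h
  obtain ⟨e1, e2⟩ := h1.norm_sub_free_le hst hq hρ0 (by linarith)
  rw [h2, h3, norm_one, ← hQ] at e1 e2
  have hK : 1 + ‖h‖ / ‖ρ‖ ≤ 1 + ‖h‖ := by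
    gcongr
    exact div_le_self (norm_nonneg _) hρ1
  have hsin := norm_sin_le_exp (ρ * ((t - s : ℝ) : ℂ))
  have hcos := norm_cos_le_exp (ρ * ((t - s : ℝ) : ℂ))
  rw [abs_im_mul_sub ρ hst] at hsin hcos
  set E := Real.exp (|ρ.im| * (t - s)) with hE
  have hE0 : 0 < E := Real.exp_pos _
  constructor
  · calc _ = ‖((ivpSol q (ρ ^ 2) s t 1 h).1 t - (1 * Complex.cos (ρ * ((t - s : ℝ) : ℂ))
        + h * (Complex.sin (ρ * ((t - s : ℝ) : ℂ)) / ρ)))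
        + h * (Complex.sin (ρ * ((t - s : ℝ) : ℂ)) / ρ)‖ := by congr 1; ring
      _ ≤ 2 * (1 + ‖h‖ / ‖ρ‖) * Q / ‖ρ‖ * E + ‖h‖ * (E / ‖ρ‖) := by
        refine (norm_add_le _ _).trans (add_le_add e1 ?_)
        rw [norm_mul, norm_div]
        gcongr
      _ ≤ 2 * (1 + ‖h‖) * Q / ‖ρ‖ * E + ‖h‖ * (E / ‖ρ‖) + 1 / ‖ρ‖ * E := by
        have : 0 ≤ 1 / ‖ρ‖ * E := by positivity
        refine le_add_of_le_of_nonneg ?_ this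
        gcongr
      _ = _ := by ring
  · calc _ = ‖((ivpSol q (ρ ^ 2) s t 1 h).2 t - (-1 * ρ * Complex.sin (ρ * ((t - s : ℝ) : ℂ))
        + h * Complex.cos (ρ * ((t - s : ℝ) : ℂ))))
        + h * Complex.cos (ρ * ((t - s : ℝ) : ℂ))‖ := by congr 1; ring
      _ ≤ 2 * (1 + ‖h‖ / ‖ρ‖) * Q * E + ‖h‖ * E := by
        refine (norm_add_le _ _).trans (add_le_add e2 ?_)
        rw [norm_mul]
        gcongr
      _ ≤ 2 * (1 + ‖h‖) * Q * E + ‖h‖ * E + E := by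
        refine le_add_of_le_of_nonneg ?_ hE0.le
        gcongr
      _ = _ := by ring

/-- Asymptotics of the solution with initial data `(0, 1)`. -/
lemma ivpSol_asymptotics_zero (hst : s ≤ t) (hq : IntervalIntegrable q volume s t) :
    ∃ C R : ℝ, 0 < C ∧ 1 ≤ R ∧ ∀ ρ : ℂ, R ≤ ‖ρ‖ →
      ‖ρ * (ivpSol q (ρ ^ 2) s t 0 1).1 t - Complex.sin (ρ * ((t - s : ℝ) : ℂ))‖
        ≤ C / ‖ρ‖ * Real.exp (|ρ.im| * (t - s)) ∧
      ‖(ivpSol q (ρ ^ 2) s t 0 1).2 t - Complex.cos (ρ * ((t - s : ℝ) : ℂ))‖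
        ≤ C / ‖ρ‖ * Real.exp (|ρ.im| * (t - s)) := by
  set Q := ∫ r in s..t, |q r| with hQ
  have hQ0 : 0 ≤ Q := intervalIntegral.integral_nonneg hst fun _ _ => abs_nonneg _
  refine ⟨2 * Q + 1, 1 + 2 * Q, by positivity, by linarith, fun ρ hρ => ?_⟩
  have hρ1 : 1 ≤ ‖ρ‖ := by linarith
  have hρ0 : ρ ≠ 0 := norm_pos_iff.1 (by linarith)
  have hρp : 0 < ‖ρ‖ := by linarith
  obtain ⟨h1, h2, h3⟩ := ivpSol_spec hst hq (ρ ^ 2) 0 1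
  obtain ⟨e1, e2⟩ := h1.norm_sub_free_le hst hq hρ0 (by linarith)
  rw [h2, h3, norm_zero, norm_one, ← hQ, zero_add] at e1 e2
  set E := Real.exp (|ρ.im| * (t - s)) with hE
  have hE0 : 0 < E := Real.exp_pos _
  constructor
  · calc _ = ‖ρ * ((ivpSol q (ρ ^ 2) s t 0 1).1 t - (0 * Complex.cos (ρ * ((t - s : ℝ) : ℂ))
        + 1 * (Complex.sin (ρ * ((t - s : ℝ) : ℂ)) / ρ)))‖ := by
          congr 1; field_simp; ring
      _ ≤ ‖ρ‖ * (2 * (1 / ‖ρ‖) * Q / ‖ρ‖ * E) := by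
        rw [norm_mul]
        gcongr
      _ = 2 * Q / ‖ρ‖ * E := by field_simp
      _ ≤ _ := by gcongr; linarith
  · calc _ = ‖(ivpSol q (ρ ^ 2) s t 0 1).2 t - (-0 * ρ * Complex.sin (ρ * ((t - s : ℝ) : ℂ))
        + 1 * Complex.cos (ρ * ((t - s : ℝ) : ℂ)))‖ := by congr 1; ring
      _ ≤ 2 * (1 / ‖ρ‖) * Q * E := e2
      _ = 2 * Q / ‖ρ‖ * E := by ring
      _ ≤ _ := by gcongr; linarith

end Asymptotics

/-! ### Counting functions of the form `R L + O(1)` -/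

/-- The points counted by `o` are bounded below, and `R L + O(1)` of them lie below `R ^ 2`. -/
def CountsLike (o : ℝ → ℕ) (L : ℝ) : Prop :=
  ∃ C A : ℝ, (∀ x < A, o x = 0) ∧
    ∀ R : ℝ, 0 ≤ R → ∃ n : ℕ, mass o (Iio (R ^ 2)) = n ∧ |n - R * L| ≤ C

/-- On an interval on which `f` has no zero, `g` has at most one. -/
lemma HerglotzPair.eq_of_zeros {f g : ℂ → ℂ} (h : HerglotzPair f g) {x y : ℝ} (hxy : x ≤ y)
    (hx : g x = 0) (hy : g y = 0) (hf : ∀ r ∈ Icc x y, (f r).re ≠ 0) : x = y := by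
  by_contra hne
  have hlt : x < y := lt_of_le_of_ne hxy hne
  have hd : ∀ r ∈ Icc x y, HasDerivAt (fun r : ℝ => (g r).re / (f r).re)
      (((deriv g r).re * (f r).re - (g r).re * (deriv f r).re) / (f r).re ^ 2) r := fun r hr =>
    ((h.differentiable.2 r).hasDerivAt.real_of_complex).div
      ((h.differentiable.1 r).hasDerivAt.real_of_complex) (hf r hr)
  obtain ⟨r, hr, h0⟩ := exists_hasDerivAt_eq_zero hlt
    (fun r hr => (hd r hr).continuousAt.continuousWithinAt) (by simp [hx, hy])
    (fun r hr => hd r (Ioo_subset_Icc_self hr))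
  have h1 := h.wronskian_neg r
  have h2 := hf r (Ioo_subset_Icc_self hr)
  rw [div_eq_zero_iff] at h0
  rcases h0 with h0 | h0
  · linarith
  · exact h2 (by simpa using h0)

/-- If `g(ρ²)` and `f(ρ²)` behave, up to scaling, like the cosine and the sine of `ρ L + c`, then
there is exactly one zero of `g` between consecutive extrema of the cosine. -/
lemma mass_zeroInd_eq_one {f g : ℂ → ℂ} (h : HerglotzPair f g) {L c ρ₀ : ℝ} {p r : ℝ → ℝ}
    (hL : 0 < L) (hp : ∀ ρ, ρ₀ ≤ ρ → 0 < p ρ)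
    (hg : ∀ ρ, ρ₀ ≤ ρ → |p ρ * (g ((ρ ^ 2 : ℝ) : ℂ)).re - Real.cos (ρ * L + c)| < 1 / 2)
    (hf : ∀ ρ, ρ₀ ≤ ρ → |r ρ * (f ((ρ ^ 2 : ℝ) : ℂ)).re - Real.sin (ρ * L + c)| < 1 / 2)
    {N : ℕ} {a b : ℝ} (ha0 : 0 ≤ a) (ha : ρ₀ ≤ a) (haN : a * L + c = N * Real.pi)
    (hbN : b * L + c = (N + 1 : ℕ) * Real.pi) :
    mass (zeroInd g) (Ico (a ^ 2) (b ^ 2)) = 1 := by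
  have hab : a < b := by
    have : (b - a) * L = Real.pi := by push_cast at hbN; linarith
    have h1 : 0 < (b - a) * L := this ▸ Real.pi_pos
    linarith [pos_of_mul_pos_left h1 hL.le]
  have hre : ∀ x : ℝ, (g x).re = 0 → g x = 0 := fun x hx => by
    rw [← (h.ofReal_re x).2, hx, Complex.ofReal_zero]
  have hcont : Continuous fun x : ℝ => (g x).re :=
    Complex.continuous_re.comp (h.differentiable.2.continuous.comp Complex.continuous_ofReal)
  apply le_antisymm
  · refine mass_le_one (fun x _ => by unfold zeroInd; split_ifs <;> simp) ?_
    -- at a zero of `g` the cosine is small, hence so it is between two zeros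
    have hsmall : ∀ x ∈ Ico (a ^ 2) (b ^ 2), g x = 0 →
        a ≤ √x ∧ √x < b ∧ |Real.cos (√x * L + c - N * Real.pi)| < 1 / 2 := fun x hx hx0 => by
      have h1 : a ≤ √x := Real.le_sqrt_of_sq_le hx.1
      refine ⟨h1, (Real.sqrt_lt' (ha0.trans_lt hab)).2 hx.2, ?_⟩
      have h2 := hg (√x) (ha.trans h1)
      rw [Real.sq_sqrt ((sq_nonneg a).trans hx.1), hx0] at h2
      rw [Real.cos_sub_nat_mul_pi, abs_mul, abs_pow, abs_neg, abs_one, one_pow, one_mul]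
      simpa using h2
    have key : ∀ x ∈ Ico (a ^ 2) (b ^ 2), ∀ y ∈ Ico (a ^ 2) (b ^ 2), g x = 0 → g y = 0 →
        x ≤ y → x = y := fun x hx y hy hx0 hy0 hxy => by
      refine h.eq_of_zeros hxy hx0 hy0 fun w hw hfw => ?_
      obtain ⟨x1, x2, x3⟩ := hsmall x hx hx0
      obtain ⟨y1, y2, y3⟩ := hsmall y hy hy0
      have hxw : √x ≤ √w := Real.sqrt_le_sqrt hw.1
      have hwy : √w ≤ √y := Real.sqrt_le_sqrt hw.2
      have hw0 : 0 ≤ w := ((sq_nonneg a).trans hx.1).trans hw.1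
      have e1 := hf (√w) (ha.trans (x1.trans hxw))
      rw [Real.sq_sqrt hw0, hfw, mul_zero, zero_sub, abs_neg] at e1
      have b1 : 0 ≤ √x * L + c - N * Real.pi := by
        have := mul_le_mul_of_nonneg_right x1 hL.le
        linarith
      have b2 : √y * L + c - N * Real.pi ≤ Real.pi := by
        have := mul_le_mul_of_nonneg_right y2.le hL.le
        push_cast at hbN
        linarith
      have m1 := mul_le_mul_of_nonneg_right hxw hL.le
      have m2 := mul_le_mul_of_nonneg_right hwy hL.le
      have c1 := Real.cos_le_cos_of_nonneg_of_le_pi b1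
        (show √w * L + c - N * Real.pi ≤ Real.pi by linarith) (by linarith)
      have c2 := Real.cos_le_cos_of_nonneg_of_le_pi
        (show 0 ≤ √w * L + c - N * Real.pi by linarith) b2 (by linarith)
      have c3 : |Real.cos (√w * L + c - N * Real.pi)| < 1 / 2 := by
        rw [abs_lt] at x3 y3 ⊢
        exact ⟨by linarith, by linarith⟩
      rw [Real.cos_sub_nat_mul_pi, abs_mul, abs_pow, abs_neg, abs_one, one_pow, one_mul] at c3
      have s1 := Real.sin_sq_add_cos_sq (√w * L + c)
      rw [← sq_abs, ← sq_abs (Real.cos _)] at s1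
      nlinarith [abs_nonneg (Real.sin (√w * L + c)), abs_nonneg (Real.cos (√w * L + c))]
    intro x hx y hy hx0 hy0
    rw [zeroInd_ne_zero] at hx0 hy0
    rcases le_total x y with hxy | hxy
    · exact key x hx y hy hx0 hy0 hxy
    · exact (key y hy x hx hy0 hx0 hxy).symm
  · have ea := hg a ha
    have eb := hg b (ha.trans hab.le)
    have pa := hp a ha
    have pb := hp b (ha.trans hab.le)
    have hsq : a ^ 2 ≤ b ^ 2 := by gcongr
    obtain ⟨x, hx, hx0⟩ : ∃ x ∈ Icc (a ^ 2) (b ^ 2), (g x).re = 0 := by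
      rw [haN, Real.cos_nat_mul_pi] at ea
      rw [hbN, Real.cos_nat_mul_pi, pow_succ (-1 : ℝ) N] at eb
      rcases neg_one_pow_eq_or ℝ N with hN | hN <;> rw [hN] at ea eb <;> rw [abs_lt] at ea eb
      · have ha' : 0 < (g ((a ^ 2 : ℝ) : ℂ)).re := by
          by_contra hcon
          have := mul_nonpos_of_nonneg_of_nonpos pa.le (not_lt.1 hcon)
          linarith [ea.1]
        have hb' : (g ((b ^ 2 : ℝ) : ℂ)).re < 0 := by
          by_contra hcon
          have := mul_nonneg pb.le (not_lt.1 hcon)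
          linarith [eb.2]
        exact intermediate_value_Icc' hsq hcont.continuousOn ⟨hb'.le, ha'.le⟩
      · have ha' : (g ((a ^ 2 : ℝ) : ℂ)).re < 0 := by
          by_contra hcon
          have := mul_nonneg pa.le (not_lt.1 hcon)
          linarith [ea.2]
        have hb' : 0 < (g ((b ^ 2 : ℝ) : ℂ)).re := by
          by_contra hcon
          have := mul_nonpos_of_nonneg_of_nonpos pb.le (not_lt.1 hcon)
          linarith [eb.1]
        exact intermediate_value_Icc hsq hcont.continuousOn ⟨ha'.le, hb'.le⟩
    have hxb : x ≠ b ^ 2 := by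
      rintro rfl
      rw [hx0, hbN, Real.cos_nat_mul_pi, mul_zero, zero_sub, abs_neg, abs_pow, abs_neg, abs_one,
        one_pow] at eb
      norm_num at eb
    exact one_le_mass (x := x) ⟨hx.1, lt_of_le_of_ne hx.2 hxb⟩ (zeroInd_ne_zero.2 (hre x hx0))

/-- Counting the zeros of `g` from one extremum of the cosine to the next; below the first extremum
there are finitely many. -/
lemma countsLike_zeroInd {f g : ℂ → ℂ} (h : HerglotzPair f g) {L c ρ₀ A : ℝ} {p r : ℝ → ℝ}
    (hL : 0 < L) (hp : ∀ ρ, ρ₀ ≤ ρ → 0 < p ρ)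
    (hg : ∀ ρ, ρ₀ ≤ ρ → |p ρ * (g ((ρ ^ 2 : ℝ) : ℂ)).re - Real.cos (ρ * L + c)| < 1 / 2)
    (hf : ∀ ρ, ρ₀ ≤ ρ → |r ρ * (f ((ρ ^ 2 : ℝ) : ℂ)).re - Real.sin (ρ * L + c)| < 1 / 2)
    (hA : ∀ x : ℝ, x < A → g x ≠ 0) :
    CountsLike (zeroInd g) (L / Real.pi) := by
  have hπ := Real.pi_pos
  obtain ⟨k₀, hk₀⟩ := exists_nat_ge ((max ρ₀ 0 * L + c) / Real.pi)
  rw [div_le_iff₀ hπ] at hk₀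
  set P : ℕ → ℝ := fun k => (((k₀ + k : ℕ) : ℝ) * Real.pi - c) / L with hP
  have hPL : ∀ k, P k * L + c = ((k₀ + k : ℕ) : ℝ) * Real.pi := fun k => by
    simp only [hP]; field_simp; ring
  have hPmono : Monotone P := fun i j hij => by
    simp only [hP]
    gcongr
  have hP0 : max ρ₀ 0 ≤ P 0 := by
    have := hPL 0
    rw [add_zero] at this
    have h1 : max ρ₀ 0 * L ≤ P 0 * L := by linarith
    exact le_of_mul_le_mul_right h1 hL
  have hPk : ∀ k, ρ₀ ≤ P k ∧ 0 ≤ P k := fun k =>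
    ⟨(le_max_left _ _).trans (hP0.trans (hPmono (Nat.zero_le k))),
      (le_max_right _ _).trans (hP0.trans (hPmono (Nat.zero_le k)))⟩
  have hzero : ∀ x < A, zeroInd g x = 0 := fun x hx => by
    by_contra hcon
    exact hA x hx (zeroInd_ne_zero.1 hcon)
  obtain ⟨n₀, hn₀⟩ : ∃ n₀ : ℕ, mass (zeroInd g) (Iio (P 0 ^ 2)) = n₀ := by
    refine (ENat.ne_top_iff_exists.1 (mass_ne_top ((h.finite_zeros A (P 0 ^ 2)).subset ?_))).imp
      fun n hn => hn.symm
    rintro x ⟨hx, hx0⟩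
    rw [mem_ofPred_eq, zeroInd_ne_zero] at hx0
    exact ⟨⟨not_lt.1 fun hxA => hA x hxA hx0, le_of_lt hx⟩, hx0⟩
  have hmass : ∀ k, mass (zeroInd g) (Iio (P k ^ 2)) = (n₀ + k : ℕ) := fun k => by
    induction k with
    | zero => rw [hn₀, add_zero]
    | succ k ih =>
      have hle : P k ^ 2 ≤ P (k + 1) ^ 2 :=
        pow_le_pow_left₀ (hPk k).2 (hPmono (Nat.le_succ k)) 2
      rw [← Iio_union_Ico_eq_Iio hle, mass_union (by
          rw [Set.disjoint_left]; exact fun x hx hx' => absurd hx (not_lt.2 hx'.1)), ih,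
        mass_zeroInd_eq_one h hL hp hg hf (N := k₀ + k) (hPk k).2 (hPk k).1 (hPL k)
          (hPL (k + 1))]
      push_cast
      ring
  refine ⟨n₀ + k₀ + 2 + |c| / Real.pi, A, hzero, fun R hR => ?_⟩
  have hc1 : -(|c| / Real.pi) ≤ c / Real.pi := by
    rw [← neg_div]; gcongr; exact neg_abs_le c
  have hc2 : c / Real.pi ≤ |c| / Real.pi := by gcongr; exact le_abs_self c
  have hPdiv : ∀ k, P k * (L / Real.pi) = k₀ + k - c / Real.pi := fun k => by
    have := hPL k
    push_cast at this
    field_simp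
    linarith
  have hLπ : 0 < L / Real.pi := by positivity
  have hnn : (0 : ℝ) ≤ n₀ := Nat.cast_nonneg _
  have hkk : (0 : ℝ) ≤ k₀ := Nat.cast_nonneg _
  rcases lt_or_ge R (P 0) with hRP | hRP
  · have hle : mass (zeroInd g) (Iio (R ^ 2)) ≤ n₀ := by
      rw [← hn₀]
      exact mass_mono (Iio_subset_Iio (by gcongr))
    obtain ⟨n, hn⟩ := ENat.ne_top_iff_exists.1 (ne_top_of_le_ne_top (ENat.natCast_ne_top n₀) hle)
    refine ⟨n, hn.symm, ?_⟩
    rw [← hn] at hle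
    have hle' : (n : ℝ) ≤ n₀ := by exact_mod_cast hle
    have h1 : R * (L / Real.pi) ≤ P 0 * (L / Real.pi) := by gcongr
    rw [hPdiv] at h1
    have h2 : 0 ≤ R * (L / Real.pi) := by positivity
    have h3 : (0 : ℝ) ≤ n := Nat.cast_nonneg _
    push_cast at h1
    rw [abs_le]
    constructor <;> linarith
  · set k := ⌊(R - P 0) * (L / Real.pi)⌋₊ with hk
    have h0 : 0 ≤ (R - P 0) * (L / Real.pi) := mul_nonneg (by linarith) hLπ.le
    have h1 : (k : ℝ) ≤ (R - P 0) * (L / Real.pi) := Nat.floor_le h0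
    have h2 : (R - P 0) * (L / Real.pi) < k + 1 := Nat.lt_floor_add_one _
    have e0 := hPdiv 0
    have e1 := hPdiv k
    have e2 := hPdiv (k + 1)
    push_cast at e0 e2
    have hk1 : P k ≤ R := by
      refine le_of_mul_le_mul_right ?_ hLπ
      linarith
    have hk2 : R ≤ P (k + 1) := by
      refine le_of_mul_le_mul_right ?_ hLπ
      linarith
    have l1 : mass (zeroInd g) (Iio (R ^ 2)) ≤ (n₀ + (k + 1) : ℕ) := by
      rw [← hmass]
      exact mass_mono (Iio_subset_Iio (by gcongr))
    have l2 : ((n₀ + k : ℕ) : ℕ∞) ≤ mass (zeroInd g) (Iio (R ^ 2)) := by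
      rw [← hmass]
      exact mass_mono (Iio_subset_Iio (pow_le_pow_left₀ (hPk k).2 hk1 2))
    obtain ⟨n, hn⟩ := ENat.ne_top_iff_exists.1 (ne_top_of_le_ne_top (ENat.natCast_ne_top _) l1)
    refine ⟨n, hn.symm, ?_⟩
    rw [← hn] at l1 l2
    have l1' : (n : ℝ) ≤ n₀ + (k + 1) := by exact_mod_cast l1
    have l2' : (n₀ : ℝ) + k ≤ n := by exact_mod_cast l2
    rw [abs_le]
    constructor <;> linarith

lemma mass_Iio_eq_mass_Ico {o : ℝ → ℕ} {A B : ℝ} (hAB : A ≤ B) (h : ∀ x < A, o x = 0) :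
    mass o (Iio B) = mass o (Ico A B) := by
  rw [← Iio_union_Ico_eq_Iio hAB, mass_union (by
    rw [Set.disjoint_left]; exact fun x hx hx' => absurd hx (not_lt.2 hx'.1)),
    mass_eq_zero (S := Iio A) h, zero_add]

/-- The counting functions of the denominators add up to that of the numerator. -/
lemma countsLike_pairSum {ι : Type*} [Fintype ι] [DecidableEq ι] [Nonempty ι] {f g : ι → ℂ → ℂ}
    {L : ι → ℝ} (h : ∀ j, HerglotzPair (f j) (g j))
    (hc : ∀ j, CountsLike (zeroInd (g j)) (L j)) {A : ℝ}
    (hA : ∀ x : ℝ, x < A → pairSum f g x ≠ 0) :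
    CountsLike (realOrder (pairSum f g)) (∑ j, L j) := by
  choose C Λ hΛ hcount using hc
  have hord : ∀ x < A, realOrder (pairSum f g) x = 0 := fun x hx => by
    rw [realOrder, analyticOrderNatAt, ((differentiable_pairSum h).analyticAt
      (x : ℂ)).analyticOrderAt_eq_zero.2 (hA x hx)]
    rfl
  obtain ⟨B, hB⟩ : ∃ B : ℝ, B ≤ 0 ∧ B ≤ A ∧ ∀ j, B ≤ Λ j := by
    refine ⟨-|A| - ∑ j, |Λ j|, ?_, ?_, fun j => ?_⟩
    · have : 0 ≤ ∑ j, |Λ j| := Finset.sum_nonneg fun _ _ => abs_nonneg _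
      linarith [abs_nonneg A]
    · have : 0 ≤ ∑ j, |Λ j| := Finset.sum_nonneg fun _ _ => abs_nonneg _
      linarith [neg_abs_le A]
    · have := Finset.single_le_sum (f := fun j => |Λ j|) (fun _ _ => abs_nonneg _)
        (Finset.mem_univ j)
      linarith [neg_abs_le (Λ j), abs_nonneg A]
  refine ⟨∑ j, C j + 1, A, hord, fun R hR => ?_⟩
  choose n hn hnC using fun j => hcount j R hR
  have hBR : B ≤ R ^ 2 := hB.1.trans (sq_nonneg R)
  have hmain := mass_pairSum h B (R ^ 2)
  rw [← mass_Iio_eq_mass_Ico hBR fun x hx => hord x (hx.trans_le hB.2.1)] at hmain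
  have hsum : ∑ j, mass (zeroInd (g j)) (Ico B (R ^ 2)) = ((∑ j, n j : ℕ) : ℕ∞) := by
    push_cast
    refine Finset.sum_congr rfl fun j _ => ?_
    rw [← hn j, mass_Iio_eq_mass_Ico hBR fun x hx => hΛ j x (hx.trans_le (hB.2.2 j))]
  rw [hsum] at hmain
  have hfin : ((∑ j, n j : ℕ) : ℕ∞) + 1 ≠ ⊤ := by
    exact_mod_cast ENat.natCast_ne_top (∑ j, n j + 1)
  obtain ⟨N, hN⟩ := ENat.ne_top_iff_exists.1 (ne_top_of_le_ne_top hfin hmain.1)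
  refine ⟨N, hN.symm, ?_⟩
  rw [← hN] at hmain
  have l1 : (N : ℝ) ≤ ∑ j, (n j : ℝ) + 1 := by exact_mod_cast hmain.1
  have l2 : ∑ j, (n j : ℝ) ≤ N + 1 := by exact_mod_cast hmain.2
  have l3 : |∑ j, (n j : ℝ) - R * ∑ j, L j| ≤ ∑ j, C j := by
    rw [Finset.mul_sum, ← Finset.sum_sub_distrib]
    exact (Finset.abs_sum_le_sum_abs _ _).trans (Finset.sum_le_sum fun j _ => hnC j)
  rw [abs_le] at l3 ⊢
  constructor <;> linarith

/-! ### The fundamental system on the real axis -/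

section Edge

variable {q : ℝ → ℝ} {s t : ℝ}

/-- Behaviour of the solution with initial data `(1, h)` for `lam = ρ ^ 2 → +∞`. -/
lemma ivpSol_one_atTop (hst : s ≤ t) (hq : IntervalIntegrable q volume s t) (h : ℂ) :
    ∀ᶠ ρ : ℝ in atTop,
      |((ivpSol q ((ρ ^ 2 : ℝ) : ℂ) s t 1 h).1 t).re - Real.cos (ρ * (t - s))| < 1 / 2 ∧
      |-ρ⁻¹ * ((ivpSol q ((ρ ^ 2 : ℝ) : ℂ) s t 1 h).2 t).re - Real.sin (ρ * (t - s))| < 1 / 2 := by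
  obtain ⟨C, R, hC, hR, H⟩ := ivpSol_asymptotics_one hst hq h
  filter_upwards [eventually_ge_atTop R, eventually_gt_atTop (2 * C)] with ρ h1 h2
  have hρ : 0 < ρ := by linarith
  have hn : ‖(ρ : ℂ)‖ = ρ := by rw [Complex.norm_real, Real.norm_of_nonneg hρ.le]
  obtain ⟨e1, e2⟩ := H ρ (by rw [hn]; exact h1)
  rw [hn, Complex.ofReal_im, abs_zero, zero_mul, Real.exp_zero, mul_one] at e1
  rw [Complex.ofReal_im, abs_zero, zero_mul, Real.exp_zero, mul_one] at e2
  rw [← Complex.ofReal_mul, ← Complex.ofReal_pow] at e1 e2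
  have hCρ : C / ρ < 1 / 2 := by rw [div_lt_div_iff₀ hρ two_pos]; linarith
  constructor
  · refine lt_of_le_of_lt ?_ (e1.trans_lt hCρ)
    have := Complex.abs_re_le_norm ((ivpSol q ((ρ ^ 2 : ℝ) : ℂ) s t 1 h).1 t -
      Complex.cos ((ρ * (t - s) : ℝ) : ℂ))
    rwa [Complex.sub_re, Complex.cos_ofReal_re] at this
  · have h3 := (Complex.abs_re_le_norm _).trans e2
    rw [Complex.add_re, Complex.re_ofReal_mul, Complex.sin_ofReal_re] at h3
    have h4 : -ρ⁻¹ * ((ivpSol q ((ρ ^ 2 : ℝ) : ℂ) s t 1 h).2 t).re - Real.sin (ρ * (t - s))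
      = -ρ⁻¹ * (((ivpSol q ((ρ ^ 2 : ℝ) : ℂ) s t 1 h).2 t).re + ρ * Real.sin (ρ * (t - s))) := by
      field_simp
      ring
    rw [h4, abs_mul, abs_neg, abs_inv, abs_of_pos hρ]
    refine lt_of_le_of_lt ?_ hCρ
    rw [div_eq_inv_mul]
    gcongr

/-- Behaviour of the solution with initial data `(0, 1)` for `lam = ρ ^ 2 → +∞`. -/
lemma ivpSol_zero_atTop (hst : s ≤ t) (hq : IntervalIntegrable q volume s t) :
    ∀ᶠ ρ : ℝ in atTop,
      |ρ * ((ivpSol q ((ρ ^ 2 : ℝ) : ℂ) s t 0 1).1 t).re - Real.sin (ρ * (t - s))| < 1 / 2 := by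
  obtain ⟨C, R, hC, hR, H⟩ := ivpSol_asymptotics_zero hst hq
  filter_upwards [eventually_ge_atTop R, eventually_gt_atTop (2 * C)] with ρ h1 h2
  have hρ : 0 < ρ := by linarith
  have hn : ‖(ρ : ℂ)‖ = ρ := by rw [Complex.norm_real, Real.norm_of_nonneg hρ.le]
  obtain ⟨e1, -⟩ := H ρ (by rw [hn]; exact h1)
  rw [hn, Complex.ofReal_im, abs_zero, zero_mul, Real.exp_zero, mul_one] at e1
  rw [← Complex.ofReal_mul, ← Complex.ofReal_pow] at e1
  have hCρ : C / ρ < 1 / 2 := by rw [div_lt_div_iff₀ hρ two_pos]; linarith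
  refine lt_of_le_of_lt ?_ (e1.trans_lt hCρ)
  have := Complex.abs_re_le_norm ((ρ : ℂ) * (ivpSol q ((ρ ^ 2 : ℝ) : ℂ) s t 0 1).1 t -
    Complex.sin ((ρ * (t - s) : ℝ) : ℂ))
  rwa [Complex.sub_re, Complex.sin_ofReal_re, Complex.re_ofReal_mul] at this

/-- Behaviour of the solution with initial data `(1, h)` for `lam = -k ^ 2 → -∞`. -/
lemma ivpSol_one_atBot (hst : s < t) (hq : IntervalIntegrable q volume s t) (h : ℂ) :
    ∀ᶠ k : ℝ in atTop,
      Real.exp (k * (t - s)) / 4 ≤ ((ivpSol q ((-k ^ 2 : ℝ) : ℂ) s t 1 h).1 t).re ∧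
      ((ivpSol q ((-k ^ 2 : ℝ) : ℂ) s t 1 h).1 t).re ≤ 2 * Real.exp (k * (t - s)) ∧
      k * Real.exp (k * (t - s)) / 8 ≤ ((ivpSol q ((-k ^ 2 : ℝ) : ℂ) s t 1 h).2 t).re := by
  obtain ⟨C, R, hC, hR, H⟩ := ivpSol_asymptotics_one hst.le hq h
  filter_upwards [eventually_ge_atTop R, eventually_gt_atTop (4 * C),
    eventually_gt_atTop (1 / (t - s))] with k h1 h2 h3
  have hk : 0 < k := by linarith
  have hL : 0 < t - s := sub_pos.2 hst
  rw [div_lt_iff₀ hL] at h3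
  have hn : ‖(Complex.I * k)‖ = k := by
    rw [norm_mul, Complex.norm_I, one_mul, Complex.norm_real, Real.norm_of_nonneg hk.le]
  obtain ⟨e1, e2⟩ := H (Complex.I * k) (by rw [hn]; exact h1)
  have hsq : (Complex.I * k) ^ 2 = ((-k ^ 2 : ℝ) : ℂ) := by
    rw [mul_pow, Complex.I_sq]; push_cast; ring
  have him : |(Complex.I * (k : ℂ)).im| = k := by simp [abs_of_pos hk]
  have harg : Complex.I * k * ((t - s : ℝ) : ℂ) = ((k * (t - s) : ℝ) : ℂ) * Complex.I := by
    push_cast; ring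
  rw [hn, hsq, him, harg, Complex.cos_mul_I, ← Complex.ofReal_cosh] at e1
  rw [hsq, him, harg, Complex.sin_mul_I, ← Complex.ofReal_sinh] at e2
  have e1' := (Complex.abs_re_le_norm _).trans e1
  have e2' := (Complex.abs_re_le_norm _).trans e2
  have hI : Complex.I * k * (((Real.sinh (k * (t - s)) : ℝ) : ℂ) * Complex.I)
      = ((-(k * Real.sinh (k * (t - s))) : ℝ) : ℂ) := by
    push_cast
    linear_combination ((k : ℂ) * Complex.sinh (k * (t - s))) * Complex.I_mul_I
  rw [hI] at e2'
  rw [Complex.sub_re, Complex.ofReal_re, Real.cosh_eq] at e1'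
  rw [Complex.add_re, Complex.ofReal_re, Real.sinh_eq] at e2'
  set E := Real.exp (k * (t - s)) with hE
  have hE0 : 0 < E := Real.exp_pos _
  have hE1 : 1 ≤ E := Real.one_le_exp (by positivity)
  have hE2 : Real.exp (-(k * (t - s))) ≤ E / 4 := by
    have h4 : 2 ≤ E := by
      have := Real.add_one_le_exp (k * (t - s))
      linarith
    rw [Real.exp_neg, ← hE, inv_le_iff_one_le_mul₀ hE0]
    nlinarith
  have hE3 : 0 < Real.exp (-(k * (t - s))) := Real.exp_pos _
  have hCk : C / k * E ≤ E / 4 := by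
    have : C / k ≤ 1 / 4 := by rw [div_le_div_iff₀ hk (by norm_num)]; linarith
    nlinarith
  rw [abs_le] at e1' e2'
  refine ⟨by linarith, by linarith, ?_⟩
  have h5 : C * E ≤ k / 4 * E := by gcongr; linarith
  have h6 : k * Real.exp (-(k * (t - s))) ≤ k * (E / 4) := by gcongr
  linarith [e2'.1]

/-- Behaviour of the solution with initial data `(0, 1)` for `lam = -k ^ 2 → -∞`. -/
lemma ivpSol_zero_atBot (hst : s < t) (hq : IntervalIntegrable q volume s t) :
    ∀ᶠ k : ℝ in atTop,
      0 < ((ivpSol q ((-k ^ 2 : ℝ) : ℂ) s t 0 1).1 t).re ∧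
      0 < ((ivpSol q ((-k ^ 2 : ℝ) : ℂ) s t 0 1).2 t).re := by
  obtain ⟨C, R, hC, hR, H⟩ := ivpSol_asymptotics_zero hst.le hq
  filter_upwards [eventually_ge_atTop R, eventually_gt_atTop (8 * C),
    eventually_gt_atTop (1 / (t - s))] with k h1 h2 h3
  have hk : 0 < k := by linarith
  have hL : 0 < t - s := sub_pos.2 hst
  rw [div_lt_iff₀ hL] at h3
  have hn : ‖(Complex.I * k)‖ = k := by
    rw [norm_mul, Complex.norm_I, one_mul, Complex.norm_real, Real.norm_of_nonneg hk.le]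
  obtain ⟨e1, e2⟩ := H (Complex.I * k) (by rw [hn]; exact h1)
  have hsq : (Complex.I * k) ^ 2 = ((-k ^ 2 : ℝ) : ℂ) := by
    rw [mul_pow, Complex.I_sq]; push_cast; ring
  have him : |(Complex.I * (k : ℂ)).im| = k := by simp [abs_of_pos hk]
  have harg : Complex.I * k * ((t - s : ℝ) : ℂ) = ((k * (t - s) : ℝ) : ℂ) * Complex.I := by
    push_cast; ring
  rw [hn, hsq, him, harg, Complex.sin_mul_I, ← Complex.ofReal_sinh] at e1
  rw [hn, hsq, him, harg, Complex.cos_mul_I, ← Complex.ofReal_cosh] at e2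
  set E := Real.exp (k * (t - s)) with hE
  have hI : Complex.I * k * (ivpSol q ((-k ^ 2 : ℝ) : ℂ) s t 0 1).1 t
      - ((Real.sinh (k * (t - s)) : ℝ) : ℂ) * Complex.I
      = Complex.I * (((k : ℝ) : ℂ) * (ivpSol q ((-k ^ 2 : ℝ) : ℂ) s t 0 1).1 t
        - ((Real.sinh (k * (t - s)) : ℝ) : ℂ)) := by ring
  rw [hI, norm_mul, Complex.norm_I, one_mul] at e1
  have e1' := (Complex.abs_re_le_norm _).trans e1
  have e2' := (Complex.abs_re_le_norm _).trans e2
  rw [Complex.sub_re, Complex.ofReal_re, Complex.re_ofReal_mul, Real.sinh_eq, ← hE] at e1'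
  rw [Complex.sub_re, Complex.ofReal_re, Real.cosh_eq, ← hE] at e2'
  have hE0 : 0 < E := Real.exp_pos _
  have hE2 : Real.exp (-(k * (t - s))) ≤ E / 4 := by
    have h4 : 2 ≤ E := by
      have := Real.add_one_le_exp (k * (t - s))
      linarith
    rw [Real.exp_neg, ← hE, inv_le_iff_one_le_mul₀ hE0]
    nlinarith
  have hE3 : 0 < Real.exp (-(k * (t - s))) := Real.exp_pos _
  have hCk : C / k * E ≤ E / 8 := by
    have : C / k ≤ 1 / 8 := by rw [div_le_div_iff₀ hk (by norm_num)]; linarith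
    nlinarith
  rw [abs_le] at e1' e2'
  refine ⟨?_, by linarith [e2'.1]⟩
  have : 0 < k * ((ivpSol q ((-k ^ 2 : ℝ) : ℂ) s t 0 1).1 t).re := by linarith [e1'.1]
  exact pos_of_mul_pos_right this hk.le

lemma exists_of_eventually_neg_sq {p : ℝ → Prop} (h : ∀ᶠ k : ℝ in atTop, p (-k ^ 2)) :
    ∃ A : ℝ, ∀ x < A, p x := by
  obtain ⟨k₀, hk₀⟩ := eventually_atTop.1 h
  refine ⟨-(max k₀ 0) ^ 2, fun x hx => ?_⟩
  have h1 : (max k₀ 0) ^ 2 < -x := by linarith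
  have h2 : max k₀ 0 ≤ √(-x) := Real.le_sqrt_of_sq_le h1.le
  have h3 := hk₀ _ ((le_max_left _ _).trans h2)
  rwa [Real.sq_sqrt ((sq_nonneg _).trans h1.le), neg_neg] at h3

/-- The zeros of `y (t, ·)` for initial data `(1, h)`. -/
lemma countsLike_ivpSol_one (hst : s < t) (hq : IntervalIntegrable q volume s t) (h : ℝ) :
    CountsLike (zeroInd fun z => (ivpSol q z s t 1 h).1 t) ((t - s) / Real.pi) := by
  have hpair := herglotzPair_ivpSol hst hq (c := 1) (c' := h) (Or.inl one_ne_zero)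
  rw [Complex.ofReal_one] at hpair
  obtain ⟨ρ₀, hρ₀⟩ := eventually_atTop.1 (ivpSol_one_atTop hst.le hq h)
  obtain ⟨A, hA⟩ := exists_of_eventually_neg_sq
    (p := fun x => (ivpSol q (x : ℂ) s t 1 h).1 t ≠ 0) (by
      filter_upwards [ivpSol_one_atBot hst hq h] with k hk h0
      rw [h0] at hk
      have := hk.1
      rw [Complex.zero_re] at this
      linarith [Real.exp_pos (k * (t - s))])
  exact countsLike_zeroInd hpair (L := t - s) (c := 0) (ρ₀ := ρ₀) (A := A) (p := fun _ => 1)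
    (r := fun ρ => -ρ⁻¹) (sub_pos.2 hst) (fun _ _ => one_pos)
    (fun ρ hρ => by simpa using (hρ₀ ρ hρ).1) (fun ρ hρ => by simpa using (hρ₀ ρ hρ).2) hA

/-- The zeros of `y (t, ·)` for initial data `(0, 1)`. -/
lemma countsLike_ivpSol_zero (hst : s < t) (hq : IntervalIntegrable q volume s t) :
    CountsLike (zeroInd fun z => (ivpSol q z s t 0 1).1 t) ((t - s) / Real.pi) := by
  have hpair := herglotzPair_fundamental hst hq
  obtain ⟨ρ₀, hρ₀⟩ := eventually_atTop.1 ((ivpSol_one_atTop hst.le hq 0).and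
    ((ivpSol_zero_atTop hst.le hq).and (eventually_gt_atTop 0)))
  obtain ⟨A, hA⟩ := exists_of_eventually_neg_sq
    (p := fun x => (ivpSol q (x : ℂ) s t 0 1).1 t ≠ 0) (by
      filter_upwards [ivpSol_zero_atBot hst hq] with k hk h0
      rw [h0] at hk
      exact lt_irrefl _ hk.1)
  -- the phase `-π / 2` turns the cosine into the sine
  refine countsLike_zeroInd hpair (L := t - s) (c := -(Real.pi / 2)) (ρ₀ := ρ₀) (A := A)
    (p := fun ρ => ρ) (r := fun _ => -1) (sub_pos.2 hst) (fun ρ hρ => (hρ₀ ρ hρ).2.2)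
    (fun ρ hρ => ?_) (fun ρ hρ => ?_) hA
  · rw [← sub_eq_add_neg, Real.cos_sub_pi_div_two]
    exact (hρ₀ ρ hρ).2.1
  · rw [← sub_eq_add_neg, Real.sin_sub_pi_div_two, ← abs_neg]
    have := (hρ₀ ρ hρ).1.1
    convert this using 2
    ring

end Edge

/-! ### Growth of order one half -/

/-- `F` grows at most like `exp (C √|z|)`. -/
def ExpSqrtBound (F : ℂ → ℂ) : Prop :=
  ∃ C R : ℝ, 0 ≤ C ∧ ∀ z : ℂ, R ≤ ‖z‖ → ‖F z‖ ≤ Real.exp (C * (1 + √‖z‖))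

section ExpSqrt

variable {F G : ℂ → ℂ}

lemma ExpSqrtBound.mul (hF : ExpSqrtBound F) (hG : ExpSqrtBound G) :
    ExpSqrtBound fun z => F z * G z := by
  obtain ⟨C, R, hC, h⟩ := hF
  obtain ⟨C', R', hC', h'⟩ := hG
  refine ⟨C + C', max R R', by positivity, fun z hz => ?_⟩
  rw [norm_mul, add_mul, Real.exp_add]
  exact mul_le_mul (h z ((le_max_left _ _).trans hz)) (h' z ((le_max_right _ _).trans hz))
    (norm_nonneg _) (Real.exp_pos _).le

lemma ExpSqrtBound.add (hF : ExpSqrtBound F) (hG : ExpSqrtBound G) :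
    ExpSqrtBound fun z => F z + G z := by
  obtain ⟨C, R, hC, h⟩ := hF
  obtain ⟨C', R', hC', h'⟩ := hG
  refine ⟨C + C' + 1, max R R', by positivity, fun z hz => ?_⟩
  have h1 := h z ((le_max_left _ _).trans hz)
  have h2 := h' z ((le_max_right _ _).trans hz)
  set w := 1 + √‖z‖ with hw
  have hw1 : 1 ≤ w := by linarith [Real.sqrt_nonneg ‖z‖]
  have e1 : Real.exp (C * w) ≤ Real.exp ((C + C') * w) := Real.exp_le_exp.2 (by nlinarith)
  have e2 : Real.exp (C' * w) ≤ Real.exp ((C + C') * w) := Real.exp_le_exp.2 (by nlinarith)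
  have e3 : 2 ≤ Real.exp w := by linarith [Real.add_one_le_exp w]
  calc ‖F z + G z‖ ≤ Real.exp ((C + C') * w) * 2 := by linarith [norm_add_le (F z) (G z)]
    _ ≤ Real.exp ((C + C') * w) * Real.exp w := by gcongr
    _ = _ := by rw [← Real.exp_add]; congr 1; ring

lemma expSqrtBound_const (c : ℂ) : ExpSqrtBound fun _ => c := by
  refine ⟨‖c‖, 0, norm_nonneg c, fun z _ => ?_⟩
  have h1 := Real.add_one_le_exp (‖c‖ * (1 + √‖z‖))
  nlinarith [norm_nonneg c, Real.sqrt_nonneg ‖z‖, mul_nonneg (norm_nonneg c) (Real.sqrt_nonneg ‖z‖)]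

lemma expSqrtBound_of_sq {L C R : ℝ} (hL : 0 ≤ L) (hC : 0 ≤ C)
    (h : ∀ ρ : ℂ, R ≤ ‖ρ‖ → ‖F (ρ ^ 2)‖ ≤ (C + ‖ρ‖) * Real.exp (|ρ.im| * L)) :
    ExpSqrtBound F := by
  refine ⟨C + L + 1, max R 0 ^ 2, by positivity, fun z hz => ?_⟩
  obtain ⟨ρ, hρ⟩ := IsAlgClosed.exists_pow_nat_eq z two_pos
  have hn : √‖z‖ = ‖ρ‖ := by rw [← hρ, norm_pow, Real.sqrt_sq (norm_nonneg _)]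
  have hRρ : R ≤ ‖ρ‖ := by
    rw [← hρ, norm_pow] at hz
    exact (le_max_left _ _).trans (le_of_sq_le_sq hz (norm_nonneg ρ))
  rw [hn, ← hρ]
  have h1 := Real.add_one_le_exp (C + ‖ρ‖)
  have h2 : Real.exp (|ρ.im| * L) ≤ Real.exp (‖ρ‖ * L) := by
    refine Real.exp_le_exp.2 ?_
    gcongr
    exact Complex.abs_im_le_norm ρ
  calc ‖F (ρ ^ 2)‖ ≤ (C + ‖ρ‖) * Real.exp (|ρ.im| * L) := h ρ hRρ
    _ ≤ Real.exp (C + ‖ρ‖) * Real.exp (‖ρ‖ * L) := by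
      gcongr
      linarith
    _ = Real.exp (C + ‖ρ‖ + ‖ρ‖ * L) := (Real.exp_add _ _).symm
    _ ≤ _ := by
      refine Real.exp_le_exp.2 ?_
      nlinarith [norm_nonneg ρ, mul_nonneg hC (norm_nonneg ρ)]

lemma expSqrtBound_ivpSol_one {q : ℝ → ℝ} {s t : ℝ} (hst : s ≤ t)
    (hq : IntervalIntegrable q volume s t) (h : ℂ) :
    ExpSqrtBound (fun z => (ivpSol q z s t 1 h).1 t) ∧
      ExpSqrtBound (fun z => (ivpSol q z s t 1 h).2 t) := by
  obtain ⟨C, R, hC, hR, H⟩ := ivpSol_asymptotics_one hst hq h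
  refine ⟨expSqrtBound_of_sq (sub_nonneg.2 hst) hC.le (R := R) fun ρ hρ => ?_,
    expSqrtBound_of_sq (sub_nonneg.2 hst) hC.le (R := R) fun ρ hρ => ?_⟩
  · have hρ1 : 1 ≤ ‖ρ‖ := hR.trans hρ
    have h1 := (H ρ hρ).1
    have h2 := norm_cos_le_exp (ρ * ((t - s : ℝ) : ℂ))
    rw [abs_im_mul_sub ρ hst] at h2
    have h3 : C / ‖ρ‖ ≤ C := div_le_self hC.le hρ1
    have h4 := norm_le_norm_sub_add ((ivpSol q (ρ ^ 2) s t 1 h).1 t)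
      (Complex.cos (ρ * ((t - s : ℝ) : ℂ)))
    nlinarith [Real.exp_pos (|ρ.im| * (t - s))]
  · have h1 := (H ρ hρ).2
    have h2 := norm_sin_le_exp (ρ * ((t - s : ℝ) : ℂ))
    rw [abs_im_mul_sub ρ hst] at h2
    have h4 := norm_le_norm_sub_add ((ivpSol q (ρ ^ 2) s t 1 h).2 t)
      (-(ρ * Complex.sin (ρ * ((t - s : ℝ) : ℂ))))
    rw [sub_neg_eq_add, norm_neg, norm_mul] at h4
    nlinarith [mul_le_mul_of_nonneg_left h2 (norm_nonneg ρ)]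

lemma expSqrtBound_ivpSol_zero {q : ℝ → ℝ} {s t : ℝ} (hst : s ≤ t)
    (hq : IntervalIntegrable q volume s t) :
    ExpSqrtBound (fun z => (ivpSol q z s t 0 1).1 t) ∧
      ExpSqrtBound (fun z => (ivpSol q z s t 0 1).2 t) := by
  obtain ⟨C, R, hC, hR, H⟩ := ivpSol_asymptotics_zero hst hq
  refine ⟨expSqrtBound_of_sq (sub_nonneg.2 hst) hC.le (R := R) fun ρ hρ => ?_,
    expSqrtBound_of_sq (sub_nonneg.2 hst) hC.le (R := R) fun ρ hρ => ?_⟩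
  · have hρ1 : 1 ≤ ‖ρ‖ := hR.trans hρ
    have h1 := (H ρ hρ).1
    have h2 := norm_sin_le_exp (ρ * ((t - s : ℝ) : ℂ))
    rw [abs_im_mul_sub ρ hst] at h2
    have h3 : C / ‖ρ‖ ≤ C := div_le_self hC.le hρ1
    have h4 := norm_le_norm_sub_add (ρ * (ivpSol q (ρ ^ 2) s t 0 1).1 t)
      (Complex.sin (ρ * ((t - s : ℝ) : ℂ)))
    rw [norm_mul] at h4
    nlinarith [Real.exp_pos (|ρ.im| * (t - s)), norm_nonneg ((ivpSol q (ρ ^ 2) s t 0 1).1 t)]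
  · have hρ1 : 1 ≤ ‖ρ‖ := hR.trans hρ
    have h1 := (H ρ hρ).2
    have h2 := norm_cos_le_exp (ρ * ((t - s : ℝ) : ℂ))
    rw [abs_im_mul_sub ρ hst] at h2
    have h3 : C / ‖ρ‖ ≤ C := div_le_self hC.le hρ1
    have h4 := norm_le_norm_sub_add ((ivpSol q (ρ ^ 2) s t 0 1).2 t)
      (Complex.cos (ρ * ((t - s : ℝ) : ℂ)))
    nlinarith [Real.exp_pos (|ρ.im| * (t - s))]

/-- An upper bound `exp (C (1 + √|z|))` and a lower bound `c exp (K √|z|)` on the negative axis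
pin the order down to `1 / 2`. -/
lemma growthOrder_eq_half (hF : ExpSqrtBound F) {c K : ℝ} (hc : 0 < c) (hK : 1 < K)
    (hlow : ∀ᶠ k : ℝ in atTop, c * Real.exp (K * k) ≤ ‖F ((-k ^ 2 : ℝ) : ℂ)‖) :
    growthOrder F = ((1 / 2 : ℝ) : EReal) := by
  obtain ⟨C, R, hC, hup⟩ := hF
  have hM : ∀ r, R ≤ r → 0 ≤ r → maxModulus F r ≤ Real.exp (C * (1 + √r)) ∧
      ‖F ((-r : ℝ) : ℂ)‖ ≤ maxModulus F r := fun r hRr hr => by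
    have hbd : ∀ y ∈ (fun z => ‖F z‖) '' Metric.sphere (0 : ℂ) r,
        y ≤ Real.exp (C * (1 + √r)) := by
      rintro _ ⟨z, hz, rfl⟩
      rw [mem_sphere_zero_iff_norm] at hz
      have := hup z (by rw [hz]; exact hRr)
      rwa [hz] at this
    have hmem : ‖F ((-r : ℝ) : ℂ)‖ ∈ (fun z => ‖F z‖) '' Metric.sphere (0 : ℂ) r :=
      ⟨((-r : ℝ) : ℂ), by simp [abs_of_nonneg hr], rfl⟩
    exact ⟨csSup_le ⟨_, hmem⟩ hbd, le_csSup ⟨_, hbd⟩ hmem⟩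
  have hsqrt : Tendsto (fun r : ℝ => √r) atTop atTop := Real.tendsto_sqrt_atTop
  have hev : ∀ᶠ r : ℝ in atTop, √r ≤ Real.log (maxModulus F r) ∧
      Real.log (maxModulus F r) ≤ (2 * C + 1) * √r := by
    have h1 : ∀ᶠ k : ℝ in atTop, -Real.log c ≤ (K - 1) * k :=
      (tendsto_id.const_mul_atTop (sub_pos.2 hK)).eventually_ge_atTop _
    filter_upwards [eventually_ge_atTop R, eventually_ge_atTop 1, hsqrt.eventually hlow,
      hsqrt.eventually h1] with r h2 h3 h4 h5
    have hr : 0 ≤ r := zero_le_one.trans h3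
    rw [Real.sq_sqrt hr] at h4
    obtain ⟨m1, m2⟩ := hM r h2 hr
    have h6 : c * Real.exp (K * √r) ≤ maxModulus F r := h4.trans m2
    have hpos : 0 < c * Real.exp (K * √r) := by positivity
    have hr1 : 1 ≤ √r := Real.one_le_sqrt.2 h3
    constructor
    · have := Real.log_le_log hpos h6
      rw [Real.log_mul hc.ne' (Real.exp_pos _).ne', Real.log_exp] at this
      linarith
    · have := Real.log_le_log (hpos.trans_le h6) m1
      rw [Real.log_exp] at this
      nlinarith
  have hlim : Tendsto (fun r : ℝ => Real.log (Real.log (maxModulus F r)) / Real.log r) atTop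
      (𝓝 (1 / 2)) := by
    have hup' : Tendsto (fun r : ℝ => Real.log (2 * C + 1) / Real.log r + 1 / 2) atTop
        (𝓝 (0 + 1 / 2)) :=
      (tendsto_const_nhds.div_atTop Real.tendsto_log_atTop).add tendsto_const_nhds
    rw [zero_add] at hup'
    refine tendsto_of_tendsto_of_tendsto_of_le_of_le' tendsto_const_nhds hup' ?_ ?_
    · filter_upwards [hev, eventually_gt_atTop 1] with r h1 h2
      have hlog : 0 < Real.log r := Real.log_pos h2
      have hs : 0 < √r := Real.sqrt_pos.2 (by linarith)
      have := Real.log_le_log hs h1.1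
      rw [Real.log_sqrt (by linarith)] at this
      rw [le_div_iff₀ hlog]
      linarith
    · filter_upwards [hev, eventually_gt_atTop 1] with r h1 h2
      have hlog : 0 < Real.log r := Real.log_pos h2
      have hs : 0 < √r := Real.sqrt_pos.2 (by linarith)
      have := Real.log_le_log (hs.trans_le h1.1) h1.2
      rw [Real.log_mul (by positivity) hs.ne', Real.log_sqrt (by linarith)] at this
      rw [div_le_iff₀ hlog, add_mul, div_mul_cancel₀ _ hlog.ne']
      linarith
  exact ((continuous_coe_real_ereal.tendsto _).comp hlim).limsup_eq

end ExpSqrt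

/-! ### Enumeration in increasing order -/

section Enumeration

variable {o : ℝ → ℕ} {L : ℝ}

lemma finite_of_mass_ne_top {S : Set ℝ} (h : mass o S ≠ ⊤) : (S ∩ {x | o x ≠ 0}).Finite := by
  rw [mass, Set.encard_ne_top_iff] at h
  refine (h.image Prod.fst).subset ?_
  rintro x ⟨hx, hx0⟩
  exact ⟨(x, 0), ⟨hx, Nat.pos_of_ne_zero hx0⟩, rfl⟩

lemma mass_Iic (x : ℝ) : mass o (Iic x) = mass o (Iio x) + o x := by
  rw [← Iio_union_right, mass_union (by simp), mass_singleton]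

lemma exists_mass_Iic_eq {x : ℝ} (h : mass o (Iio x) ≠ ⊤) (h0 : mass o (Iio x) ≠ 0) :
    ∃ y < x, o y ≠ 0 ∧ mass o (Iic y) = mass o (Iio x) := by
  have hfin := finite_of_mass_ne_top h
  have hne : (Iio x ∩ {x | o x ≠ 0}).Nonempty := by
    by_contra hcon
    rw [Set.not_nonempty_iff_eq_empty, Set.eq_empty_iff_forall_notMem] at hcon
    exact h0 (mass_eq_zero fun y hy => by
      by_contra hoy
      exact hcon y ⟨hy, hoy⟩)
  obtain ⟨y, ⟨hy, hoy⟩, hmax⟩ := Set.exists_max_image _ id hfin hne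
  refine ⟨y, hy, hoy, ?_⟩
  rw [← Iic_union_Ioo_eq_Iio hy, mass_union (by
    rw [Set.disjoint_left]; exact fun r hr hr' => absurd hr'.1 (not_lt.2 hr)),
    mass_eq_zero (S := Ioo y x), add_zero]
  intro r hr
  by_contra hor
  exact absurd (hmax r ⟨hr.2, hor⟩) (not_le.2 hr.1)

/-- The points counted by `o` can be listed in increasing order, and the `k`-th of them is
`(k / L) ^ 2` up to an error `O(1)` in the square root. -/
lemma CountsLike.exists_enumeration (h : CountsLike o L) (hL : 0 < L) :
    ∃ μ : ℕ → ℝ, (∀ x, {k | μ k = x}.encard = o x) ∧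
      ∃ (C : ℝ) (k₀ : ℕ), ∀ k ≥ k₀, 0 ≤ μ k ∧ |√(μ k) - k / L| ≤ C := by
  obtain ⟨C, A, hA, hcount⟩ := h
  have hfin : ∀ x, mass o (Iio x) ≠ ⊤ := fun x => by
    obtain ⟨n, hn, -⟩ := hcount (√(max x 0)) (Real.sqrt_nonneg _)
    rw [Real.sq_sqrt (le_max_right _ _)] at hn
    exact ne_top_of_le_ne_top (hn ▸ ENat.natCast_ne_top n)
      (mass_mono (Iio_subset_Iio (le_max_left x 0)))
  set T : ℕ → Set ℝ := fun k => {x | o x ≠ 0 ∧ (k : ℕ∞) < mass o (Iic x)} with hT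
  have hTne : ∀ k, (T k).Nonempty := fun k => by
    obtain ⟨n, hn, hnC⟩ := hcount ((|C| + k + 1) / L) (by positivity)
    rw [div_mul_cancel₀ _ hL.ne', abs_le] at hnC
    have hkn : k < n := by
      have : (k : ℝ) < n := by linarith [le_abs_self C]
      exact_mod_cast this
    obtain ⟨y, -, hoy, hy⟩ := exists_mass_Iic_eq (o := o) (hfin _) (by
      rw [hn]; exact_mod_cast (Nat.zero_le k |>.trans_lt hkn).ne')
    refine ⟨y, hoy, ?_⟩
    rw [hy, hn]
    exact_mod_cast hkn
  have hmin : ∀ k, ∃ x ∈ T k, ∀ y ∈ T k, x ≤ y := fun k => by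
    obtain ⟨x₀, hx₀⟩ := hTne k
    have hf : (T k ∩ Iic x₀).Finite := (finite_of_mass_ne_top (hfin (x₀ + 1))).subset
      fun y hy => ⟨lt_of_le_of_lt (show y ≤ x₀ from hy.2) (lt_add_one x₀), hy.1.1⟩
    obtain ⟨x, hx, hxmin⟩ := Set.exists_min_image _ id hf ⟨x₀, hx₀, Set.mem_Iic.2 le_rfl⟩
    refine ⟨x, hx.1, fun y hy => ?_⟩
    rcases le_total y x₀ with h1 | h1
    · exact hxmin y ⟨hy, h1⟩
    · exact hx.2.trans h1
  choose μ hμT hμmin using hmin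
  have hμlow : ∀ k, mass o (Iio (μ k)) ≤ k := fun k => by
    by_contra hcon
    rw [not_le] at hcon
    obtain ⟨y, hy, hoy, hyeq⟩ := exists_mass_Iic_eq (hfin (μ k)) (bot_le.trans_lt hcon).ne'
    exact absurd (hμmin k y ⟨hoy, hyeq ▸ hcon⟩) (not_le.2 hy)
  refine ⟨μ, fun x => ?_, ?_⟩
  · obtain ⟨n, hn⟩ := ENat.ne_top_iff_exists.1 (hfin x)
    have hset : {k | μ k = x} = Ico n (n + o x) := by
      ext k
      rw [mem_ofPred_eq, mem_Ico]
      constructor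
      · rintro rfl
        have h1 := hμlow k
        have h2 := (hμT k).2
        rw [mass_Iic, ← hn] at h2
        rw [← hn] at h1
        exact ⟨by exact_mod_cast h1, by exact_mod_cast h2⟩
      · rintro ⟨h1, h2⟩
        have hx : x ∈ T k := by
          refine ⟨by omega, ?_⟩
          rw [mass_Iic, ← hn]
          exact_mod_cast h2
        refine le_antisymm (hμmin k x hx) (not_lt.1 fun hlt => ?_)
        have h3 : mass o (Iic (μ k)) ≤ mass o (Iio x) := mass_mono (Iic_subset_Iio.2 hlt)
        have h4 := (hμT k).2.trans_le h3
        rw [← hn] at h4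
        have : k < n := by exact_mod_cast h4
        omega
    rw [hset, ← Finset.coe_Ico, Set.encard_coe_eq_coe_finsetCard, Nat.card_Ico]
    simp
  · obtain ⟨n₁, hn₁, hn₁C⟩ := hcount 1 zero_le_one
    refine ⟨|C| / L + 1, n₁, fun k hk => ?_⟩
    have h0 : 0 ≤ μ k := by
      by_contra hcon
      have h1 : mass o (Iic (μ k)) ≤ mass o (Iio (1 ^ 2)) :=
        mass_mono (Iic_subset_Iio.2 (by linarith))
      have h2 := (hμT k).2.trans_le h1
      rw [hn₁] at h2
      have : k < n₁ := by exact_mod_cast h2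
      omega
    refine ⟨h0, ?_⟩
    obtain ⟨n, hn, hnC⟩ := hcount (√(μ k)) (Real.sqrt_nonneg _)
    obtain ⟨n', hn', hnC'⟩ := hcount (√(μ k) + 1) (by positivity)
    have e1 := hμlow k
    rw [Real.sq_sqrt h0] at hn
    rw [hn] at e1
    have e1' : (n : ℝ) ≤ k := by exact_mod_cast e1
    have hlt : μ k < (√(μ k) + 1) ^ 2 := by
      have := Real.sq_sqrt h0
      nlinarith [Real.sqrt_nonneg (μ k)]
    have e2 := (hμT k).2.trans_le (mass_mono (Iic_subset_Iio.2 hlt))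
    rw [hn'] at e2
    have e2' : (k : ℝ) ≤ n' := by exact_mod_cast (ENat.natCast_lt_natCast.1 e2).le
    rw [abs_le] at hnC hnC'
    have hC1 := le_abs_self C
    have hkL : (k : ℝ) / L * L = k := div_mul_cancel₀ _ hL.ne'
    have hCL : |C| / L * L = |C| := div_mul_cancel₀ _ hL.ne'
    rw [abs_le]
    constructor
    · refine le_of_mul_le_mul_right ?_ hL
      rw [sub_mul, neg_mul, add_mul, hkL, hCL]
      linarith
    · refine le_of_mul_le_mul_right ?_ hL
      rw [sub_mul, add_mul, hkL, hCL]
      linarith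

end Enumeration

/-! ### The star graph -/

section Star

variable {q₁ q₂ q₃ q : ℝ → ℝ} {h₁ h₂ h₃ h a d b : ℝ}

lemma intervalIntegrable_of_subinterval (hq : IntegrableOn q (Icc 0 Real.pi)) {s t : ℝ}
    (hs : 0 ≤ s) (hst : s ≤ t) (ht : t ≤ Real.pi) : IntervalIntegrable q volume s t := by
  rw [intervalIntegrable_iff_integrableOn_Icc_of_le hst]
  exact hq.mono_set (Icc_subset_Icc hs ht)

lemma zeroInd_const_mul {g : ℂ → ℂ} {c : ℂ} (hc : c ≠ 0) :
    zeroInd (fun z => c * g z) = zeroInd g := by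
  funext x
  unfold zeroInd
  congr 1
  simp [hc]

lemma herglotzPair_phi (hq : IntegrableOn q (Icc 0 Real.pi)) (h : ℝ) :
    HerglotzPair (fun z => (phi q h z).2 Real.pi) (fun z => (phi q h z).1 Real.pi) := by
  have := herglotzPair_ivpSol Real.pi_pos
    (intervalIntegrable_of_subinterval hq le_rfl Real.pi_pos.le le_rfl) (c := 1) (c' := h)
    (Or.inl one_ne_zero)
  rwa [Complex.ofReal_one] at this

lemma herglotzPair_phiLeft (hq : IntegrableOn q (Icc 0 Real.pi)) (h : ℝ) (hd : 0 < d)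
    (hdπ : d < Real.pi) :
    HerglotzPair (fun z => (phiLeft q h d z).2 d) (fun z => (phiLeft q h d z).1 d) := by
  have := herglotzPair_ivpSol hd
    (intervalIntegrable_of_subinterval hq le_rfl hd.le hdπ.le) (c := 1) (c' := h)
    (Or.inl one_ne_zero)
  rwa [Complex.ofReal_one] at this

lemma herglotzPair_phiRight (hq : IntegrableOn q (Icc 0 Real.pi)) (h b : ℝ) (ha : 0 < a)
    (hd : 0 < d) (hdπ : d < Real.pi) :
    HerglotzPair (fun z => (phiRight q h a d b z).2 Real.pi)
      (fun z => (phiRight q h a d b z).1 Real.pi) :=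
  ((herglotzPair_phiLeft hq h hd hdπ).jump ha.ne' b).propagate hdπ.le
    (intervalIntegrable_of_subinterval hq hd.le hdπ.le le_rfl)

lemma phiRight_eq (hq : IntegrableOn q (Icc 0 Real.pi)) (h a b : ℝ) (hd : 0 < d)
    (hdπ : d < Real.pi) (z : ℂ) :
    (phiRight q h a d b z).1 Real.pi
        = (a * (phiLeft q h d z).1 d) * (ivpSol q z d Real.pi 1 0).1 Real.pi
          + ((a : ℂ)⁻¹ * (phiLeft q h d z).2 d + b * (phiLeft q h d z).1 d)
            * (ivpSol q z d Real.pi 0 1).1 Real.pi ∧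
      (phiRight q h a d b z).2 Real.pi
        = (a * (phiLeft q h d z).1 d) * (ivpSol q z d Real.pi 1 0).2 Real.pi
          + ((a : ℂ)⁻¹ * (phiLeft q h d z).2 d + b * (phiLeft q h d z).1 d)
            * (ivpSol q z d Real.pi 0 1).2 Real.pi :=
  ivpSol_linear hdπ.le (intervalIntegrable_of_subinterval hq hd.le hdπ.le le_rfl) z _ _
    (right_mem_Icc.2 hdπ.le)

/-- Far on the negative axis the solution on the edge with the jump is positive together with its
derivative, and bounded away from zero. -/
lemma phiRight_atBot (hq : IntegrableOn q (Icc 0 Real.pi)) (h b : ℝ) (ha : 0 < a)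
    (hd : 0 < d) (hdπ : d < Real.pi) :
    ∀ᶠ k : ℝ in atTop,
      a / 16 ≤ ((phiRight q h a d b ((-k ^ 2 : ℝ) : ℂ)).1 Real.pi).re ∧
      0 ≤ ((phiRight q h a d b ((-k ^ 2 : ℝ) : ℂ)).2 Real.pi).re := by
  have hq1 := intervalIntegrable_of_subinterval hq le_rfl hd.le hdπ.le
  have hq2 := intervalIntegrable_of_subinterval hq hd.le hdπ.le le_rfl
  filter_upwards [ivpSol_one_atBot hd hq1 h, ivpSol_one_atBot hdπ hq2 0, ivpSol_zero_atBot hdπ hq2,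
    eventually_ge_atTop (16 * a * |b|), eventually_ge_atTop 0] with k hy hu hv hk hk0
  obtain ⟨i1, i2⟩ := (herglotzPair_phiLeft hq h hd hdπ).im_eq_zero (-k ^ 2)
  obtain ⟨e1, e2⟩ := phiRight_eq hq h a b hd hdπ ((-k ^ 2 : ℝ) : ℂ)
  rw [e1, e2]
  change Real.exp _ / 4 ≤ ((phiLeft q h d ((-k ^ 2 : ℝ) : ℂ)).1 d).re ∧
    ((phiLeft q h d ((-k ^ 2 : ℝ) : ℂ)).1 d).re ≤ _ ∧
    _ ≤ ((phiLeft q h d ((-k ^ 2 : ℝ) : ℂ)).2 d).re at hy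
  set y := (phiLeft q h d ((-k ^ 2 : ℝ) : ℂ)).1 d
  set y' := (phiLeft q h d ((-k ^ 2 : ℝ) : ℂ)).2 d
  set u := (ivpSol q ((-k ^ 2 : ℝ) : ℂ) d Real.pi 1 0).1 Real.pi
  set u' := (ivpSol q ((-k ^ 2 : ℝ) : ℂ) d Real.pi 1 0).2 Real.pi
  set v := (ivpSol q ((-k ^ 2 : ℝ) : ℂ) d Real.pi 0 1).1 Real.pi
  set v' := (ivpSol q ((-k ^ 2 : ℝ) : ℂ) d Real.pi 0 1).2 Real.pi
  have hcoef1 : (a : ℂ) * y = ((a * y.re : ℝ) : ℂ) :=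
    Complex.ext (by simp) (by simp [i2])
  have hcoef2 : (a : ℂ)⁻¹ * y' + b * y = ((a⁻¹ * y'.re + b * y.re : ℝ) : ℂ) := by
    rw [← Complex.ofReal_inv]
    exact Complex.ext (by simp) (by simp [i1, i2])
  rw [hcoef1, hcoef2, Complex.add_re, Complex.add_re, Complex.re_ofReal_mul, Complex.re_ofReal_mul,
    Complex.re_ofReal_mul, Complex.re_ofReal_mul]
  have hE : 1 ≤ Real.exp (k * (d - 0)) := Real.one_le_exp (by rw [sub_zero]; positivity)
  have hE' : 1 ≤ Real.exp (k * (Real.pi - d)) :=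
    Real.one_le_exp (mul_nonneg hk0 (sub_nonneg.2 hdπ.le))
  set E := Real.exp (k * (d - 0))
  -- the contribution of the jump coefficient `b` is dominated by that of the derivative
  have hcoef : 0 ≤ a⁻¹ * y'.re + b * y.re := by
    have h1 : |b| * y.re ≤ |b| * (2 * E) := by gcongr; exact hy.2.1
    have h2 : -(|b| * y.re) ≤ b * y.re := by
      have : 0 ≤ y.re := by linarith
      nlinarith [neg_abs_le b]
    have h3 : |b| * (2 * E) ≤ a⁻¹ * (k * E / 8) := by
      have : a⁻¹ * (16 * a * |b|) ≤ a⁻¹ * k := by gcongr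
      have h4 : a⁻¹ * (16 * a * |b|) = 16 * |b| := by field_simp
      nlinarith
    have h4 : a⁻¹ * (k * E / 8) ≤ a⁻¹ * y'.re := by gcongr; exact hy.2.2
    linarith
  have hy4 : 1 / 4 ≤ y.re := by linarith
  have hu4 : 1 / 4 ≤ u.re := by linarith [hu.1]
  have hu' : 0 ≤ u'.re := by
    refine le_trans ?_ hu.2.2
    positivity
  constructor
  · have h1 : a / 16 ≤ a * y.re * u.re := by
      have : (1 / 4 : ℝ) * (1 / 4) ≤ y.re * u.re := by gcongr
      nlinarith
    have h2 := mul_nonneg hcoef hv.1.le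
    linarith
  · have : 0 ≤ a * y.re * u'.re := by positivity
    have h2 := mul_nonneg hcoef hv.2.le
    linarith

/-- The zeros of `φ₁ (π, ·)`: the solutions before and after the jump contribute `R d / π` and
`R (π - d) / π`. -/
lemma countsLike_phiRight (hq : IntegrableOn q (Icc 0 Real.pi)) (h b : ℝ) (ha : 0 < a)
    (hd : 0 < d) (hdπ : d < Real.pi) :
    CountsLike (zeroInd fun z => (phiRight q h a d b z).1 Real.pi) 1 := by
  have hq1 := intervalIntegrable_of_subinterval hq le_rfl hd.le hdπ.le
  have hq2 := intervalIntegrable_of_subinterval hq hd.le hdπ.le le_rfl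
  have ha' : (a : ℂ) ≠ 0 := by exact_mod_cast ha.ne'
  set f : Fin 2 → ℂ → ℂ := ![fun z => (a : ℂ)⁻¹ * (phiLeft q h d z).2 d + b * (phiLeft q h d z).1 d,
    fun z => (ivpSol q z d Real.pi 1 0).1 Real.pi] with hf
  set g : Fin 2 → ℂ → ℂ := ![fun z => a * (phiLeft q h d z).1 d,
    fun z => (ivpSol q z d Real.pi 0 1).1 Real.pi] with hg
  have hpair : ∀ j, HerglotzPair (f j) (g j) := by
    intro j
    fin_cases j
    · exact (herglotzPair_phiLeft hq h hd hdπ).jump ha.ne' b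
    · exact herglotzPair_fundamental hdπ hq2
  have hsum : pairSum f g = fun z => (phiRight q h a d b z).1 Real.pi := by
    funext z
    have h1 : (Finset.univ : Finset (Fin 2)).erase 0 = {1} := by decide
    have h2 : (Finset.univ : Finset (Fin 2)).erase 1 = {0} := by decide
    rw [(phiRight_eq hq h a b hd hdπ z).1, pairSum, Fin.sum_univ_two, h1, h2,
      Finset.prod_singleton, Finset.prod_singleton]
    simp only [hf, hg, Matrix.cons_val_zero, Matrix.cons_val_one]
    ring
  have hcount : ∀ j, CountsLike (zeroInd (g j))
      (![(d - 0) / Real.pi, (Real.pi - d) / Real.pi] j) := by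
    intro j
    fin_cases j
    · change CountsLike (zeroInd fun z => (a : ℂ) * (phiLeft q h d z).1 d) ((d - 0) / Real.pi)
      rw [zeroInd_const_mul ha']
      exact countsLike_ivpSol_one hd hq1 h
    · exact countsLike_ivpSol_zero hdπ hq2
  obtain ⟨A, hA⟩ := exists_of_eventually_neg_sq (p := fun x => pairSum f g x ≠ 0) (by
    filter_upwards [phiRight_atBot hq h b ha hd hdπ] with k hk h0
    rw [hsum] at h0
    simp only at h0
    rw [h0, Complex.zero_re] at hk
    linarith [hk.1])
  have := countsLike_pairSum hpair hcount hA
  rw [hsum, funext (herglotzPair_phiRight hq h b ha hd hdπ).realOrder_eq, Fin.sum_univ_two] at this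
  have hone : (![(d - 0) / Real.pi, (Real.pi - d) / Real.pi] : Fin 2 → ℝ) 0
      + (![(d - 0) / Real.pi, (Real.pi - d) / Real.pi] : Fin 2 → ℝ) 1 = 1 := by
    simp only [Matrix.cons_val_zero, Matrix.cons_val_one]
    field_simp
    ring
  rwa [hone] at this

/-- The derivatives at the central vertex, edge by edge. -/
noncomputable def starF (q₁ q₂ q₃ : ℝ → ℝ) (h₁ h₂ h₃ a d b : ℝ) : Fin 3 → ℂ → ℂ :=
  ![fun z => (phiRight q₁ h₁ a d b z).2 Real.pi, fun z => (phi q₂ h₂ z).2 Real.pi,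
    fun z => (phi q₃ h₃ z).2 Real.pi]

/-- The values at the central vertex, edge by edge. -/
noncomputable def starG (q₁ q₂ q₃ : ℝ → ℝ) (h₁ h₂ h₃ a d b : ℝ) : Fin 3 → ℂ → ℂ :=
  ![fun z => (phiRight q₁ h₁ a d b z).1 Real.pi, fun z => (phi q₂ h₂ z).1 Real.pi,
    fun z => (phi q₃ h₃ z).1 Real.pi]

lemma charFun_apply (z : ℂ) :
    charFun q₁ q₂ q₃ h₁ h₂ h₃ a d b z
      = (phiRight q₁ h₁ a d b z).2 Real.pi * (phi q₂ h₂ z).1 Real.pi * (phi q₃ h₃ z).1 Real.pi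
        + (phiRight q₁ h₁ a d b z).1 Real.pi * (phi q₂ h₂ z).2 Real.pi * (phi q₃ h₃ z).1 Real.pi
        + (phiRight q₁ h₁ a d b z).1 Real.pi * (phi q₂ h₂ z).1 Real.pi
          * (phi q₃ h₃ z).2 Real.pi := by
  simp only [charFun, Matrix.det_fin_three, Matrix.of_apply, Matrix.cons_val', Matrix.cons_val_zero,
    Matrix.cons_val_one, Matrix.cons_val]
  ring

lemma charFun_eq_pairSum :
    charFun q₁ q₂ q₃ h₁ h₂ h₃ a d b
      = pairSum (starF q₁ q₂ q₃ h₁ h₂ h₃ a d b) (starG q₁ q₂ q₃ h₁ h₂ h₃ a d b) := by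
  funext z
  have e0 : (Finset.univ : Finset (Fin 3)).erase 0 = {1, 2} := by decide
  have e1 : (Finset.univ : Finset (Fin 3)).erase 1 = {0, 2} := by decide
  have e2 : (Finset.univ : Finset (Fin 3)).erase 2 = {0, 1} := by decide
  rw [charFun_apply, pairSum, Fin.sum_univ_three, e0, e1, e2, Finset.prod_pair (by decide),
    Finset.prod_pair (by decide), Finset.prod_pair (by decide)]
  simp only [starF, starG, Matrix.cons_val_zero, Matrix.cons_val_one, Matrix.cons_val]
  ring

lemma herglotzPair_star (hq₁ : IntegrableOn q₁ (Icc 0 Real.pi))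
    (hq₂ : IntegrableOn q₂ (Icc 0 Real.pi)) (hq₃ : IntegrableOn q₃ (Icc 0 Real.pi))
    (h₁ h₂ h₃ b : ℝ) (ha : 0 < a) (hd : 0 < d) (hdπ : d < Real.pi) (j : Fin 3) :
    HerglotzPair (starF q₁ q₂ q₃ h₁ h₂ h₃ a d b j) (starG q₁ q₂ q₃ h₁ h₂ h₃ a d b j) := by
  fin_cases j
  · exact herglotzPair_phiRight hq₁ h₁ b ha hd hdπ
  · exact herglotzPair_phi hq₂ h₂
  · exact herglotzPair_phi hq₃ h₃

/-- Far on the negative axis the three terms of `ω` are non-negative, and `φ₁ φ₂ φ₃'` is large. -/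
lemma charFun_atBot (hq₁ : IntegrableOn q₁ (Icc 0 Real.pi))
    (hq₂ : IntegrableOn q₂ (Icc 0 Real.pi)) (hq₃ : IntegrableOn q₃ (Icc 0 Real.pi))
    (h₁ h₂ h₃ b : ℝ) (ha : 0 < a) (hd : 0 < d) (hdπ : d < Real.pi) :
    ∀ᶠ k : ℝ in atTop, a / 512 * Real.exp (Real.pi * k)
      ≤ ‖charFun q₁ q₂ q₃ h₁ h₂ h₃ a d b ((-k ^ 2 : ℝ) : ℂ)‖ := by
  have hi (q : ℝ → ℝ) (hq : IntegrableOn q (Icc 0 Real.pi)) :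
      IntervalIntegrable q volume 0 Real.pi :=
    intervalIntegrable_of_subinterval hq le_rfl Real.pi_pos.le le_rfl
  filter_upwards [phiRight_atBot hq₁ h₁ b ha hd hdπ,
    ivpSol_one_atBot Real.pi_pos (hi q₂ hq₂) h₂, ivpSol_one_atBot Real.pi_pos (hi q₃ hq₃) h₃,
    eventually_ge_atTop 1] with k h1 h2 h3 hk
  refine le_trans ?_ (Complex.re_le_norm _)
  rw [charFun_apply]
  obtain ⟨e1, e1'⟩ := (herglotzPair_phiRight hq₁ h₁ b ha hd hdπ).ofReal_re (-k ^ 2)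
  obtain ⟨e2, e2'⟩ := (herglotzPair_phi hq₂ h₂).ofReal_re (-k ^ 2)
  obtain ⟨e3, e3'⟩ := (herglotzPair_phi hq₃ h₃).ofReal_re (-k ^ 2)
  rw [← e1, ← e1', ← e2, ← e2', ← e3, ← e3']
  simp only [← Complex.ofReal_mul, ← Complex.ofReal_add, Complex.ofReal_re]
  change _ ≤ ((phi q₂ h₂ ((-k ^ 2 : ℝ) : ℂ)).1 Real.pi).re ∧ _ ∧
    _ ≤ ((phi q₂ h₂ ((-k ^ 2 : ℝ) : ℂ)).2 Real.pi).re at h2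
  change _ ≤ ((phi q₃ h₃ ((-k ^ 2 : ℝ) : ℂ)).1 Real.pi).re ∧ _ ∧
    _ ≤ ((phi q₃ h₃ ((-k ^ 2 : ℝ) : ℂ)).2 Real.pi).re at h3
  rw [sub_zero, mul_comm k Real.pi] at h2 h3
  obtain ⟨h1a, h1b⟩ := h1
  obtain ⟨h2a, -, h2b⟩ := h2
  obtain ⟨h3a, -, h3b⟩ := h3
  generalize ((phiRight q₁ h₁ a d b ((-k ^ 2 : ℝ) : ℂ)).1 Real.pi).re = g₁ at *
  generalize ((phiRight q₁ h₁ a d b ((-k ^ 2 : ℝ) : ℂ)).2 Real.pi).re = f₁ at *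
  generalize ((phi q₂ h₂ ((-k ^ 2 : ℝ) : ℂ)).1 Real.pi).re = g₂ at *
  generalize ((phi q₂ h₂ ((-k ^ 2 : ℝ) : ℂ)).2 Real.pi).re = f₂ at *
  generalize ((phi q₃ h₃ ((-k ^ 2 : ℝ) : ℂ)).1 Real.pi).re = g₃ at *
  generalize ((phi q₃ h₃ ((-k ^ 2 : ℝ) : ℂ)).2 Real.pi).re = f₃ at *
  have hE : 1 ≤ Real.exp (Real.pi * k) := Real.one_le_exp (by positivity)
  generalize Real.exp (Real.pi * k) = E at *
  have hkE : 1 ≤ k * E := by nlinarith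
  have p1 : 0 ≤ g₁ := le_trans (by positivity) h1a
  have p2 : 0 ≤ g₂ := by linarith
  have p3 : 0 ≤ g₃ := by linarith
  have p4 : 0 ≤ f₂ := by linarith
  have p5 : 1 / 8 ≤ f₃ := by linarith
  have m1 : a / 16 * (E / 4) * (1 / 8) ≤ g₁ * g₂ * f₃ := by gcongr
  have m2 : 0 ≤ f₁ * g₂ * g₃ := by positivity
  have m3 : 0 ≤ g₁ * f₂ * g₃ := by positivity
  linarith

lemma expSqrtBound_charFun (hq₁ : IntegrableOn q₁ (Icc 0 Real.pi))
    (hq₂ : IntegrableOn q₂ (Icc 0 Real.pi)) (hq₃ : IntegrableOn q₃ (Icc 0 Real.pi))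
    (h₁ h₂ h₃ a b : ℝ) (hd : 0 < d) (hdπ : d < Real.pi) :
    ExpSqrtBound (charFun q₁ q₂ q₃ h₁ h₂ h₃ a d b) := by
  have hi (q : ℝ → ℝ) (hq : IntegrableOn q (Icc 0 Real.pi)) :
      IntervalIntegrable q volume 0 Real.pi :=
    intervalIntegrable_of_subinterval hq le_rfl Real.pi_pos.le le_rfl
  obtain ⟨hy, hy'⟩ := expSqrtBound_ivpSol_one hd.le
    (intervalIntegrable_of_subinterval hq₁ le_rfl hd.le hdπ.le) h₁
  have hqr := intervalIntegrable_of_subinterval hq₁ hd.le hdπ.le le_rfl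
  obtain ⟨hu, hu'⟩ := expSqrtBound_ivpSol_one hdπ.le hqr 0
  obtain ⟨hv, hv'⟩ := expSqrtBound_ivpSol_zero hdπ.le hqr
  obtain ⟨hg₂, hf₂⟩ := expSqrtBound_ivpSol_one Real.pi_pos.le (hi q₂ hq₂) h₂
  obtain ⟨hg₃, hf₃⟩ := expSqrtBound_ivpSol_one Real.pi_pos.le (hi q₃ hq₃) h₃
  have hc := (expSqrtBound_const a).mul hy
  have hc' := ((expSqrtBound_const (a : ℂ)⁻¹).mul hy').add ((expSqrtBound_const b).mul hy)
  have hg₁ := (hc.mul hu).add (hc'.mul hv)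
  have hf₁ := (hc.mul hu').add (hc'.mul hv')
  have := (((hf₁.mul hg₂).mul hg₃).add ((hg₁.mul hf₂).mul hg₃)).add ((hg₁.mul hg₂).mul hf₃)
  convert this using 1
  funext z
  rw [charFun_apply, (phiRight_eq hq₁ h₁ a b hd hdπ z).1, (phiRight_eq hq₁ h₁ a b hd hdπ z).2]
  rfl

lemma countsLike_charFun (hq₁ : IntegrableOn q₁ (Icc 0 Real.pi))
    (hq₂ : IntegrableOn q₂ (Icc 0 Real.pi)) (hq₃ : IntegrableOn q₃ (Icc 0 Real.pi))
    (h₁ h₂ h₃ b : ℝ) (ha : 0 < a) (hd : 0 < d) (hdπ : d < Real.pi) :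
    CountsLike (realOrder (charFun q₁ q₂ q₃ h₁ h₂ h₃ a d b)) 3 := by
  have hcount : ∀ j, CountsLike (zeroInd (starG q₁ q₂ q₃ h₁ h₂ h₃ a d b j)) 1 := by
    have hphi : ∀ (q : ℝ → ℝ) (h : ℝ), IntegrableOn q (Icc 0 Real.pi) →
        CountsLike (zeroInd fun z => (phi q h z).1 Real.pi) 1 := fun q h hq => by
      have := countsLike_ivpSol_one Real.pi_pos
        (intervalIntegrable_of_subinterval hq le_rfl Real.pi_pos.le le_rfl) h
      rwa [sub_zero, div_self Real.pi_pos.ne'] at this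
    intro j
    fin_cases j
    · exact countsLike_phiRight hq₁ h₁ b ha hd hdπ
    · exact hphi q₂ h₂ hq₂
    · exact hphi q₃ h₃ hq₃
  obtain ⟨A, hA⟩ := exists_of_eventually_neg_sq
    (p := fun x => charFun q₁ q₂ q₃ h₁ h₂ h₃ a d b x ≠ 0) (by
      filter_upwards [charFun_atBot hq₁ hq₂ hq₃ h₁ h₂ h₃ b ha hd hdπ] with k hk h0
      rw [h0, norm_zero] at hk
      exact absurd hk (not_le.2 (by positivity)))
  rw [charFun_eq_pairSum] at hA ⊢
  have := countsLike_pairSum (herglotzPair_star hq₁ hq₂ hq₃ h₁ h₂ h₃ b ha hd hdπ) hcount hA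
  simpa using this

/-- The consecutive blocks of three indices, `k = 3 (n - 1) + i`. -/
lemma encard_blocks (μ : ℕ → ℝ) (x : ℝ) :
    {p : ℕ × Fin 3 | 1 ≤ p.1 ∧ μ (3 * (p.1 - 1) + p.2) = x}.encard = {k | μ k = x}.encard := by
  have hinj : Function.Injective fun k : ℕ =>
      ((k / 3 + 1, ⟨k % 3, Nat.mod_lt k (by norm_num)⟩) : ℕ × Fin 3) := by
    intro k k' hk
    simp only [Prod.mk.injEq, Fin.mk.injEq, Nat.add_right_cancel_iff] at hk
    omega
  rw [← hinj.encard_image {k | μ k = x}]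
  congr 1
  ext ⟨n, i⟩
  simp only [mem_ofPred_eq, mem_image, Prod.mk.injEq]
  constructor
  · rintro ⟨hn, hx⟩
    refine ⟨_, hx, by omega, ?_⟩
    ext
    simp only
    omega
  · rintro ⟨k, hk, rfl, rfl⟩
    refine ⟨by omega, ?_⟩
    convert hk using 2
    simp only
    omega

end Star

end StarSL

theorem lemma2p2
    (q₁ q₂ q₃ : ℝ → ℝ) (h₁ h₂ h₃ a d b : ℝ)
    (hq₁ : IntegrableOn q₁ (Set.Icc 0 Real.pi))
    (hq₂ : IntegrableOn q₂ (Set.Icc 0 Real.pi))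
    (hq₃ : IntegrableOn q₃ (Set.Icc 0 Real.pi))
    (hh₁ : h₁ ≠ 0) (hh₂ : h₂ ≠ 0) (hh₃ : h₃ ≠ 0)
    (ha : 0 < a) (hd₀ : 0 < d) (hdπ : d < Real.pi)
    (hjump : 0 < |a - 1| + |b|) :
    -- `ω` is entire
    Differentiable ℂ (StarSL.charFun q₁ q₂ q₃ h₁ h₂ h₃ a d b) ∧
    -- its growth order is `1/2`
    StarSL.growthOrder (StarSL.charFun q₁ q₂ q₃ h₁ h₂ h₃ a d b) = ((1 / 2 : ℝ) : EReal) ∧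
    -- all its zeros are real
    (∀ z : ℂ, StarSL.charFun q₁ q₂ q₃ h₁ h₂ h₃ a d b z = 0 → z.im = 0) ∧
    -- three sequences `lam n i`, `n ≥ 1`, run through the zeros, each zero being listed as often
    -- as its multiplicity (and nothing else being listed), with the stated asymptotics;
    -- the index `i = 0, 1, 2` stands for the first, second and third sequence
    ((a ^ 2 - 1) / (a ^ 2 + 1) < 3 / 4 →
      ∃ lam : ℕ → Fin 3 → ℝ,
        (∀ z : ℂ, Set.encard {p : ℕ × Fin 3 | 1 ≤ p.1 ∧ ((lam p.1 p.2 : ℝ) : ℂ) = z}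
          = analyticOrderAt (StarSL.charFun q₁ q₂ q₃ h₁ h₂ h₃ a d b) z) ∧
        (fun n : ℕ => Complex.sqrt ((lam n 0 : ℝ) : ℂ) - ((n : ℂ) - 1))
          =O[atTop] (fun _ : ℕ => (1 : ℝ)) ∧
        (∀ i : Fin 3, i ≠ 0 →
          (fun n : ℕ => Complex.sqrt ((lam n i : ℝ) : ℂ) - ((n : ℂ) - 1 / 2))
            =O[atTop] (fun _ : ℕ => (1 : ℝ)))) := by
  have hpair := StarSL.herglotzPair_star hq₁ hq₂ hq₃ h₁ h₂ h₃ b ha hd₀ hdπ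
  have hreal : ∀ z : ℂ, StarSL.charFun q₁ q₂ q₃ h₁ h₂ h₃ a d b z = 0 → z.im = 0 := by
    intro z hz
    by_contra him
    rw [StarSL.charFun_eq_pairSum] at hz
    exact StarSL.pairSum_ne_zero hpair him hz
  have hdiff : Differentiable ℂ (StarSL.charFun q₁ q₂ q₃ h₁ h₂ h₃ a d b) := by
    rw [StarSL.charFun_eq_pairSum]
    exact StarSL.differentiable_pairSum hpair
  refine ⟨hdiff, ?_, hreal, fun _ => ?_⟩
  · exact StarSL.growthOrder_eq_half (StarSL.expSqrtBound_charFun hq₁ hq₂ hq₃ h₁ h₂ h₃ a b hd₀ hdπ)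
      (by positivity) (by linarith [Real.pi_gt_three])
      (StarSL.charFun_atBot hq₁ hq₂ hq₃ h₁ h₂ h₃ b ha hd₀ hdπ)
  obtain ⟨μ, hμ, C, k₀, hasymp⟩ :=
    (StarSL.countsLike_charFun hq₁ hq₂ hq₃ h₁ h₂ h₃ b ha hd₀ hdπ).exists_enumeration (by norm_num)
  have hbound : ∀ (i : Fin 3) (e : ℝ), |e| ≤ 1 →
      (fun n : ℕ => Complex.sqrt ((μ (3 * (n - 1) + i) : ℝ) : ℂ) - ((n : ℂ) - (e : ℂ)))
        =O[atTop] (fun _ : ℕ => (1 : ℝ)) := by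
    intro i e he
    refine IsBigO.of_bound (C + 2) ?_
    filter_upwards [eventually_ge_atTop (k₀ + 1)] with n hn
    obtain ⟨h0, hC⟩ := hasymp (3 * (n - 1) + i) (by omega)
    have hsq : Complex.sqrt ((μ (3 * (n - 1) + i) : ℝ) : ℂ)
        = ((√(μ (3 * (n - 1) + i)) : ℝ) : ℂ) := by
      rw [Complex.sqrt_of_nonneg (by exact_mod_cast h0), Complex.ofReal_re]
    have hcast : ((3 * (n - 1) + i : ℕ) : ℝ) / 3 = n - 1 + (i : ℕ) / 3 := by
      rw [Nat.cast_add, Nat.cast_mul, Nat.cast_sub (by omega)]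
      push_cast
      ring
    have hi : ((i : ℕ) : ℝ) ≤ 2 := by exact_mod_cast Nat.le_of_lt_succ i.2
    have hi0 : (0 : ℝ) ≤ (i : ℕ) := Nat.cast_nonneg _
    have hdist : ‖(((√(μ (3 * (n - 1) + i)) - (n - e) : ℝ)) : ℂ)‖ ≤ C + 2 := by
      rw [Complex.norm_real, Real.norm_eq_abs, abs_le]
      rw [hcast, abs_le] at hC
      rw [abs_le] at he
      constructor <;> linarith
    rw [hsq, norm_one, mul_one]
    push_cast at hdist
    exact hdist
  refine ⟨fun n i => μ (3 * (n - 1) + i), fun z => ?_, ?_, fun i _ => ?_⟩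
  · by_cases hz : z.im = 0
    · obtain ⟨x, rfl⟩ : ∃ x : ℝ, (x : ℂ) = z := ⟨z.re, Complex.ext rfl (by simp [hz])⟩
      simp only [Complex.ofReal_inj]
      rw [StarSL.encard_blocks, hμ, StarSL.charFun_eq_pairSum,
        StarSL.analyticOrderAt_pairSum hpair]
    · rw [(hdiff.analyticAt z).analyticOrderAt_eq_zero.2 fun h0 => hz (hreal z h0),
        Set.encard_eq_zero, Set.eq_empty_iff_forall_notMem]
      rintro p ⟨-, rfl⟩
      exact hz (Complex.ofReal_im _)
  · have := hbound 0 1 (by norm_num)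
    simpa using this
  · have := hbound i (1 / 2) (by rw [abs_of_pos] <;> norm_num)
    simpa using this
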